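/- **Lemma 3.3 (Morita).** All gradings are by $\mathbb Z/2$ and all vector spaces are over $\mathbb C$. Let $R=\mathbb C[x_1,\dots,x_N]$ (purely even), let $W\in R$, and let $D$ be a matrix factorisation of $W$: an odd square supermatrix over $R$, of size $2n$ with $n\ge 1$ ($n$ even and $n$ odd rows and columns), with $D^2=W\cdot e$, where $e$ is the identity matrix. Let $A=\operatorname{End}(D)$ be the graded algebra of all supermatrices of this size over $R$, and let $\sigma=\operatorname{diag}(1,\dots,1,-1,\dots,-1)$, so that $\sigma a=(-1)^{|a|}a\sigma$ for homogeneous $a\in A$. For $B\in\{R,A\}$ let $\mathrm{Coder}(T_B)\cong\bigoplus_{m\ge 0}\operatorname{Hom}(B[1]^{\otimes m},B[1])$ be the space of coderivations, of the second kind (only finitely many nonzero components $\Phi_m$), of the tensor coalgebra of $B[1]$, with the graded commutator $[\,\cdot\,,\cdot\,]$ as bracket. Let $\widehat\partial_0+\widehat\partial_2\in\mathrm{Coder}(T_R)$ and $\partial_0+\partial_2\in\mathrm{Coder}(T_A)$ be the codifferentials whose only nonzero components are the curvature, $-W$ for $R$ and $-W\cdot e$ for $A$, and $a\otimes b\mapsto(-1)^{|a|+1}ab$.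 Define the cotrace map $\mathrm{cotr}:\mathrm{Coder}(T_R)\to\mathrm{Coder}(T_A)$ by $\mathrm{cotr}(\Phi)_0=\Phi_0\cdot e$ and, for $m\ge1$, $$\big(\mathrm{cotr}(\Phi)_m(a_1\otimes\dots\otimes a_m)\big)_{kl}=\sum_{i_1,\dots,i_{m-1}=1}^{2n}\Phi_m\big((\sigma^{m+1}a_1)_{ki_1}\otimes(\sigma a_2)_{i_1i_2}\otimes\dots\otimes(\sigma a_m)_{i_{m-1}l}\big).$$ Then: 1. $\mathrm{cotr}$ preserves parity and is a map of graded Lie algebras: $\mathrm{cotr}([\Phi,\Psi])=[\mathrm{cotr}(\Phi),\mathrm{cotr}(\Psi)]$ for all $\Phi,\Psi\in\mathrm{Coder}(T_R)$. 2. $\mathrm{cotr}(\widehat\partial_0+\widehat\partial_2)=\partial_0+\partial_2$. 3. The DG Lie algebras $(\mathrm{Coder}(T_R),[\widehat\partial_0+\widehat\partial_2,\,\cdot\,],[\,\cdot\,,\cdot\,])$ and $(\mathrm{Coder}(T_A),[\partial_0+\partial_2,\,\cdot\,],[\,\cdot\,,\cdot\,])$ are $L_\infty$-algebras (with $\ell_1$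 the differential, $\ell_2(u\wedge v)=(-1)^{|u|+1}[u,v]$ and all other $\ell_n=0$), and the coalgebra morphism with linear part $\mathrm{cotr}$ and no higher components is an $L_\infty$-quasi-isomorphism from the first to the second: it is an $L_\infty$-morphism, and $\mathrm{cotr}$ induces an isomorphism on cohomology. 4. There is also an $L_\infty$-quasi-isomorphism in the opposite direction, from $(\mathrm{Coder}(T_A),[\partial_0+\partial_2,\,\cdot\,],[\,\cdot\,,\cdot\,])$ to $(\mathrm{Coder}(T_R),[\widehat\partial_0+\widehat\partial_2,\,\cdot\,],[\,\cdot\,,\cdot\,])$. -/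

import Mathlib

noncomputable section

namespace MoritaLInf

/-! ## Super vector spaces over `ℂ` -/

/-- The sign `(-1)^p` of a parity `p`. -/
def sgn (p : ZMod 2) : ℂ := (-1) ^ p.val

/-- A `ℤ/2`-grading `V = V₀ ⊕ V₁` of a complex vector space, recorded by its parity operator
`op v = (-1)^{|v|} v`.  Over `ℂ` the gradings correspond exactly to the linear involutions,
see `SuperGrading.isCompl_part`. -/
structure SuperGrading (V : Type*) [AddCommGroup V] [Module ℂ V] where
  op : V →ₗ[ℂ] V
  op_op : ∀ v, op (op v) = v

namespace SuperGrading

variable {V : Type*} [AddCommGroup V] [Module ℂ V]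

/-- The subspace of homogeneous elements of parity `p`. -/
def part (G : SuperGrading V) (p : ZMod 2) : Submodule ℂ V :=
  LinearMap.eqLocus G.op (sgn p • LinearMap.id)

/-- The projection of `V` onto the homogeneous part of parity `p`. -/
def proj (G : SuperGrading V) (p : ZMod 2) : V →ₗ[ℂ] V :=
  (2⁻¹ : ℂ) • (LinearMap.id + sgn p • G.op)

/-- The suspension `V[1]`, with `V[1]_i = V_{i+1}`: all parities are reversed. -/
def shift (G : SuperGrading V) : SuperGrading V where
  op := -G.op
  op_op v := by simp [G.op_op]

/-- The grading for which all of `V` is even. -/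
def even (V : Type*) [AddCommGroup V] [Module ℂ V] : SuperGrading V where
  op := LinearMap.id
  op_op _ := rfl

theorem mem_part (G : SuperGrading V) (p : ZMod 2) (v : V) :
    v ∈ G.part p ↔ G.op v = sgn p • v := Iff.rfl

theorem isCompl_part (G : SuperGrading V) : IsCompl (G.part 0) (G.part 1) := by
  have h0 : sgn 0 = 1 := by simp [sgn]
  have h1 : sgn 1 = -1 := by simp [sgn, ZMod.val_one]
  refine IsCompl.of_eq ?_ ?_
  · refine (Submodule.eq_bot_iff _).2 fun v hv => ?_
    have ha := (G.mem_part 0 v).1 hv.1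
    have hb := (G.mem_part 1 v).1 hv.2
    rw [h0, one_smul] at ha
    rw [h1, ha, neg_smul, one_smul] at hb
    have h2 : (2 : ℂ) • v = 0 := by rw [two_smul]; nth_rewrite 1 [hb]; simp
    exact (smul_eq_zero.1 h2).resolve_left two_ne_zero
  · refine (Submodule.eq_top_iff').2 fun v => Submodule.mem_sup.2
      ⟨(2⁻¹ : ℂ) • (v + G.op v), ?_, (2⁻¹ : ℂ) • (v - G.op v), ?_, ?_⟩
    · rw [mem_part, h0]; simp [G.op_op, add_comm]
    · rw [mem_part, h1]; simp [G.op_op, ← smul_neg]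
    · rw [← smul_add, add_add_sub_cancel, ← two_smul ℂ v, smul_smul]; simp

end SuperGrading

/-! ## Coderivations of the tensor coalgebra, through their components -/

section Coder

variable {U : Type*} [AddCommGroup U] [Module ℂ U]

/-- The space of coderivations, of the second kind, of the tensor coalgebra
`T = ⨁ₙ U^{⊗ n}` of `U = A[1]`.  A coderivation `Φ` is determined by its components
`Φₙ : U^{⊗ n} → U`, which may be prescribed arbitrarily, by
`Φ |_{U^{⊗ n}} = ∑_{i+k+l=n} id^{⊗ i} ⊗ Φₖ ⊗ id^{⊗ l}`;
it is of the second kind if only finitely many components are nonzero. -/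
abbrev Coder (U : Type*) [AddCommGroup U] [Module ℂ U] : Type _ :=
  DirectSum ℕ fun n => MultilinearMap ℂ (fun _ : Fin n => U) U

instance instAddCommGroupCoder : AddCommGroup (Coder U) := inferInstance

/-- The list of arguments
`(ρ a₀, …, ρ aᵢ₋₁, Ψ(aᵢ, …, aᵢ₊ₖ₋₁), aᵢ₊ₖ, …, aₘ₊ₖ₋₁)` of length `m + 1`. -/
def insertArgs {m k : ℕ} (ρ : U →ₗ[ℂ] U) (i : Fin (m + 1))
    (Ψ : MultilinearMap ℂ (fun _ : Fin k => U) U) (a : Fin (m + k) → U) : Fin (m + 1) → U :=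
  fun t =>
    if h : t < i then ρ (a ⟨t, by have := i.2; have : t.1 < i.1 := h; omega⟩)
    else if h' : t = i then Ψ fun s => a ⟨i + s, by have := i.2; have := s.2; omega⟩
    else a ⟨t - 1 + k, by have := t.2; have : ¬ t.1 < i.1 := h; have : t.1 ≠ i.1 := fun e => h' (Fin.ext e); omega⟩

/-- Varying one argument `aⱼ` varies exactly one entry of `insertArgs`, linearly. -/
theorem insertArgs_update {m k : ℕ} (ρ : U →ₗ[ℂ] U) (i : Fin (m + 1))
    (Ψ : MultilinearMap ℂ (fun _ : Fin k => U) U) (a : Fin (m + k) → U) (j : Fin (m + k)) :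
    ∃ (t : Fin (m + 1)) (L : U →ₗ[ℂ] U), ∀ z,
      insertArgs ρ i Ψ (Function.update a j z) = Function.update (insertArgs ρ i Ψ a) t (L z) := by
  have hi := i.2
  have hj := j.2
  rcases lt_or_ge j.1 i.1 with h1 | h1
  · refine ⟨⟨j, by omega⟩, ρ, fun z => funext fun t => ?_⟩
    have ht := t.2
    have e : (fun s : Fin k => Function.update a j z ⟨i + s, by omega⟩)
        = fun s : Fin k => a ⟨i + s, by omega⟩ :=
      funext fun s => Function.update_of_ne (by simp only [ne_eq, Fin.ext_iff]; omega) _ _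
    rw [Function.update_apply]
    simp only [insertArgs, e]
    simp only [Function.update_apply, Fin.ext_iff, Fin.lt_def]
    split_ifs <;> first | rfl | omega
  · rcases lt_or_ge j.1 (i.1 + k) with h2 | h2
    · refine ⟨i, Ψ.toLinearMap (fun s => a ⟨i + s, by omega⟩) ⟨j - i, by omega⟩,
        fun z => funext fun t => ?_⟩
      have ht := t.2
      have e : (fun s : Fin k => Function.update a j z ⟨i + s, by omega⟩)
          = Function.update (fun s : Fin k => a ⟨i + s, by omega⟩) ⟨j - i, by omega⟩ z := by
        funext s
        simp only [Function.update_apply, Fin.ext_iff]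
        split_ifs <;> first | rfl | omega
      rw [Function.update_apply]
      simp only [insertArgs, e, MultilinearMap.toLinearMap_apply]
      rcases lt_trichotomy t.1 i.1 with h3 | h3 | h3
      · rw [dif_pos (Fin.lt_def.2 h3), if_neg (fun h => by simp [h] at h3), dif_pos (Fin.lt_def.2 h3),
          Function.update_of_ne (by simp only [ne_eq, Fin.ext_iff]; omega)]
      · obtain rfl : t = i := Fin.ext h3
        simp
      · have h4 : ¬ t < i := by simp only [Fin.lt_def]; omega
        have h5 : ¬ t = i := by simp only [Fin.ext_iff]; omega
        rw [dif_neg h4, dif_neg h5, if_neg h5, dif_neg h4, dif_neg h5,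
          Function.update_of_ne (by simp only [ne_eq, Fin.ext_iff]; omega)]
    · refine ⟨⟨j + 1 - k, by omega⟩, LinearMap.id, fun z => funext fun t => ?_⟩
      have ht := t.2
      have e : (fun s : Fin k => Function.update a j z ⟨i + s, by omega⟩)
          = fun s : Fin k => a ⟨i + s, by omega⟩ :=
        funext fun s => Function.update_of_ne (by simp only [ne_eq, Fin.ext_iff]; omega) _ _
      rw [Function.update_apply]
      simp only [insertArgs, e, LinearMap.id_apply]
      simp only [Function.update_apply, Fin.ext_iff, Fin.lt_def]
      split_ifs <;> first | rfl | omega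

/-- The composite `Φ ∘ (ρ^{⊗ i} ⊗ Ψ ⊗ id^{⊗ (m-i)})`. -/
def insertAt {m k : ℕ} (ρ : U →ₗ[ℂ] U) (i : Fin (m + 1))
    (Φ : MultilinearMap ℂ (fun _ : Fin (m + 1) => U) U)
    (Ψ : MultilinearMap ℂ (fun _ : Fin k => U) U) :
    MultilinearMap ℂ (fun _ : Fin (m + k) => U) U where
  toFun a := Φ (insertArgs ρ i Ψ a)
  map_update_add' {inst} a j x y := by
    obtain rfl : inst = instDecidableEqFin _ := Subsingleton.elim _ _
    obtain ⟨t, L, h⟩ := insertArgs_update ρ i Ψ a j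
    rw [h, h, h, map_add, Φ.map_update_add]
  map_update_smul' {inst} a j c x := by
    obtain rfl : inst = instDecidableEqFin _ := Subsingleton.elim _ _
    obtain ⟨t, L, h⟩ := insertArgs_update ρ i Ψ a j
    rw [h, h, map_smul, Φ.map_update_smul]

/-- `insertAt` as a bilinear map of `Φ` and `Ψ`. -/
def insertAtBilin {m : ℕ} (k : ℕ) (ρ : U →ₗ[ℂ] U) (i : Fin (m + 1)) :
    MultilinearMap ℂ (fun _ : Fin (m + 1) => U) U →ₗ[ℂ]
      MultilinearMap ℂ (fun _ : Fin k => U) U →ₗ[ℂ] MultilinearMap ℂ (fun _ : Fin (m + k) => U) U :=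
  LinearMap.mk₂ ℂ (insertAt ρ i) (fun _ _ _ => rfl) (fun _ _ _ => rfl)
    (fun Φ Ψ Ψ' => by
      ext a
      have h : ∀ X, insertArgs ρ i X a
          = Function.update (insertArgs ρ i Ψ a) i (X fun s => a ⟨i + s, by omega⟩) := by
        intro X
        ext t
        by_cases ht : t = i
        · subst ht; simp [insertArgs]
        · simp [insertArgs, ht]
      change Φ (insertArgs ρ i (Ψ + Ψ') a) = Φ (insertArgs ρ i Ψ a) + Φ (insertArgs ρ i Ψ' a)
      rw [h (Ψ + Ψ'), h Ψ', add_apply, Φ.map_update_add, ← h Ψ])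
    (fun c Φ Ψ => by
      ext a
      have h : ∀ X, insertArgs ρ i X a
          = Function.update (insertArgs ρ i Ψ a) i (X fun s => a ⟨i + s, by omega⟩) := by
        intro X
        ext t
        by_cases ht : t = i
        · subst ht; simp [insertArgs]
        · simp [insertArgs, ht]
      change Φ (insertArgs ρ i (c • Ψ) a) = c • Φ (insertArgs ρ i Ψ a)
      rw [h (c • Ψ), smul_apply, Φ.map_update_smul, ← h Ψ])

/-- The components of the composite operator `Φ ∘ Ψ` on the tensor coalgebra, where `Ψ` is a
coderivation of parity `q`:
`(Φ ∘ Ψ)ₙ = ∑_{i+k+l=n} Φ_{i+1+l} ∘ (id^{⊗ i} ⊗ Ψₖ ⊗ id^{⊗ l})`.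
By the Koszul rule `Ψ` passes the first `i` arguments at the cost of the sign
`(-1)^{q (|a₁| + … + |aᵢ|)}`. -/
def circ (G : SuperGrading U) (q : ZMod 2) : Coder U →ₗ[ℂ] Coder U →ₗ[ℂ] Coder U :=
  DirectSum.toModule ℂ ℕ _ fun m =>
    match m with
    | 0 => 0
    | m + 1 =>
      LinearMap.flip <| DirectSum.toModule ℂ ℕ _ fun k => LinearMap.flip <|
        ∑ i : Fin (m + 1), (insertAtBilin k (G.op ^ q.val) i).compr₂
          (DirectSum.lof ℂ ℕ (fun n => MultilinearMap ℂ (fun _ : Fin n => U) U) (m + k))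

/-- The grading of the space of coderivations: `Φ` has parity `p` if each component maps
arguments of parities `q₁, …, qₙ` to an element of parity `p + q₁ + … + qₙ`. -/
def coderGrading (G : SuperGrading U) : SuperGrading (Coder U) where
  op := DirectSum.lmap fun _ =>
    (G.op.compMultilinearMapₗ ℂ).comp (MultilinearMap.compLinearMapₗ fun _ => G.op)
  op_op Φ := by
    refine DFinsupp.ext fun n => MultilinearMap.ext fun a => ?_
    simp [DirectSum.lmap_apply, G.op_op]

/-- The graded commutator of coderivations,
`[Φ, Ψ] = Φ ∘ Ψ - (-1)^{|Φ| |Ψ|} Ψ ∘ Φ` on homogeneous elements, extended bilinearly. -/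
def coderBracket (G : SuperGrading U) : Coder U →ₗ[ℂ] Coder U →ₗ[ℂ] Coder U :=
  ∑ p : ZMod 2, ∑ q : ZMod 2,
    ((circ G q).compl₁₂ ((coderGrading G).proj p) ((coderGrading G).proj q)
      - sgn (p * q) •
        (circ G p).flip.compl₁₂ ((coderGrading G).proj p) ((coderGrading G).proj q))

/-- A bilinear map as a multilinear map of two arguments. -/
def bilin {V W : Type*} [AddCommGroup V] [Module ℂ V] [AddCommGroup W] [Module ℂ W]
    (B : V →ₗ[ℂ] V →ₗ[ℂ] W) : MultilinearMap ℂ (fun _ : Fin 2 => V) W where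
  toFun v := B (v 0) (v 1)
  map_update_add' v i x y := by fin_cases i <;> simp
  map_update_smul' v i c x := by fin_cases i <;> simp

/-- The coderivation `∂₀ + ∂₂` of the curved associative algebra `(A, c)`:
`∂₀ = c` and `∂₂(a ⊗ b) = (-1)^{|a| + 1} a b`, the sign being that of the degree of `a` in
`A[1]`. -/
def curvedCodiff {A : Type*} [Ring A] [Algebra ℂ A] (G : SuperGrading A) (c : A) : Coder A :=
  DirectSum.lof ℂ ℕ (fun n => MultilinearMap ℂ (fun _ : Fin n => A) A) 0
      (MultilinearMap.constOfIsEmpty ℂ (fun _ : Fin 0 => A) c)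
    + DirectSum.lof ℂ ℕ (fun n => MultilinearMap ℂ (fun _ : Fin n => A) A) 2
      (bilin ((LinearMap.mul ℂ A).comp G.shift.op))

end Coder

/-! ## `L∞`-algebras and `L∞`-quasi-isomorphisms -/

section LInf

/-- A family of multilinear operations `Fₙ : V^n → V'`, `n ≥ 0`. -/
abbrev Ops (V V' : Type*) [AddCommGroup V] [Module ℂ V] [AddCommGroup V'] [Module ℂ V'] : Type _ :=
  ∀ n : ℕ, MultilinearMap ℂ (fun _ : Fin n => V) V'

/-- The Koszul sign of the stable rearrangement of elements of parities `p₁, …, pₙ` by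
increasing colour: the product of `(-1)^{pᵢ pⱼ}` over all `i < j` with `c j < c i`. -/
def koszulSign {n : ℕ} (p : Fin n → ZMod 2) (c : Fin n → ℕ) : ℂ :=
  ∏ i, ∏ j, if i < j ∧ c j < c i then sgn (p i * p j) else 1

/-- The subsequence of `x₁, …, xₙ` indexed by `S`, in increasing order. -/
def restrictTo {V : Type*} {n : ℕ} (x : Fin n → V) (S : Finset (Fin n)) : Fin S.card → V :=
  fun t => x (S.orderEmbOfFin rfl t)

/-- The set of indices of colour `b`. -/
def block {n k : ℕ} (c : Fin n → Fin k) (b : Fin k) : Finset (Fin n) :=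
  Finset.univ.filter fun i => c i = b

variable {V V' : Type*} [AddCommGroup V] [Module ℂ V] [AddCommGroup V'] [Module ℂ V']

/-- The operations `Fₙ : V[1]^n → V'[1]` are homogeneous of parity `e` and graded symmetric, that
is, they are maps `V[1]^{∧ n} → V'[1]` of degree `e`.  Here `G`, `G'` grade `V`, `V'`. -/
structure IsGradedSymm (G : SuperGrading V) (G' : SuperGrading V') (e : ZMod 2)
    (F : Ops V V') : Prop where
  parity : ∀ (n : ℕ) (p : Fin n → ZMod 2) (x : Fin n → V), (∀ i, x i ∈ G.shift.part (p i)) →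
    F n x ∈ G'.shift.part (e + ∑ i, p i)
  symm : ∀ (n : ℕ) (p : Fin n → ZMod 2) (x : Fin n → V), (∀ i, x i ∈ G.shift.part (p i)) →
    ∀ τ : Equiv.Perm (Fin n),
      F n (fun i => x (τ i)) = koszulSign p (fun i => (τ.symm i : ℕ)) • F n x

/-- The `V'[1]`-component, on `x₁ ∧ … ∧ xₙ`, of the composite of `F` with the coderivation given by
the operations `ℓ`:
`∑_S ± F(ℓ(x_S) ∧ x_{Sᶜ})`, the sum over all subsets `S` of the indices, the sign being the Koszul
sign of `x₁ ∧ … ∧ xₙ = ± x_S ∧ x_{Sᶜ}`. -/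
def compCoder {n : ℕ} (F : Ops V V') (ℓ : Ops V V) (p : Fin n → ZMod 2) (x : Fin n → V) : V' :=
  ∑ S : Finset (Fin n), koszulSign p (fun i => if i ∈ S then 0 else 1) •
    F (Sᶜ.card + 1) (Fin.cons (ℓ S.card (restrictTo x S)) (restrictTo x Sᶜ))

/-- The `V'[1]`-component, on `x₁ ∧ … ∧ xₙ`, of the composite of the coderivation given by the
operations `ℓ'` with the coalgebra morphism given by the operations `F`:
`∑ₖ (1/k!) ∑ ± ℓ'ₖ(F(x_{B₁}) ∧ … ∧ F(x_{Bₖ}))`, the inner sum over all ordered partitions of the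
indices into nonempty blocks `B₁, …, Bₖ`. -/
def compMor {n : ℕ} (ℓ' : Ops V' V') (F : Ops V V') (p : Fin n → ZMod 2) (x : Fin n → V) : V' :=
  open Classical in
  ∑ k ∈ Finset.range (n + 1), (k.factorial : ℂ)⁻¹ •
    ∑ c : Fin n → Fin k, if Function.Surjective c then
      koszulSign p (fun i => (c i : ℕ)) •
        ℓ' k fun b => F (block c b).card (restrictTo x (block c b))
    else 0

/-- The operations `ℓₙ : V[1]^{∧ n} → V[1]` make the super vector space `V` an (uncurved)
`L∞`-algebra: they have degree `1`, `ℓ₀ = 0`, and the coderivation of the symmetric coalgebra of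
`V[1]` that they determine squares to zero. -/
structure IsLInfAlgebra (G : SuperGrading V) (ℓ : Ops V V) : Prop where
  gradedSymm : IsGradedSymm G G 1 ℓ
  zero : ℓ 0 = 0
  sq_zero : ∀ (n : ℕ) (p : Fin n → ZMod 2) (x : Fin n → V), (∀ i, x i ∈ G.shift.part (p i)) →
    compCoder ℓ ℓ p x = 0

/-- The operations `Fₙ : V[1]^{∧ n} → V'[1]`, of degree `0` and with `F₀ = 0`, form an
`L∞`-morphism `(V, ℓ) → (V', ℓ')`: the coalgebra morphism that they determine intertwines the
codifferentials. -/
structure IsLInfMorphism (G : SuperGrading V) (G' : SuperGrading V') (ℓ : Ops V V) (ℓ' : Ops V' V')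
    (F : Ops V V') : Prop where
  gradedSymm : IsGradedSymm G G' 0 F
  zero : F 0 = 0
  intertwines : ∀ (n : ℕ) (p : Fin n → ZMod 2) (x : Fin n → V), (∀ i, x i ∈ G.shift.part (p i)) →
    compCoder F ℓ p x = compMor ℓ' F p x

/-- A multilinear map of one argument as a linear map. -/
def lin (f : MultilinearMap ℂ (fun _ : Fin 1 => V) V') : V →ₗ[ℂ] V' :=
  (MultilinearMap.ofSubsingleton ℂ V V' 0).symm f

/-- The cohomology `ker d / im d` of `d` (with `im d ⊆ ker d` if `d ∘ d = 0`). -/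
abbrev Cohomology (d : V →ₗ[ℂ] V) : Type _ :=
  LinearMap.ker d ⧸ (LinearMap.range d).submoduleOf (LinearMap.ker d)

/-- An `L∞`-quasi-isomorphism: an `L∞`-morphism between `L∞`-algebras whose linear part `F₁`
induces an isomorphism between the cohomologies of `ℓ₁` and `ℓ'₁`. -/
structure IsLInfQuasiIso (G : SuperGrading V) (G' : SuperGrading V') (ℓ : Ops V V) (ℓ' : Ops V' V')
    (F : Ops V V') : Prop where
  source : IsLInfAlgebra G ℓ
  target : IsLInfAlgebra G' ℓ'
  morphism : IsLInfMorphism G G' ℓ ℓ' F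
  quasiIso : ∃ e : Cohomology (lin (ℓ 1)) ≃ₗ[ℂ] Cohomology (lin (ℓ' 1)),
    ∀ (z : LinearMap.ker (lin (ℓ 1))) (z' : LinearMap.ker (lin (ℓ' 1))),
      lin (F 1) z = z' → e (Submodule.Quotient.mk z) = Submodule.Quotient.mk z'

/-- The operations of a DG Lie algebra: `ℓ₁ = d` and `ℓ₂(u ∧ v) = (-1)^{|u| + 1} [u, v]`, the sign
being that of the degree of `u` in `V[1]`; all others vanish. -/
def dgLieOps (G : SuperGrading V) (d : V →ₗ[ℂ] V) (br : V →ₗ[ℂ] V →ₗ[ℂ] V) : Ops V V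
  | 1 => MultilinearMap.ofSubsingleton ℂ V V 0 d
  | 2 => bilin (br.comp G.shift.op)
  | _ => 0

/-- The coalgebra morphism with linear part `f` and no other components. -/
def strictOps (f : V →ₗ[ℂ] V') : Ops V V'
  | 1 => MultilinearMap.ofSubsingleton ℂ V V' 0 f
  | _ => 0

/-- The operations on `Coder(T)`, `T` the tensor coalgebra of `U`, of the DG Lie algebra with
differential `[Q, ·]` and the graded commutator as bracket. -/
def coderOps {U : Type*} [AddCommGroup U] [Module ℂ U] (G : SuperGrading U) (Q : Coder U) :
    Ops (Coder U) (Coder U) :=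
  dgLieOps (coderGrading G) (coderBracket G Q) (coderBracket G)

end LInf

/-! ## Matrix factorisations and the cotrace map -/

section Cotrace

/-- The polynomial ring `R = ℂ[x₁, …, x_N]`. -/
abbrev Poly (N : ℕ) : Type := MvPolynomial (Fin N) ℂ

/-- Square supermatrices with entries in `R`, with `n` even and `n` odd rows and columns. -/
abbrev SuperMat (N n : ℕ) : Type := Matrix (Fin n ⊕ Fin n) (Fin n ⊕ Fin n) (Poly N)

/-- The matrix `σ = diag(1, …, 1, -1, …, -1)`. -/
def sigma (N n : ℕ) : SuperMat N n := Matrix.diagonal (Sum.elim (fun _ => 1) fun _ => -1)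

theorem sigma_mul_sigma (N n : ℕ) : sigma N n * sigma N n = 1 := by
  rw [sigma, Matrix.diagonal_mul_diagonal, ← Matrix.diagonal_one]
  congr 1
  ext i
  cases i <;> simp

/-- The grading of supermatrices: `σ a = (-1)^{|a|} a σ`, so that even supermatrices are block
diagonal and odd ones are block off-diagonal. -/
def superMatGrading (N n : ℕ) : SuperGrading (SuperMat N n) where
  op := (LinearMap.mulLeft ℂ (sigma N n)).comp (LinearMap.mulRight ℂ (sigma N n))
  op_op a := by
    change sigma N n * (sigma N n * (a * sigma N n) * sigma N n) = a
    rw [mul_assoc, mul_assoc, sigma_mul_sigma, mul_one, ← mul_assoc, sigma_mul_sigma, one_mul]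

/-- A matrix factorisation of `W`: an odd supermatrix `D` of positive size `2n`, with
`D² = W · e`. -/
structure MatrixFactorization {N : ℕ} (W : Poly N) (n : ℕ) where
  D : SuperMat N n
  size_pos : 0 < n
  odd : D ∈ (superMatGrading N n).part 1
  sq : D * D = W • (1 : SuperMat N n)

/-- The `ℤ/2`-graded algebra `A = End(D)` of off-shell open string operators: all polynomial
supermatrices of the size of `D`. -/
abbrev MatrixFactorization.EndAlg {N : ℕ} {W : Poly N} {n : ℕ} (_D : MatrixFactorization W n) :
    Type :=
  SuperMat N n

/-- The linear map `a ↦ (σ^{m+1} a)_{kl}` for the first of `m` arguments (`t = 0`), and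
`a ↦ (σ a)_{kl}` for all others. -/
def cotrEntry {N n : ℕ} (m t : ℕ) (k l : Fin n ⊕ Fin n) : SuperMat N n →ₗ[ℂ] Poly N :=
  (Matrix.entryLinearMap ℂ (Poly N) k l).comp
    (LinearMap.mulLeft ℂ (sigma N n ^ (if t = 0 then m + 1 else 1)))

/-- The component of arity `m` of the cotrace map,
`cotr(Φ)ₘ(a₁ ⊗ … ⊗ aₘ)_{kl} =
  ∑_{i₁, …, iₘ₋₁} Φₘ((σ^{m+1} a₁)_{k i₁} ⊗ (σ a₂)_{i₁ i₂} ⊗ … ⊗ (σ aₘ)_{iₘ₋₁ l})`.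
The sum runs over all index paths `i₀, …, iₘ`, and each contributes to the matrix entry
`(k, l) = (i₀, iₘ)`; for `m = 0` this is `Φ₀ · e`. -/
def cotrComp (N n m : ℕ) :
    MultilinearMap ℂ (fun _ : Fin m => Poly N) (Poly N) →ₗ[ℂ]
      MultilinearMap ℂ (fun _ : Fin m => SuperMat N n) (SuperMat N n) :=
  ∑ i : Fin (m + 1) → Fin n ⊕ Fin n,
    ((Matrix.singleLinearMap ℂ (i 0) (i (Fin.last m))).compMultilinearMapₗ ℂ).comp
      (MultilinearMap.compLinearMapₗ fun t : Fin m => cotrEntry m t (i t.castSucc) (i t.succ))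

/-- The cotrace map `Coder(T_R) → Coder(T_A)`. -/
def cotr {N : ℕ} {W : Poly N} {n : ℕ} (D : MatrixFactorization W n) :
    Coder (Poly N) →ₗ[ℂ] Coder D.EndAlg :=
  DirectSum.lmap fun m => cotrComp N n m

/-- The grading of `R[1]`, where `R` is even. -/
abbrev gradR (N : ℕ) : SuperGrading (Poly N) := (SuperGrading.even (Poly N)).shift

/-- The grading of `A[1]`. -/
abbrev gradA {N : ℕ} {W : Poly N} {n : ℕ} (D : MatrixFactorization W n) :
    SuperGrading D.EndAlg := (superMatGrading N n).shift

/-- The codifferential `∂̂₀ + ∂̂₂` on `T_R` with curvature `-W`. -/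
def codiffR {N : ℕ} (W : Poly N) : Coder (Poly N) :=
  curvedCodiff (SuperGrading.even (Poly N)) (-W)

/-- The codifferential `∂₀ + ∂₂` on `T_A` with curvature `-W · e`. -/
def codiffA {N : ℕ} {W : Poly N} {n : ℕ} (D : MatrixFactorization W n) : Coder D.EndAlg :=
  curvedCodiff (superMatGrading N n) (-(W • (1 : SuperMat N n)))

end Cotrace

end MoritaLInf

end

noncomputable section

namespace MoritaLInf

open TensorAlgebra

/-! ## Signs and gradings -/

/-! `cotr` is Morita invariance at the level of Hochschild cochains: `A` is a full matrix algebra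
over `R`, and a cochain of `R` is evaluated along all index paths of a product of matrices, the
powers of `σ` accounting for the grading. Restriction to the corner of an even index `o` is a left
inverse (`restrictCorner_cotr`), so `cotr` is injective. It remains to see that it is a morphism of
DG Lie algebras, that its cokernel is acyclic, and that these facts give `L∞`-quasi-isomorphisms
both ways.

Lie structure. A coderivation is encoded by a functional `toFun Φ` on the tensor algebra and by the
operator `hat` that this functional generates. Brackets become graded commutators of operators
(`hat_bracket`), so the Jacobi identity is associativity of composition. The functional of `cotr Φ`
is, up to a sign, that of `Φ` pulled back along the algebra morphism `pathMat` (`toFun_cotr`), and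
`pathMat` intertwines the operators (`pathMat_hat`).

Acyclicity. For the product alone, inserting matrix units `e_{oi}` into words gives a homotopy from
the identity to `cotr` after restriction (`homotopy_contractUnit`). Bracketing with the product
raises arity by one, bracketing with the curvature lowers it by one. Since only finitely many
components are nonzero, an induction on the top arity therefore absorbs the curvature
(`exists_sub_bracket_of_mem`).

Inverse. Over a field, an injective map `f` of complexes with acyclic cokernel is part of a
contraction with retraction `p` and homotopy `s` (`exists_contraction`). As `p` need not respect
brackets, it has to be completed by higher components. Operations are represented by functionals on
the tensor algebra, graded symmetry being the vanishing on the ideal of graded commutators, and a DG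
Lie structure by a codifferential `Q` there. Let `η` be the derivation extending `s`. Then `Qη + ηQ
= N + R`, where `N` counts the letters in the kernel of `p` and `R` shortens words. The conditions
that `F` kill `Qη + ηQ` and restrict to `pr₁` on words in the image of `f` determine `F`, through an
equation with a locally nilpotent perturbation. The defect of the morphism equation satisfies the
same conditions with zero on the right, hence vanishes (`OddLie.exists_morphism`). -/

@[simp] theorem sgn_zero : sgn 0 = 1 := by simp [sgn]

@[simp] theorem sgn_one : sgn 1 = -1 := by simp [sgn, ZMod.val_one]

theorem zmod2_cases (p : ZMod 2) : p = 0 ∨ p = 1 := by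
  fin_cases p
  · exact Or.inl rfl
  · exact Or.inr rfl

theorem one_add_one_zmod2 : (1 + 1 : ZMod 2) = 0 := rfl

theorem sgn_add (p q : ZMod 2) : sgn (p + q) = sgn p * sgn q := by
  rcases zmod2_cases p with rfl | rfl <;> rcases zmod2_cases q with rfl | rfl <;>
    simp [one_add_one_zmod2]

theorem sgn_mul_self (p : ZMod 2) : sgn p * sgn p = 1 := by
  rcases zmod2_cases p with rfl | rfl <;> simp

theorem sgn_ne_zero (p : ZMod 2) : sgn p ≠ 0 := fun h => by simpa [h] using sgn_mul_self p

theorem sgn_smul_sgn_smul {M : Type*} [AddCommGroup M] [Module ℂ M] (p : ZMod 2) (x : M) :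
    sgn p • sgn p • x = x := by
  rw [smul_smul, sgn_mul_self, one_smul]

theorem val_one_zmod2 : (1 : ZMod 2).val = 1 := rfl

namespace SuperGrading

variable {V : Type*} [AddCommGroup V] [Module ℂ V] (G : SuperGrading V)

theorem op_of_mem {p : ZMod 2} {v : V} (h : v ∈ G.part p) : G.op v = sgn p • v := h

theorem proj_apply (p : ZMod 2) (v : V) : G.proj p v = (2⁻¹ : ℂ) • (v + sgn p • G.op v) := rfl

theorem proj_mem (p : ZMod 2) (v : V) : G.proj p v ∈ G.part p := by
  rw [mem_part, proj_apply, map_smul, map_add, map_smul, G.op_op, smul_comm (sgn p) (2⁻¹ : ℂ),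
    smul_add (sgn p), smul_smul (sgn p) (sgn p), sgn_mul_self, one_smul, add_comm]

theorem proj_zero_add_proj_one (v : V) : G.proj 0 v + G.proj 1 v = v := by
  simp only [proj_apply, sgn_zero, sgn_one]
  module

theorem proj_of_mem {p : ZMod 2} {v : V} (h : v ∈ G.part p) (q : ZMod 2) :
    G.proj q v = if q = p then v else 0 := by
  rw [proj_apply, G.op_of_mem h]
  rcases zmod2_cases p with rfl | rfl <;> rcases zmod2_cases q with rfl | rfl <;>
    simp only [sgn_zero, sgn_one, if_true, zero_ne_one, one_ne_zero, if_false] <;> module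

theorem op_pow_of_mem {p : ZMod 2} {v : V} (h : v ∈ G.part p) (q : ZMod 2) :
    (G.op ^ q.val) v = sgn (q * p) • v := by
  rcases zmod2_cases q with rfl | rfl
  · simp
  · rw [val_one_zmod2, pow_one, one_mul, G.op_of_mem h]

theorem shift_op (v : V) : G.shift.op v = -G.op v := rfl

theorem mem_shift_part {p : ZMod 2} {v : V} : v ∈ G.shift.part p ↔ v ∈ G.part (p + 1) := by
  rw [mem_part, mem_part, shift_op, sgn_add, sgn_one, mul_neg_one, neg_smul, neg_eq_iff_eq_neg]

theorem hom_induction {C : V → Prop} (add : ∀ x y, C x → C y → C (x + y))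
    (hom : ∀ p, ∀ x ∈ G.part p, C x) (x : V) : C x := by
  rw [← G.proj_zero_add_proj_one x]
  exact add _ _ (hom 0 _ (G.proj_mem 0 x)) (hom 1 _ (G.proj_mem 1 x))

end SuperGrading

/-! ## Recursion and induction on the tensor algebra -/

abbrev TA (V : Type*) [AddCommGroup V] [Module ℂ V] : Type _ := TensorAlgebra ℂ V

section Recursor

variable {V M : Type*} [AddCommGroup V] [Module ℂ V] [AddCommGroup M] [Module ℂ M]

/-- The letter `x` of the tensor algebra. -/
abbrev lt : V →ₗ[ℂ] TA V := TensorAlgebra.ι ℂ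

/-- The recursion refers to the tail of a word as well as to its value on the tail, so letters act
on pairs (tail, value). The universal property of the tensor algebra extends this action to all
words. -/
def recStep (a : V →ₗ[ℂ] TA V →ₗ[ℂ] M) (b : V →ₗ[ℂ] M →ₗ[ℂ] M) :
    V →ₗ[ℂ] Module.End ℂ (TA V × M) where
  toFun x := LinearMap.prod ((LinearMap.mulLeft ℂ (lt x)).comp (LinearMap.fst ℂ _ _))
    ((a x).comp (LinearMap.fst ℂ _ _) + (b x).comp (LinearMap.snd ℂ _ _))
  map_add' x y := by
    ext <;> simp [add_mul]
  map_smul' c x := by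
    ext <;> simp

theorem recStep_apply (a : V →ₗ[ℂ] TA V →ₗ[ℂ] M) (b : V →ₗ[ℂ] M →ₗ[ℂ] M) (x : V) (u : TA V × M) :
    recStep a b x u = (lt x * u.1, a x u.1 + b x u.2) := rfl

/-- The linear map on the tensor algebra with prescribed value at `1` and prescribed
dependence on the first letter. -/
def recL (m₀ : M) (a : V →ₗ[ℂ] TA V →ₗ[ℂ] M) (b : V →ₗ[ℂ] M →ₗ[ℂ] M) : TA V →ₗ[ℂ] M :=
  (LinearMap.snd ℂ _ _).comp
    ((LinearMap.applyₗ ((1 : TA V), m₀)).comp (TensorAlgebra.lift ℂ (recStep a b)).toLinearMap)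

theorem ta_induction {C : TA V → Prop} (one : C 1) (add : ∀ s t, C s → C t → C (s + t))
    (smul : ∀ (c : ℂ) t, C t → C (c • t)) (mul : ∀ x t, C t → C (lt x * t)) (t : TA V) : C t := by
  -- The built-in induction splits arbitrary products; carrying a right factor `u` turns it into
  -- removal of one letter at a time from the left.
  have h : ∀ t u : TA V, C u → C (t * u) := by
    intro t
    induction t using TensorAlgebra.induction with
    | algebraMap r => intro u hu; rw [← Algebra.smul_def]; exact smul r u hu
    | ι x => exact mul x
    | mul a b ha hb => intro u hu; rw [mul_assoc]; exact ha _ (hb _ hu)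
    | add a b ha hb => intro u hu; rw [add_mul]; exact add _ _ (ha _ hu) (hb _ hu)
  simpa using h t 1 one

theorem ta_hom_induction (G : SuperGrading V) {C : TA V → Prop} (one : C 1)
    (add : ∀ s t, C s → C t → C (s + t)) (smul : ∀ (c : ℂ) t, C t → C (c • t))
    (mul : ∀ p, ∀ x ∈ G.part p, ∀ t, C t → C (lt x * t)) (t : TA V) : C t := by
  refine ta_induction one add smul (fun x t ht => ?_) t
  refine G.hom_induction (C := fun x => C (lt x * t)) (fun x y hx hy => ?_)
    (fun p x hx => mul p x hx t ht) x
  rw [map_add, add_mul]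
  exact add _ _ hx hy

theorem ta_ext {f g : TA V →ₗ[ℂ] M} (one : f 1 = g 1)
    (mul : ∀ x t, f t = g t → f (lt x * t) = g (lt x * t)) : f = g :=
  LinearMap.ext fun t => ta_induction (C := fun t => f t = g t) one
    (fun s t hs ht => by rw [map_add, map_add, hs, ht])
    (fun c t ht => by rw [map_smul, map_smul, ht]) mul t

theorem ta_hom_ext (G : SuperGrading V) {f g : TA V →ₗ[ℂ] M} (one : f 1 = g 1)
    (mul : ∀ p, ∀ x ∈ G.part p, ∀ t, f t = g t → f (lt x * t) = g (lt x * t)) : f = g :=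
  LinearMap.ext fun t => ta_hom_induction G (C := fun t => f t = g t) one
    (fun s t hs ht => by rw [map_add, map_add, hs, ht])
    (fun c t ht => by rw [map_smul, map_smul, ht]) mul t

/-- Two linear maps agree if they agree on `1` and on products with a first letter. -/
theorem ta_cases_ext {f g : TA V →ₗ[ℂ] M} (one : f 1 = g 1)
    (mul : ∀ x t, f (lt x * t) = g (lt x * t)) : f = g :=
  ta_ext one fun x t _ => mul x t

variable (m₀ : M) (a : V →ₗ[ℂ] TA V →ₗ[ℂ] M) (b : V →ₗ[ℂ] M →ₗ[ℂ] M)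

@[simp] theorem recL_one : recL m₀ a b 1 = m₀ := by simp [recL]

theorem recL_mul (x : V) (t : TA V) : recL m₀ a b (lt x * t) = a x t + b x (recL m₀ a b t) := by
  -- The first coordinate rebuilds the word that has been read, so the second one has access to the
  -- tail.
  have h : ∀ t : TA V, (TensorAlgebra.lift ℂ (recStep a b) t (1, m₀)).1 = t := by
    intro t
    refine ta_induction (C := fun t => (TensorAlgebra.lift ℂ (recStep a b) t (1, m₀)).1 = t)
      ?_ ?_ ?_ ?_ t
    · simp
    · intro s t hs ht; simp [hs, ht]
    · intro c t ht; simp [ht]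
    · intro x t ht; simp [recStep_apply, ht]
  simp [recL, recStep_apply, h]

/-- The word with letters `l`. -/
def word (l : List V) : TA V := (l.map lt).prod

@[simp] theorem word_nil : word ([] : List V) = 1 := rfl

@[simp] theorem word_cons (x : V) (l : List V) : word (x :: l) = lt x * word l := by
  simp [word]

theorem word_append (l l' : List V) : word (l ++ l') = word l * word l' := by
  simp [word]

theorem tprod_eq_word {n : ℕ} (x : Fin n → V) :
    TensorAlgebra.tprod ℂ V n x = word (List.ofFn x) := by
  rw [TensorAlgebra.tprod_apply, word, List.map_ofFn]
  rfl

theorem word_induction {C : TA V → Prop} (add : ∀ s t, C s → C t → C (s + t))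
    (smul : ∀ (c : ℂ) t, C t → C (c • t)) (wd : ∀ l, C (word l)) (t : TA V) : C t := by
  have h : ∀ t : TA V, ∀ l, C (word l * t) := by
    refine ta_induction ?_ ?_ ?_ ?_
    · intro l; simpa using wd l
    · intro s t hs ht l; rw [mul_add]; exact add _ _ (hs l) (ht l)
    · intro c t ht l; rw [mul_smul_comm]; exact smul _ _ (ht l)
    · intro x t ht l
      have := ht (l ++ [x])
      rwa [word_append, word_cons, word_nil, mul_one, mul_assoc] at this
  simpa using h t []

theorem word_ext {f g : TA V →ₗ[ℂ] M} (h : ∀ l, f (word l) = g (word l)) : f = g :=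
  LinearMap.ext fun t => word_induction (C := fun t => f t = g t)
    (fun s t hs ht => by rw [map_add, map_add, hs, ht])
    (fun c t ht => by rw [map_smul, map_smul, ht]) h t

theorem tprod_ext {f g : TA V →ₗ[ℂ] M}
    (h : ∀ n x, f (TensorAlgebra.tprod ℂ V n x) = g (TensorAlgebra.tprod ℂ V n x)) : f = g := by
  refine word_ext fun l => ?_
  have := h l.length l.get
  rwa [tprod_eq_word, List.ofFn_get] at this

end Recursor

/-! ### Functoriality of the tensor algebra and its projection to degree one. -/

section Map

variable {V V' : Type*} [AddCommGroup V] [Module ℂ V] [AddCommGroup V'] [Module ℂ V']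

/-- The algebra homomorphism of tensor algebras induced by a linear map. -/
def tmap (f : V →ₗ[ℂ] V') : TA V →ₐ[ℂ] TA V' := TensorAlgebra.lift ℂ (lt.comp f)

@[simp] theorem tmap_lt (f : V →ₗ[ℂ] V') (x : V) : tmap f (lt x) = lt (f x) := by
  simp [tmap]

theorem tmap_mul (f : V →ₗ[ℂ] V') (x : V) (t : TA V) :
    tmap f (lt x * t) = lt (f x) * tmap f t := by
  rw [map_mul, tmap_lt]

theorem tmap_word (f : V →ₗ[ℂ] V') (l : List V) : tmap f (word l) = word (l.map f) := by
  induction l with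
  | nil => simp
  | cons x l ih => simp [ih]

/-- The projection of the tensor algebra to its part of degree one. -/
def pr₁ : TA V →ₗ[ℂ] V :=
  recL 0 (LinearMap.mk₂ ℂ (fun x t => TensorAlgebra.algebraMapInv t • x)
    (fun x y t => smul_add _ _ _) (fun c x t => smul_comm _ _ _)
    (fun x s t => by rw [map_add, add_smul])
    (fun c x t => by rw [map_smul, smul_eq_mul, mul_smul])) 0

@[simp] theorem pr₁_one : pr₁ (1 : TA V) = 0 := recL_one _ _ _

theorem pr₁_mul (x : V) (t : TA V) : pr₁ (lt x * t) = TensorAlgebra.algebraMapInv t • x := by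
  rw [pr₁, recL_mul]
  simp

@[simp] theorem pr₁_lt (x : V) : pr₁ (lt x) = x := by
  simpa using pr₁_mul x 1

theorem aug_lt (x : V) : TensorAlgebra.algebraMapInv (lt x) = (0 : ℂ) := by
  simp [TensorAlgebra.algebraMapInv, lt]

@[simp] theorem aug_mul (x : V) (t : TA V) : TensorAlgebra.algebraMapInv (lt x * t) = (0 : ℂ) := by
  rw [map_mul, aug_lt, zero_mul]

@[simp] theorem pr₁_mul_mul (x y : V) (t : TA V) : pr₁ (lt x * (lt y * t)) = 0 := by
  rw [pr₁_mul, aug_mul, zero_smul]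

end Map

end MoritaLInf

end

noncomputable section

namespace MoritaLInf

open TensorAlgebra

/-! ## Coderivations as functionals on the tensor algebra -/

section Hat

variable {U : Type*} [AddCommGroup U] [Module ℂ U]

/-- The functional `t ↦ φ (x t)`. -/
abbrev shiftBy (φ : TA U →ₗ[ℂ] U) (x : U) : TA U →ₗ[ℂ] U := φ.comp (LinearMap.mulLeft ℂ (lt x))

/-- Applies `ψ` to an initial segment and `B` to the rest of a word, summed over all initial
segments. -/
def front (B : TA U →ₗ[ℂ] TA U) : TA U →ₗ[ℂ] (TA U →ₗ[ℂ] U) →ₗ[ℂ] TA U :=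
  recL
    ((LinearMap.mulRight ℂ (B 1)).comp (lt.comp (LinearMap.applyₗ 1)))
    (LinearMap.mk₂ ℂ (fun x t =>
        (LinearMap.mulRight ℂ (B (lt x * t))).comp (lt.comp (LinearMap.applyₗ 1)))
      (fun x y t => by ext; simp [add_mul, mul_add]) (fun c x t => by ext; simp)
      (fun x s t => by ext; simp [mul_add]) (fun c x t => by ext; simp))
    -- The recursion takes values in maps depending on the functional: a letter that is read becomes
    -- the first argument, which replaces `φ` by `shiftBy φ x`.
    (LinearMap.mk₂ ℂ (fun x (m : (TA U →ₗ[ℂ] U) →ₗ[ℂ] TA U) =>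
        m.comp (LinearMap.lcomp ℂ U (LinearMap.mulLeft ℂ (lt x))))
      (fun x y m => by
        ext φ
        have : shiftBy φ (x + y) = shiftBy φ x + shiftBy φ y := by ext; simp [add_mul]
        exact (congrArg m this).trans (map_add m _ _))
      (fun c x m => by
        ext φ
        have : shiftBy φ (c • x) = c • shiftBy φ x := by ext; simp
        exact (congrArg m this).trans (map_smul m _ _))
      (fun x m m' => rfl) (fun c x m => rfl))

@[simp] theorem front_one (B : TA U →ₗ[ℂ] TA U) (ψ : TA U →ₗ[ℂ] U) :
    front B 1 ψ = lt (ψ 1) * B 1 := by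
  rw [front, recL_one]; rfl

/-- The empty initial segment is allowed. It gives the term with `ψ 1`, through which components of
arity zero, such as a curvature, enter. -/
theorem front_mul (B : TA U →ₗ[ℂ] TA U) (ψ : TA U →ₗ[ℂ] U) (x : U) (t : TA U) :
    front B (lt x * t) ψ = lt (ψ 1) * B (lt x * t) + front B t (shiftBy ψ x) := by
  rw [front, recL_mul]; rfl

/-- The coderivation with components `φ`, where `ρ` is applied to the letters it passes. -/
def hat (ρ : U →ₗ[ℂ] U) (φ : TA U →ₗ[ℂ] U) : TA U →ₗ[ℂ] TA U :=
  recL (lt (φ 1))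
    (LinearMap.mk₂ ℂ (fun x t => front LinearMap.id (lt x * t) φ)
      (fun x y t => by simp [add_mul]) (fun c x t => by simp)
      (fun x s t => by simp [mul_add]) (fun c x t => by simp))
    ((LinearMap.mul ℂ (TA U)).comp (lt.comp ρ))

@[simp] theorem hat_one (ρ : U →ₗ[ℂ] U) (φ : TA U →ₗ[ℂ] U) : hat ρ φ 1 = lt (φ 1) := by
  rw [hat, recL_one]

theorem hat_mul (ρ : U →ₗ[ℂ] U) (φ : TA U →ₗ[ℂ] U) (x : U) (t : TA U) :
    hat ρ φ (lt x * t) = front LinearMap.id (lt x * t) φ + lt (ρ x) * hat ρ φ t := by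
  rw [hat, recL_mul]; rfl

/-- The functional `t ↦ ψ(E t)`, where `E` applies `θ` to initial segments. -/
def inFront (ψ θ : TA U →ₗ[ℂ] U) : TA U →ₗ[ℂ] U :=
  ψ.comp ((front LinearMap.id).flip θ)

theorem inFront_apply (ψ θ : TA U →ₗ[ℂ] U) (t : TA U) :
    inFront ψ θ t = ψ (front LinearMap.id t θ) := rfl

/-- Applies `ψ` to initial segments of a word with first letter `y` prescribed by `θ`. -/
theorem front_front (ψ θ : TA U →ₗ[ℂ] U) (t : TA U) :
    front LinearMap.id (front LinearMap.id t θ) ψ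
      = front LinearMap.id t (inFront ψ θ) + lt (ψ 1) * front LinearMap.id t θ := by
  refine ta_induction (C := fun t => ∀ ψ θ : TA U →ₗ[ℂ] U,
    front LinearMap.id (front LinearMap.id t θ) ψ
      = front LinearMap.id t (inFront ψ θ) + lt (ψ 1) * front LinearMap.id t θ) ?_ ?_ ?_ ?_ t ψ θ
  · intro ψ θ
    simp only [front_one, LinearMap.id_apply, mul_one, inFront_apply]
    nth_rewrite 1 [← mul_one (lt (θ 1))]
    rw [front_mul]
    simp [add_comm]
  · intro s t hs ht ψ θ
    simp only [map_add, LinearMap.add_apply, hs, ht, mul_add]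
    abel
  · intro c t ht ψ θ
    simp only [map_smul, LinearMap.smul_apply, ht, mul_smul_comm, smul_add]
  · intro x t ht ψ θ
    -- When `x` is read, either it becomes an argument of `θ`, or `θ` takes the empty segment and
    -- `x` follows the value `θ 1` as an argument of `ψ`.
    have h : inFront ψ (shiftBy θ x) + shiftBy (shiftBy ψ (θ 1)) x = shiftBy (inFront ψ θ) x := by
      ext u
      simp [inFront_apply, front_mul, add_comm]
    simp only [front_mul, map_add, LinearMap.add_apply, LinearMap.id_apply, ht, mul_add]
    rw [← h]
    simp only [map_add, inFront_apply, front_one, LinearMap.id_apply, mul_one]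
    simp only [LinearMap.comp_apply, LinearMap.mulLeft_apply, mul_one]
    abel

theorem shiftBy_comp_tmap (ψ : TA U →ₗ[ℂ] U) (ρ : U →ₗ[ℂ] U) (x : U) :
    shiftBy (ψ.comp (tmap ρ).toLinearMap) x = (shiftBy ψ (ρ x)).comp (tmap ρ).toLinearMap := by
  ext t; simp

/-- An initial segment of `hat ρ θ t` either contains the inserted value of `θ`, and then comes from
an initial segment of `t`, or ends before it. In the second case all its letters have been passed by
`θ`, which explains `tmap ρ`, and `θ` acts on the rest. -/
theorem front_hat (ρ : U →ₗ[ℂ] U) (ψ θ : TA U →ₗ[ℂ] U) (t : TA U) :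
    front LinearMap.id (hat ρ θ t) ψ
      = front LinearMap.id t (ψ.comp (hat ρ θ))
        + front (hat ρ θ) t (ψ.comp (tmap ρ).toLinearMap) := by
  refine ta_induction (C := fun t => ∀ ψ : TA U →ₗ[ℂ] U,
    front LinearMap.id (hat ρ θ t) ψ = front LinearMap.id t (ψ.comp (hat ρ θ))
        + front (hat ρ θ) t (ψ.comp (tmap ρ).toLinearMap)) ?_ ?_ ?_ ?_ t ψ
  · intro ψ
    rw [hat_one, ← mul_one (lt (θ 1)), front_mul]
    simp [add_comm]
  · intro s t hs ht ψ
    simp only [map_add, LinearMap.add_apply, hs, ht]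
    abel
  · intro c t ht ψ
    simp only [map_smul, LinearMap.smul_apply, ht, smul_add]
  · intro x t ht ψ
    have h : shiftBy (ψ.comp (hat ρ θ)) x
        = (shiftBy ψ (ρ x)).comp (hat ρ θ) + shiftBy (inFront ψ θ) x := by
      ext u
      simp [inFront_apply, hat_mul, add_comm]
    have h2 := front_mul LinearMap.id (inFront ψ θ) x t
    rw [hat_mul, map_add, LinearMap.add_apply, front_front, h2,
      front_mul LinearMap.id ψ, ht, front_mul LinearMap.id (ψ.comp (hat ρ θ)), h,
      map_add, front_mul (hat ρ θ), hat_mul, shiftBy_comp_tmap]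
    simp only [inFront_apply, front_one, LinearMap.id_apply, LinearMap.comp_apply, hat_one,
      AlgHom.toLinearMap_apply, map_one, mul_one, mul_add]
    abel

/-- `ψ` is inserted either at the very front or after the letter produced by `θ`; passing that
letter applies `ρ` to it. -/
theorem hat_front (ρ : U →ₗ[ℂ] U) (ψ θ : TA U →ₗ[ℂ] U) (t : TA U) :
    hat ρ ψ (front LinearMap.id t θ)
      = front LinearMap.id (front LinearMap.id t θ) ψ + front (hat ρ ψ) t (ρ.comp θ) := by
  refine ta_induction (C := fun t => ∀ θ : TA U →ₗ[ℂ] U, hat ρ ψ (front LinearMap.id t θ)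
      = front LinearMap.id (front LinearMap.id t θ) ψ + front (hat ρ ψ) t (ρ.comp θ))
    ?_ ?_ ?_ ?_ t θ
  · intro θ
    rw [front_one, hat_mul, front_one]
    rfl
  · intro s t hs ht θ
    simp only [map_add, LinearMap.add_apply, hs, ht]
    abel
  · intro c t ht θ
    simp only [map_smul, LinearMap.smul_apply, ht, smul_add]
  · intro x t ht θ
    rw [front_mul, map_add, ht, map_add, LinearMap.add_apply, hat_mul, front_mul (hat ρ ψ)]
    simp only [LinearMap.comp_apply, LinearMap.id_apply]
    have : ρ.comp (shiftBy θ x) = shiftBy (ρ.comp θ) x := rfl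
    rw [this]
    abel

theorem hat_hat_one (ρ₁ ρ₂ : U →ₗ[ℂ] U) (ψ θ : TA U →ₗ[ℂ] U) :
    hat ρ₁ ψ (hat ρ₂ θ 1)
      = front LinearMap.id 1 (ψ.comp (hat ρ₂ θ))
        + front (hat ρ₂ θ) 1 (ψ.comp (tmap ρ₂).toLinearMap) + front (hat ρ₁ ψ) 1 (ρ₁.comp θ) := by
  rw [← front_hat]
  have : hat ρ₂ θ 1 = front LinearMap.id 1 θ := by simp
  rw [this, hat_front]

/-- The `front` terms are those in which an insertion begins at the first letter: the value of `θ`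
is an argument of `ψ`, or the insertions are disjoint with `ψ` on the left, or disjoint with `θ` on
the left. -/
theorem hat_hat_mul (ρ₁ ρ₂ : U →ₗ[ℂ] U) (ψ θ : TA U →ₗ[ℂ] U) (x : U) (t : TA U) :
    hat ρ₁ ψ (hat ρ₂ θ (lt x * t))
      = lt (ρ₁ (ρ₂ x)) * hat ρ₁ ψ (hat ρ₂ θ t)
        + (front LinearMap.id (lt x * t) (ψ.comp (hat ρ₂ θ))
        + front (hat ρ₂ θ) (lt x * t) (ψ.comp (tmap ρ₂).toLinearMap)
        + front (hat ρ₁ ψ) (lt x * t) (ρ₁.comp θ)) := by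
  rw [← front_hat, hat_mul ρ₂, map_add, hat_front, hat_mul, map_add, LinearMap.add_apply]
  abel

/-- The graded commutator of two coderivations is the coderivation with components the graded
commutator of the components. -/
theorem hat_commutator (ρ₁ ρ₂ ρ₃ : U →ₗ[ℂ] U) (ψ θ : TA U →ₗ[ℂ] U) (c : ℂ)
    (h₁₂ : ∀ x, ρ₁ (ρ₂ x) = ρ₃ x) (h₂₁ : ∀ x, ρ₂ (ρ₁ x) = ρ₃ x)
    (hψ : ψ.comp (tmap ρ₂).toLinearMap = c • ρ₂.comp ψ)
    (hθ : ρ₁.comp θ = c • θ.comp (tmap ρ₁).toLinearMap) :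
    hat ρ₃ (ψ.comp (hat ρ₂ θ) - c • θ.comp (hat ρ₁ ψ))
      = (hat ρ₁ ψ).comp (hat ρ₂ θ) - c • (hat ρ₂ θ).comp (hat ρ₁ ψ) := by
  -- The disjoint insertions cancel in pairs by `hψ` and `hθ`; what survives is nested insertion,
  -- which is the composite of components.
  refine ta_ext ?_ fun x t ht => ?_
  · simp only [LinearMap.sub_apply, LinearMap.smul_apply, LinearMap.comp_apply, hat_hat_one, hψ, hθ,
      map_smul, smul_add]
    simp only [hat_one, front_one, LinearMap.sub_apply, LinearMap.smul_apply, LinearMap.comp_apply,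
      LinearMap.id_apply, mul_one, map_sub, map_smul]
    abel
  · rw [hat_mul, ht]
    simp only [LinearMap.sub_apply, LinearMap.smul_apply, LinearMap.comp_apply, hat_hat_mul, hψ, hθ,
      map_smul, map_sub, smul_add, h₁₂, h₂₁, mul_sub, mul_smul_comm]
    abel

theorem tmap_comp_apply {ρ₁ ρ₂ ρ₃ : U →ₗ[ℂ] U} (h : ∀ x, ρ₁ (ρ₂ x) = ρ₃ x) (t : TA U) :
    tmap ρ₁ (tmap ρ₂ t) = tmap ρ₃ t := by
  have : (tmap ρ₁).comp (tmap ρ₂) = tmap ρ₃ := by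
    ext x; simp [h]
  exact DFunLike.congr_fun this t

/-- `hat` commutes with the action of an automorphism. -/
theorem tmap_hat (g ρ : U →ₗ[ℂ] U) (φ φ' : TA U →ₗ[ℂ] U) (hρ : ∀ x, g (ρ x) = ρ (g x))
    (h : ∀ t, g (φ t) = φ' (tmap g t)) (t : TA U) :
    tmap g (hat ρ φ t) = hat ρ φ' (tmap g t) := by
  have hf : ∀ t : TA U, ∀ φ φ' : TA U →ₗ[ℂ] U, (∀ t, g (φ t) = φ' (tmap g t)) →
      tmap g (front LinearMap.id t φ) = front LinearMap.id (tmap g t) φ' := by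
    refine ta_induction ?_ ?_ ?_ ?_
    · intro φ φ' h
      simp [h]
    · intro s t hs ht φ φ' h
      simp [hs φ φ' h, ht φ φ' h]
    · intro c t ht φ φ' h
      simp [ht φ φ' h]
    · intro x t ht φ φ' h
      rw [tmap_mul, front_mul, front_mul, map_add,
        ht (shiftBy φ x) (shiftBy φ' (g x)) (fun u => by simp [h])]
      simp [h]
  refine ta_induction (C := fun t => tmap g (hat ρ φ t) = hat ρ φ' (tmap g t)) ?_ ?_ ?_ ?_ t
  · simp [h]
  · intro s t hs ht; simp [hs, ht]
  · intro c t ht; simp [ht]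
  · intro x t ht
    rw [hat_mul, map_add, hf _ _ _ h, tmap_mul, tmap_mul, hat_mul, ht, hρ]

theorem aug_front (B : TA U →ₗ[ℂ] TA U) (t : TA U) (φ : TA U →ₗ[ℂ] U) :
    TensorAlgebra.algebraMapInv (front B t φ) = (0 : ℂ) := by
  refine ta_induction (C := fun t => ∀ φ : TA U →ₗ[ℂ] U,
    TensorAlgebra.algebraMapInv (front B t φ) = (0 : ℂ)) ?_ ?_ ?_ ?_ t φ
  · intro φ; rw [front_one, aug_mul]
  · intro s t hs ht φ; rw [map_add, LinearMap.add_apply, map_add, hs, ht, add_zero]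
  · intro c t ht φ; rw [map_smul, LinearMap.smul_apply, map_smul, ht, smul_zero]
  · intro x t ht φ; rw [front_mul, map_add, aug_mul, ht, add_zero]

theorem aug_hat (ρ : U →ₗ[ℂ] U) (φ : TA U →ₗ[ℂ] U) (t : TA U) :
    TensorAlgebra.algebraMapInv (hat ρ φ t) = (0 : ℂ) := by
  have : (TensorAlgebra.algebraMapInv (R := ℂ) (M := U)).toLinearMap.comp (hat ρ φ) = 0 :=
    ta_cases_ext (by simp [aug_lt]) fun x t => by simp [hat_mul, aug_front]
  exact DFunLike.congr_fun this t

theorem pr₁_front (t : TA U) (φ : TA U →ₗ[ℂ] U) : pr₁ (front LinearMap.id t φ) = φ t := by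
  refine ta_induction (C := fun t => ∀ φ : TA U →ₗ[ℂ] U,
    pr₁ (front LinearMap.id t φ) = φ t) ?_ ?_ ?_ ?_ t φ
  · intro φ; simp
  · intro s t hs ht φ; rw [map_add, LinearMap.add_apply, map_add, hs, ht, map_add]
  · intro c t ht φ; rw [map_smul, LinearMap.smul_apply, map_smul, ht, map_smul]
  · intro x t ht φ; rw [front_mul, map_add, ht]; simp

/-- The components of a coderivation are recovered from it. -/
theorem pr₁_hat (ρ : U →ₗ[ℂ] U) (φ : TA U →ₗ[ℂ] U) (t : TA U) : pr₁ (hat ρ φ t) = φ t := by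
  have : pr₁.comp (hat ρ φ) = φ :=
    ta_cases_ext (by simp) fun x t => by simp [hat_mul, pr₁_front, pr₁_mul, aug_hat]
  exact DFunLike.congr_fun this t

end Hat

end MoritaLInf

end

noncomputable section

namespace MoritaLInf

open TensorAlgebra

/-! ### Translation between components of coderivations and functionals. -/

section ToFun

variable {U : Type*} [AddCommGroup U] [Module ℂ U]

/-- The functional on the tensor algebra with one given component. -/
def compFun (n : ℕ) : MultilinearMap ℂ (fun _ : Fin n => U) U →ₗ[ℂ] (TA U →ₗ[ℂ] U) :=
  (LinearMap.lcomp ℂ U ((DirectSum.component ℂ ℕ (fun n => TensorPower ℂ n U) n).comp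
    (TensorAlgebra.toDirectSum (R := ℂ) (M := U)).toLinearMap)).comp
      (PiTensorProduct.lift (R := ℂ) (s := fun _ : Fin n => U) (E := U)).toLinearMap

theorem compFun_tprod (n : ℕ) (Φ : MultilinearMap ℂ (fun _ : Fin n => U) U) (m : ℕ)
    (x : Fin m → U) :
    compFun n Φ (TensorAlgebra.tprod ℂ U m x)
      = if h : m = n then Φ (fun i => x (i.cast h.symm)) else 0 := by
  have h : compFun n Φ (TensorAlgebra.tprod ℂ U m x)
    = PiTensorProduct.lift Φ (DirectSum.component ℂ ℕ (fun n => TensorPower ℂ n U) n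
      (TensorAlgebra.toDirectSum (TensorAlgebra.tprod ℂ U m x))) := rfl
  rw [h, TensorAlgebra.toDirectSum_tensorPower_tprod, ← DirectSum.lof_eq_of ℂ,
    DirectSum.component.of]
  split_ifs with e
  · subst e
    simp
  · simp

/-- The functional on the tensor algebra whose components are those of a coderivation. -/
def toFun : Coder U →ₗ[ℂ] (TA U →ₗ[ℂ] U) := DirectSum.toModule ℂ ℕ _ compFun

theorem toFun_lof (n : ℕ) (Φ : MultilinearMap ℂ (fun _ : Fin n => U) U) :
    toFun (DirectSum.lof ℂ ℕ (fun n => MultilinearMap ℂ (fun _ : Fin n => U) U) n Φ)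
      = compFun n Φ := by
  rw [toFun, DirectSum.toModule_lof]

theorem toFun_tprod (Φ : Coder U) (n : ℕ) (x : Fin n → U) :
    toFun Φ (TensorAlgebra.tprod ℂ U n x) = Φ n x := by
  induction Φ using DirectSum.induction_on with
  | zero => simp
  | add a b ha hb =>
    rw [map_add, LinearMap.add_apply, ha, hb]
    rfl
  | of m Φ =>
    have := toFun_lof m Φ
    rw [DirectSum.lof_eq_of] at this
    rw [this, compFun_tprod]
    split_ifs with e
    · subst e
      rw [DirectSum.of_eq_same]
      rfl
    · rw [DirectSum.of_eq_of_ne _ _ _ e]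
      rfl

/-- This is what allows identities between coderivations to be checked on functionals. -/
theorem toFun_injective : Function.Injective (toFun (U := U)) := fun Φ Ψ h =>
  DFinsupp.ext fun n => MultilinearMap.ext fun x => by
    rw [← toFun_tprod, ← toFun_tprod, h]

theorem compFun_word (n : ℕ) (Φ : MultilinearMap ℂ (fun _ : Fin n => U) U) (l : List U)
    (h : l.length ≠ n) : compFun n Φ (word l) = 0 := by
  have := compFun_tprod n Φ l.length l.get
  rwa [tprod_eq_word, List.ofFn_get, dif_neg h] at this

theorem front_word (k : ℕ) (l : List U) (φ : TA U →ₗ[ℂ] U)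
    (h : ∀ l : List U, l.length ≠ k → φ (word l) = 0) :
    front LinearMap.id (word l) φ
      = if k ≤ l.length then lt (φ (word (l.take k))) * word (l.drop k) else 0 := by
  induction l generalizing k φ with
  | nil =>
    rw [word_nil, front_one]
    rcases k with _ | k
    · simp
    · have := h [] (by simp)
      rw [word_nil] at this
      simp [this]
  | cons x l ih =>
    rw [word_cons, front_mul]
    rcases k with _ | k
    · have h0 : shiftBy φ x = 0 := word_ext fun l' => by
        have := h (x :: l') (by simp)
        simpa using this
      simp [h0]
    · have h0 : φ 1 = 0 := h [] (by simp)
      rw [ih k (shiftBy φ x) (fun l' hl' => by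
        have := h (x :: l') (by simpa using hl')
        simpa using this)]
      simp [h0]

/-- The index `i` is the place of insertion. Truncated subtraction makes the sum empty for words
shorter than `k`. -/
theorem hat_word (k : ℕ) (l : List U) (ρ : U →ₗ[ℂ] U) (φ : TA U →ₗ[ℂ] U)
    (h : ∀ l : List U, l.length ≠ k → φ (word l) = 0) :
    hat ρ φ (word l) = ∑ i ∈ Finset.range (l.length + 1 - k),
      word ((l.take i).map ρ ++ φ (word ((l.drop i).take k)) :: l.drop (i + k)) := by
  induction l with
  | nil =>
    rw [word_nil, hat_one]
    rcases k with _ | k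
    · simp
    · have := h [] (by simp)
      rw [word_nil] at this
      simp [this]
  | cons x l ih =>
    rw [word_cons, hat_mul, ih, ← word_cons, front_word k _ φ h]
    by_cases hk : k ≤ l.length + 1
    · have e : (x :: l).length + 1 - k = (l.length + 1 - k) + 1 := by
        simp only [List.length_cons]; omega
      rw [e, Finset.sum_range_succ', if_pos (by simpa using hk), Finset.mul_sum, add_comm]
      congr 1
      · refine Finset.sum_congr rfl fun i _ => ?_
        have e1 : i + 1 + k = i + k + 1 := by omega
        simp [e1]
      · simp
    · have e : (x :: l).length + 1 - k = 0 := by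
        simp only [List.length_cons]; omega
      have e' : l.length + 1 - k = 0 := by omega
      rw [e, e', if_neg (by simpa using hk)]
      simp

theorem ofFn_insertArgs {m k : ℕ} (ρ : U →ₗ[ℂ] U) (i : Fin (m + 1))
    (Ψ : MultilinearMap ℂ (fun _ : Fin k => U) U) (a : Fin (m + k) → U) :
    List.ofFn (insertArgs ρ i Ψ a)
      = ((List.ofFn a).take i).map ρ ++ compFun k Ψ (word (((List.ofFn a).drop i).take k))
        :: (List.ofFn a).drop (i + k) := by
  have hi := i.2
  have hΨ : compFun k Ψ (word (((List.ofFn a).drop i).take k))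
      = Ψ fun s => a ⟨i + s, by omega⟩ := by
    have e : ((List.ofFn a).drop i).take k
        = List.ofFn (fun s : Fin k => a ⟨i + s, by omega⟩) := by
      refine List.ext_getElem (by simp; omega) fun j h1 h2 => ?_
      simp
    rw [e, ← tprod_eq_word, compFun_tprod, dif_pos rfl]
    rfl
  rw [hΨ]
  refine List.ext_getElem (by simp; omega) fun j h1 h2 => ?_
  rw [List.getElem_ofFn, insertArgs]
  have hj : j < m + 1 := by simpa using h1
  have hlen : (((List.ofFn a).take i).map ρ).length = i := by
    simp; omega
  split_ifs with h3 h4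
  · have h3' : j < i.1 := h3
    rw [List.getElem_append_left (by omega)]
    simp
  · have h4' : j = i.1 := congrArg Fin.val h4
    rw [List.getElem_append_right (by omega)]
    have e : j - (((List.ofFn a).take i).map ρ).length = 0 := by omega
    simp only [e, List.getElem_cons_zero]
  · have h3' : ¬ j < i.1 := h3
    have h4' : j ≠ i.1 := fun e => h4 (Fin.ext e)
    obtain ⟨d, rfl⟩ : ∃ d, j = i.1 + 1 + d := ⟨j - i.1 - 1, by omega⟩
    rw [List.getElem_append_right (by omega)]
    have e : i.1 + 1 + d - (((List.ofFn a).take i).map ρ).length = d + 1 := by omega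
    simp only [e, List.getElem_cons_succ, List.getElem_drop, List.getElem_ofFn]
    congr 2
    omega

theorem circ_lof_zero (G : SuperGrading U) (q : ZMod 2)
    (Φ : MultilinearMap ℂ (fun _ : Fin 0 => U) U) (Ψ : Coder U) :
    circ G q (DirectSum.lof ℂ ℕ (fun n => MultilinearMap ℂ (fun _ : Fin n => U) U) 0 Φ) Ψ = 0 := by
  rw [circ, DirectSum.toModule_lof]
  rfl

theorem circ_lof_lof (G : SuperGrading U) (q : ZMod 2) (m k : ℕ)
    (Φ : MultilinearMap ℂ (fun _ : Fin (m + 1) => U) U)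
    (Ψ : MultilinearMap ℂ (fun _ : Fin k => U) U) :
    circ G q (DirectSum.lof ℂ ℕ (fun n => MultilinearMap ℂ (fun _ : Fin n => U) U) (m + 1) Φ)
      (DirectSum.lof ℂ ℕ (fun n => MultilinearMap ℂ (fun _ : Fin n => U) U) k Ψ)
      = ∑ i : Fin (m + 1), DirectSum.lof ℂ ℕ (fun n => MultilinearMap ℂ (fun _ : Fin n => U) U)
          (m + k) (insertAt (G.op ^ q.val) i Φ Ψ) := by
  rw [circ, DirectSum.toModule_lof]
  simp only [LinearMap.flip_apply, DirectSum.toModule_lof, LinearMap.sum_apply]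
  rfl

theorem toFun_circ_lof_lof (G : SuperGrading U) (q : ZMod 2) (m k : ℕ)
    (Φ : MultilinearMap ℂ (fun _ : Fin m => U) U)
    (Ψ : MultilinearMap ℂ (fun _ : Fin k => U) U) :
    toFun (circ G q (DirectSum.lof ℂ ℕ (fun n => MultilinearMap ℂ (fun _ : Fin n => U) U) m Φ)
      (DirectSum.lof ℂ ℕ (fun n => MultilinearMap ℂ (fun _ : Fin n => U) U) k Ψ))
      = (compFun m Φ).comp (hat (G.op ^ q.val) (compFun k Ψ)) := by
  refine word_ext fun l => ?_
  rw [LinearMap.comp_apply, hat_word k l _ _ (fun l' h => compFun_word k Ψ l' h), map_sum]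
  -- For an outer component of arity zero, `circ` vanishes by definition, and so does the other
  -- side: every word in the image of `hat` has at least one letter.
  rcases m with _ | m
  · rw [circ_lof_zero, map_zero, LinearMap.zero_apply]
    exact (Finset.sum_eq_zero fun i _ => compFun_word 0 Φ _ (by simp)).symm
  · rw [circ_lof_lof, map_sum, LinearMap.sum_apply]
    simp only [toFun_lof]
    by_cases hl : l.length = m + k
    · obtain ⟨a, rfl⟩ : ∃ a : Fin (m + k) → U, l = List.ofFn a :=
        ⟨fun i => l.get (i.cast hl.symm), by
          refine List.ext_getElem (by simp [hl]) fun j h1 h2 => by simp⟩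
      have e : (List.ofFn a).length + 1 - k = m + 1 := by simp; omega
      rw [e, Finset.sum_range]
      refine Finset.sum_congr rfl fun i _ => ?_
      rw [← ofFn_insertArgs, ← tprod_eq_word, ← tprod_eq_word, compFun_tprod, compFun_tprod,
        dif_pos rfl, dif_pos rfl]
      rfl
    · rw [Finset.sum_eq_zero fun i _ => compFun_word _ _ _ hl]
      refine (Finset.sum_eq_zero fun i hi => compFun_word _ Φ _ ?_).symm
      rw [Finset.mem_range] at hi
      simp only [List.length_append, List.length_map, List.length_take, List.length_cons,
        List.length_drop]
      omega

theorem hat_add (ρ : U →ₗ[ℂ] U) (φ ψ : TA U →ₗ[ℂ] U) :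
    hat ρ (φ + ψ) = hat ρ φ + hat ρ ψ := by
  refine ta_ext (by simp) fun x t ht => ?_
  rw [hat_mul, ht, LinearMap.add_apply, LinearMap.add_apply, hat_mul, hat_mul, map_add, mul_add]
  abel

theorem hat_zero (ρ : U →ₗ[ℂ] U) : hat ρ (0 : TA U →ₗ[ℂ] U) = 0 := by
  refine ta_ext (by simp) fun x t ht => ?_
  rw [hat_mul, ht]
  simp

theorem hat_smul (ρ : U →ₗ[ℂ] U) (c : ℂ) (φ : TA U →ₗ[ℂ] U) :
    hat ρ (c • φ) = c • hat ρ φ := by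
  refine ta_ext (by simp) fun x t ht => ?_
  rw [hat_mul, ht]
  simp [hat_mul]

/-- From here on, composition of coderivations is composition with the operator `hat`, and the
explicit argument lists of `insertAt` are no longer needed. -/
theorem toFun_circ (G : SuperGrading U) (q : ZMod 2) (Φ Ψ : Coder U) :
    toFun (circ G q Φ Ψ) = (toFun Φ).comp (hat (G.op ^ q.val) (toFun Ψ)) := by
  induction Φ using DirectSum.induction_on with
  | zero => simp
  | add a b ha hb =>
    rw [map_add, LinearMap.add_apply, map_add, ha, hb, map_add, LinearMap.add_comp]
  | of m Φ =>
    induction Ψ using DirectSum.induction_on with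
    | zero => simp [hat_zero]
    | add a b ha hb =>
      rw [map_add, map_add, ha, hb, map_add, hat_add, LinearMap.comp_add]
    | of k Ψ =>
      have := toFun_circ_lof_lof G q m k Φ Ψ
      rw [← toFun_lof, ← toFun_lof] at this
      exact this

/-! ## The graded Lie algebra of coderivations -/

variable (G : SuperGrading U)

theorem toFun_op (Φ : Coder U) :
    toFun ((coderGrading G).op Φ) = G.op.comp ((toFun Φ).comp (tmap G.op).toLinearMap) := by
  refine tprod_ext fun n x => ?_
  rw [toFun_tprod]
  have h : (tmap G.op) (TensorAlgebra.tprod ℂ U n x)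
      = TensorAlgebra.tprod ℂ U n (fun i => G.op (x i)) := by
    rw [tprod_eq_word, tmap_word, tprod_eq_word, List.map_ofFn]
    rfl
  rw [LinearMap.comp_apply, LinearMap.comp_apply, AlgHom.toLinearMap_apply, h, toFun_tprod]
  rfl

theorem toFun_tmap {q : ZMod 2} {Φ : Coder U} (h : Φ ∈ (coderGrading G).part q) (p : ZMod 2)
    (t : TA U) : toFun Φ (tmap (G.op ^ p.val) t) = sgn (p * q) • (G.op ^ p.val) (toFun Φ t) := by
  rcases zmod2_cases p with rfl | rfl
  · have : tmap (G.op ^ (0 : ZMod 2).val) t = t := by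
      have : tmap (G.op ^ (0 : ZMod 2).val) = AlgHom.id ℂ _ := by ext; simp
      rw [this]; rfl
    rw [this]
    simp
  · have h1 := DFunLike.congr_fun ((toFun_op G Φ).symm.trans
      (congrArg toFun ((coderGrading G).op_of_mem h))) t
    rw [map_smul] at h1
    simp only [LinearMap.comp_apply, AlgHom.toLinearMap_apply, LinearMap.smul_apply] at h1
    rw [val_one_zmod2, pow_one, one_mul, ← map_smul, ← h1, G.op_op]

theorem mem_part_of_toFun {q : ZMod 2} {Φ : Coder U}
    (h : ∀ t, G.op (toFun Φ (tmap G.op t)) = sgn q • toFun Φ t) :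
    Φ ∈ (coderGrading G).part q := by
  rw [SuperGrading.mem_part]
  refine toFun_injective ?_
  rw [toFun_op, map_smul]
  exact LinearMap.ext h

theorem op_pow_op (p q : ZMod 2) (x : U) :
    (G.op ^ p.val) ((G.op ^ q.val) x) = (G.op ^ (p + q).val) x := by
  rcases zmod2_cases p with rfl | rfl <;> rcases zmod2_cases q with rfl | rfl <;>
    simp [val_one_zmod2, one_add_one_zmod2, G.op_op]

theorem coderBracket_of_mem {p q : ZMod 2} {Φ Ψ : Coder U} (hΦ : Φ ∈ (coderGrading G).part p)
    (hΨ : Ψ ∈ (coderGrading G).part q) :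
    coderBracket G Φ Ψ = circ G q Φ Ψ - sgn (p * q) • circ G p Ψ Φ := by
  simp only [coderBracket, LinearMap.sum_apply, LinearMap.sub_apply, LinearMap.smul_apply,
    LinearMap.compl₁₂_apply, LinearMap.flip_apply, SuperGrading.proj_of_mem _ hΦ,
    SuperGrading.proj_of_mem _ hΨ]
  rw [Finset.sum_eq_single p, Finset.sum_eq_single q]
  · simp
  · intro r _ hr; simp [hr]
  · simp
  · intro r _ hr
    refine Finset.sum_eq_zero fun s _ => ?_
    simp [hr]
  · simp

theorem toFun_bracket {p q : ZMod 2} {Φ Ψ : Coder U} (hΦ : Φ ∈ (coderGrading G).part p)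
    (hΨ : Ψ ∈ (coderGrading G).part q) :
    toFun (coderBracket G Φ Ψ) = (toFun Φ).comp (hat (G.op ^ q.val) (toFun Ψ))
      - sgn (p * q) • (toFun Ψ).comp (hat (G.op ^ p.val) (toFun Φ)) := by
  rw [coderBracket_of_mem G hΦ hΨ, map_sub, map_smul, toFun_circ, toFun_circ]

theorem circ_mem {p q : ZMod 2} {Φ Ψ : Coder U} (hΦ : Φ ∈ (coderGrading G).part p)
    (hΨ : Ψ ∈ (coderGrading G).part q) : circ G q Φ Ψ ∈ (coderGrading G).part (p + q) := by
  refine mem_part_of_toFun G fun t => ?_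
  have h1 : ∀ {r : ZMod 2} {Θ : Coder U}, Θ ∈ (coderGrading G).part r → ∀ t,
      G.op (toFun Θ (tmap G.op t)) = sgn r • toFun Θ t := by
    intro r Θ hΘ t
    have := toFun_tmap G hΘ 1 t
    rw [val_one_zmod2, pow_one, one_mul] at this
    rw [this, map_smul, G.op_op]
  have h2 : ∀ t, G.op ((sgn q • toFun Ψ) t) = toFun Ψ (tmap G.op t) := by
    intro t
    rw [LinearMap.smul_apply, ← h1 hΨ, G.op_op]
  have h3 := tmap_hat G.op (G.op ^ q.val) _ _
    (fun x => by rcases zmod2_cases q with rfl | rfl <;> simp [val_one_zmod2]) h2 t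
  rw [toFun_circ, LinearMap.comp_apply, LinearMap.comp_apply, ← h3, h1 hΦ, hat_smul, sgn_add,
    mul_smul]
  simp

theorem bracket_mem {p q : ZMod 2} {Φ Ψ : Coder U} (hΦ : Φ ∈ (coderGrading G).part p)
    (hΨ : Ψ ∈ (coderGrading G).part q) : coderBracket G Φ Ψ ∈ (coderGrading G).part (p + q) := by
  rw [coderBracket_of_mem G hΦ hΨ]
  refine Submodule.sub_mem _ (circ_mem G hΦ hΨ) (Submodule.smul_mem _ _ ?_)
  rw [add_comm]
  exact circ_mem G hΨ hΦ

theorem bracket_skew {p q : ZMod 2} {Φ Ψ : Coder U} (hΦ : Φ ∈ (coderGrading G).part p)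
    (hΨ : Ψ ∈ (coderGrading G).part q) :
    coderBracket G Ψ Φ = -(sgn (p * q) • coderBracket G Φ Ψ) := by
  rw [coderBracket_of_mem G hΦ hΨ, coderBracket_of_mem G hΨ hΦ, smul_sub, sgn_smul_sgn_smul,
    mul_comm q p]
  abel

/-- Thus `hat` represents the bracket faithfully by graded commutators of operators; parity of `Φ`
and `Ψ` is exactly what `hat_commutator` asks for. -/
theorem hat_bracket {p q : ZMod 2} {Φ Ψ : Coder U} (hΦ : Φ ∈ (coderGrading G).part p)
    (hΨ : Ψ ∈ (coderGrading G).part q) :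
    hat (G.op ^ (p + q).val) (toFun (coderBracket G Φ Ψ))
      = (hat (G.op ^ p.val) (toFun Φ)).comp (hat (G.op ^ q.val) (toFun Ψ))
        - sgn (p * q) • (hat (G.op ^ q.val) (toFun Ψ)).comp (hat (G.op ^ p.val) (toFun Φ)) := by
  rw [toFun_bracket G hΦ hΨ]
  refine hat_commutator _ _ _ _ _ _ (op_pow_op G p q) (fun x => by rw [op_pow_op, add_comm])
    (LinearMap.ext fun t => ?_) (LinearMap.ext fun t => ?_)
  · simpa [mul_comm] using toFun_tmap G hΦ q t
  · simp only [LinearMap.smul_apply, LinearMap.comp_apply, AlgHom.toLinearMap_apply]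
    rw [toFun_tmap G hΨ, sgn_smul_sgn_smul]

/-- After `hat_bracket` every term is a functional followed by two operators, so only associativity
of composition and signs are left. -/
theorem bracket_jacobi {p q r : ZMod 2} {Φ Ψ Θ : Coder U} (hΦ : Φ ∈ (coderGrading G).part p)
    (hΨ : Ψ ∈ (coderGrading G).part q) (hΘ : Θ ∈ (coderGrading G).part r) :
    coderBracket G Φ (coderBracket G Ψ Θ) = coderBracket G (coderBracket G Φ Ψ) Θ
      + sgn (p * q) • coderBracket G Ψ (coderBracket G Φ Θ) := by
  refine toFun_injective ?_
  rw [map_add, map_smul, toFun_bracket G hΦ (bracket_mem G hΨ hΘ), hat_bracket G hΨ hΘ,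
    toFun_bracket G (bracket_mem G hΦ hΨ) hΘ, hat_bracket G hΦ hΨ,
    toFun_bracket G hΨ (bracket_mem G hΦ hΘ), hat_bracket G hΦ hΘ,
    toFun_bracket G hΦ hΨ, toFun_bracket G hΨ hΘ, toFun_bracket G hΦ hΘ]
  ext t
  rcases zmod2_cases p with rfl | rfl <;> rcases zmod2_cases q with rfl | rfl <;>
    rcases zmod2_cases r with rfl | rfl <;>
    simp [one_add_one_zmod2] <;> abel

end ToFun

end MoritaLInf

end

noncomputable section

namespace MoritaLInf

open TensorAlgebra

/-- A functional that vanishes on nonempty words can only act on the empty initial segment. -/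
theorem front_of_shiftBy_eq_zero {U : Type*} [AddCommGroup U] [Module ℂ U]
    (B : TA U →ₗ[ℂ] TA U) (ψ : TA U →ₗ[ℂ] U) (h : ∀ x, shiftBy ψ x = 0) (t : TA U) :
    front B t ψ = lt (ψ 1) * B t := by
  have : (front B).flip ψ = (LinearMap.mulLeft ℂ (lt (ψ 1))).comp B :=
    ta_cases_ext (by simp) fun x t => by
      rw [LinearMap.flip_apply, front_mul, h]
      simp
  exact DFunLike.congr_fun this t

/-! ## The codifferential of a curved algebra -/

section Curved

variable {A : Type*} [Ring A] [Algebra ℂ A] (G : SuperGrading A) (c : A)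

/-- The functional of the codifferential. -/
abbrev muFun : TA A →ₗ[ℂ] A := toFun (curvedCodiff G c)

theorem muFun_word (l : List A) : muFun G c (word l)
    = compFun 0 (MultilinearMap.constOfIsEmpty ℂ (fun _ : Fin 0 => A) c) (word l)
      + compFun 2 (bilin ((LinearMap.mul ℂ A).comp G.shift.op)) (word l) := by
  rw [muFun, curvedCodiff, map_add, toFun_lof, toFun_lof, LinearMap.add_apply]

@[simp] theorem muFun_one : muFun G c 1 = c := by
  have h1 := compFun_tprod 0 (MultilinearMap.constOfIsEmpty ℂ (fun _ : Fin 0 => A) c) 0 ![]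
  rw [tprod_eq_word] at h1
  rw [← word_nil, muFun_word, compFun_word 2 _ _ (by simp)]
  simpa using h1

@[simp] theorem muFun_lt (x : A) : muFun G c (lt x) = 0 := by
  have : word [x] = lt x := by simp
  rw [← this, muFun_word, compFun_word 2 _ _ (by simp), compFun_word 0 _ _ (by simp), add_zero]

theorem muFun_mul_mul (x y : A) (t : TA A) :
    muFun G c (lt x * (lt y * t)) = TensorAlgebra.algebraMapInv t • (G.shift.op x * y) := by
  have : shiftBy (shiftBy (muFun G c) x) y
      = (LinearMap.toSpanSingleton ℂ A (G.shift.op x * y)).comp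
        (TensorAlgebra.algebraMapInv (R := ℂ) (M := A)).toLinearMap := by
    refine word_ext fun l => ?_
    simp only [LinearMap.comp_apply, LinearMap.mulLeft_apply, AlgHom.toLinearMap_apply,
      LinearMap.toSpanSingleton_apply]
    rw [← word_cons, ← word_cons, muFun_word, compFun_word 0 _ _ (by simp), zero_add]
    cases l with
    | nil =>
      have h1 := compFun_tprod 2 (bilin ((LinearMap.mul ℂ A).comp G.shift.op)) 2 ![x, y]
      rw [tprod_eq_word] at h1
      simpa [bilin] using h1
    | cons z l => rw [compFun_word 2 _ _ (by simp)]; simp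
  exact DFunLike.congr_fun this t

theorem muFun_mul (x : A) (t : TA A) : muFun G c (lt x * t) = G.shift.op x * pr₁ t := by
  have : shiftBy (muFun G c) x = (LinearMap.mulLeft ℂ (G.shift.op x)).comp pr₁ :=
    ta_cases_ext (by simp) fun y t => by
      simp [muFun_mul_mul, pr₁_mul]
  exact DFunLike.congr_fun this t

theorem front_muFun_mul_mul (B : TA A →ₗ[ℂ] TA A) (x y : A) (t : TA A) :
    front B (lt x * (lt y * t)) (muFun G c)
      = lt c * B (lt x * (lt y * t)) + lt (G.shift.op x * y) * B t := by
  rw [front_mul, front_mul, front_of_shiftBy_eq_zero]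
  · simp only [LinearMap.comp_apply, LinearMap.mulLeft_apply, mul_one, muFun_lt, muFun_one]
    rw [muFun_mul, pr₁_lt]
    simp
  · intro z
    ext u
    simp [muFun_mul]

theorem front_muFun_lt (B : TA A →ₗ[ℂ] TA A) (x : A) :
    front B (lt x) (muFun G c) = lt c * B (lt x) := by
  have := front_mul B (muFun G c) x 1
  simpa using this

variable {G c}

/-- A grading of an algebra. -/
def IsAlgGrading (G : SuperGrading A) : Prop := ∀ a b, G.op (a * b) = G.op a * G.op b

theorem curvedCodiff_mem (hG : IsAlgGrading G) (hc : G.op c = c) :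
    curvedCodiff G c ∈ (coderGrading G.shift).part 1 := by
  refine mem_part_of_toFun _ fun t => ?_
  have : (G.shift.op).comp ((muFun G c).comp (tmap G.shift.op).toLinearMap)
      = sgn 1 • muFun G c := by
    refine ta_cases_ext ?_ fun x t => ?_
    · simp [SuperGrading.shift_op, hc]
    · revert t
      refine fun t => DFunLike.congr_fun (f := (G.shift.op).comp ((muFun G c).comp
        ((tmap G.shift.op).toLinearMap.comp (LinearMap.mulLeft ℂ (lt x)))))
        (g := sgn 1 • (muFun G c).comp (LinearMap.mulLeft ℂ (lt x))) (ta_cases_ext ?_ fun y t => ?_) t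
      · simp
      · have e : TensorAlgebra.algebraMapInv (tmap G.shift.op t)
            = (TensorAlgebra.algebraMapInv t : ℂ) := by
          have : (TensorAlgebra.algebraMapInv (R := ℂ) (M := A)).comp (tmap G.shift.op)
              = TensorAlgebra.algebraMapInv := by
            ext x
            simp [aug_lt]
          exact DFunLike.congr_fun this t
        have hG' : ∀ a b, G.op (a * b) = G.op a * G.op b := hG
        simp [muFun_mul_mul, e, SuperGrading.shift_op, hG', G.op_op]
  exact DFunLike.congr_fun this t

/-- These are the relations of a curved algebra, sorted by word length: one letter gives centrality
of the even element `c`, three letters give associativity. In all other lengths no term survives,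
the functional being supported in arities zero and two. -/
theorem muFun_hat (hG : IsAlgGrading G) (hc : G.op c = c) (hcc : ∀ a, c * a = a * c) :
    (muFun G c).comp (hat G.shift.op (muFun G c)) = 0 := by
  have h1 : ∀ x, hat G.shift.op (muFun G c) (lt x)
      = lt c * lt x + lt (G.shift.op x) * lt c := by
    intro x
    have := hat_mul G.shift.op (muFun G c) x 1
    rwa [mul_one, front_muFun_lt, hat_one, muFun_one] at this
  have h2 : ∀ x y t, hat G.shift.op (muFun G c) (lt x * (lt y * t))
      = lt c * (lt x * (lt y * t)) + lt (G.shift.op x * y) * t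
        + lt (G.shift.op x) * hat G.shift.op (muFun G c) (lt y * t) := by
    intro x y t
    rw [hat_mul, front_muFun_mul_mul, LinearMap.id_apply, LinearMap.id_apply]
  have h3 : ∀ x, G.shift.op (G.shift.op x) = x := G.shift.op_op
  refine ta_cases_ext (by simp) fun x t => ?_
  refine DFunLike.congr_fun (f := ((muFun G c).comp (hat G.shift.op (muFun G c))).comp
    (LinearMap.mulLeft ℂ (lt x))) (g := 0) (ta_cases_ext ?_ fun y t => ?_) t
  · have e : lt c * lt x + lt (G.shift.op x) * lt c
        = lt c * (lt x * 1) + lt (G.shift.op x) * (lt c * 1) := by simp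
    simp only [LinearMap.comp_apply, LinearMap.mulLeft_apply, mul_one, h1, e]
    rw [map_add, muFun_mul_mul, muFun_mul_mul, h3, SuperGrading.shift_op, hc, map_one, one_smul,
      one_smul, neg_mul, hcc, neg_add_cancel, LinearMap.zero_apply]
  · refine DFunLike.congr_fun (f := (((muFun G c).comp (hat G.shift.op (muFun G c))).comp
      (LinearMap.mulLeft ℂ (lt x))).comp (LinearMap.mulLeft ℂ (lt y))) (g := 0)
      (ta_cases_ext ?_ fun z t => ?_) t
    · simp only [LinearMap.comp_apply, LinearMap.mulLeft_apply, mul_one]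
      have e := h2 x y 1
      rw [mul_one, mul_one, h1] at e
      rw [e]
      simp [muFun_mul, mul_add, pr₁_mul, aug_lt]
    · simp only [LinearMap.comp_apply, LinearMap.mulLeft_apply, h2 x y, h2 y z]
      simp only [map_add, muFun_mul, mul_add, pr₁_mul]
      have e : TensorAlgebra.algebraMapInv (hat G.shift.op (muFun G c) (lt z * t)) = (0 : ℂ) :=
        aug_hat _ _ _
      have hG' : ∀ a b, G.op (a * b) = G.op a * G.op b := hG
      simp [SuperGrading.shift_op, hG', G.op_op, e, mul_assoc]

theorem curvedCodiff_bracket_self (hG : IsAlgGrading G) (hc : G.op c = c)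
    (hcc : ∀ a, c * a = a * c) :
    coderBracket G.shift (curvedCodiff G c) (curvedCodiff G c) = 0 := by
  have h := curvedCodiff_mem hG hc
  refine toFun_injective ?_
  rw [toFun_bracket _ h h, val_one_zmod2, pow_one, muFun_hat hG hc hcc]
  simp

end Curved

end MoritaLInf

end

noncomputable section

namespace MoritaLInf

open TensorAlgebra

/-! ## Operators on the tensor algebra -/

section Operators

variable {V : Type*} [AddCommGroup V] [Module ℂ V] (G : SuperGrading V)

/-- The linear map `A` has parity `a`. -/
def HasParity (a : ZMod 2) (A : V →ₗ[ℂ] V) : Prop := ∀ x, G.op (A x) = sgn a • A (G.op x)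

variable {G} in
theorem HasParity.op_pow {a : ZMod 2} {A : V →ₗ[ℂ] V} (h : HasParity G a A) (q : ZMod 2) (x : V) :
    (G.op ^ q.val) (A x) = sgn (a * q) • A ((G.op ^ q.val) x) := by
  rcases zmod2_cases q with rfl | rfl
  · simp
  · rw [val_one_zmod2, pow_one, mul_one, h]

variable {G} in
theorem HasParity.mem {a p : ZMod 2} {A : V →ₗ[ℂ] V} (h : HasParity G a A) {x : V}
    (hx : x ∈ G.part p) : A x ∈ G.part (a + p) := by
  rw [SuperGrading.mem_part, h, G.op_of_mem hx, map_smul, smul_smul, sgn_add]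

/-- The extension of `A` to a derivation, where `ρ` is applied to the letters that `A` passes. -/
def der (ρ : V →ₗ[ℂ] V) (A : V →ₗ[ℂ] V) : TA V →ₗ[ℂ] TA V :=
  recL 0 ((LinearMap.mul ℂ (TA V)).comp (lt.comp A)) ((LinearMap.mul ℂ (TA V)).comp (lt.comp ρ))

@[simp] theorem der_one (ρ A : V →ₗ[ℂ] V) : der ρ A 1 = 0 := recL_one _ _ _

theorem der_mul (ρ A : V →ₗ[ℂ] V) (x : V) (t : TA V) :
    der ρ A (lt x * t) = lt (A x) * t + lt (ρ x) * der ρ A t := recL_mul _ _ _ _ _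

/-- `der` as a linear map. -/
def derL (ρ : V →ₗ[ℂ] V) : (V →ₗ[ℂ] V) →ₗ[ℂ] (TA V →ₗ[ℂ] TA V) where
  toFun := der ρ
  map_add' A B := ta_ext (by simp) fun x t ht => by
    simp only [der_mul, LinearMap.add_apply, map_add] at ht ⊢
    rw [ht, add_mul, mul_add]
    abel
  map_smul' c A := ta_ext (by simp) fun x t ht => by
    simp only [der_mul, LinearMap.smul_apply, map_smul, RingHom.id_apply] at ht ⊢
    rw [ht, smul_mul_assoc, mul_smul_comm, smul_add]

/-- The automorphism of the tensor algebra given by the `q`-th power of the parity operator. -/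
abbrev par (q : ZMod 2) : TA V →ₐ[ℂ] TA V := tmap (G.op ^ q.val)

theorem par_mul_of_mem {p : ZMod 2} {x : V} (hx : x ∈ G.part p) (q : ZMod 2) (t : TA V) :
    par G q (lt x * t) = sgn (q * p) • (lt x * par G q t) := by
  rw [tmap_mul, G.op_pow_of_mem hx, map_smul, smul_mul_assoc]

theorem par_par (p q : ZMod 2) (t : TA V) : par G p (par G q t) = par G (p + q) t := by
  refine tmap_comp_apply (fun x => ?_) t
  rcases zmod2_cases p with rfl | rfl <;> rcases zmod2_cases q with rfl | rfl <;>
    simp [val_one_zmod2, one_add_one_zmod2, G.op_op]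

/-- The derivation of parity `a` that extends `A`. -/
abbrev derP (a : ZMod 2) (A : V →ₗ[ℂ] V) : TA V →ₗ[ℂ] TA V := der (G.op ^ a.val) A

theorem derP_mul {q : ZMod 2} {y : V} (hy : y ∈ G.part q) (a : ZMod 2) (A : V →ₗ[ℂ] V) (t : TA V) :
    derP G a A (lt y * t) = lt (A y) * t + sgn (a * q) • (lt y * derP G a A t) := by
  rw [der_mul, G.op_pow_of_mem hy, map_smul, smul_mul_assoc]

variable {G} in
theorem HasParity.par_derP {a : ZMod 2} {A : V →ₗ[ℂ] V} (h : HasParity G a A) (q : ZMod 2)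
    (t : TA V) : par G q (derP G a A t) = sgn (a * q) • derP G a A (par G q t) := by
  have : (par G q).toLinearMap.comp (derP G a A)
      = sgn (a * q) • (derP G a A).comp (par G q).toLinearMap := by
    refine ta_hom_ext G (by simp) fun p x hx t ht => ?_
    simp only [LinearMap.comp_apply, AlgHom.toLinearMap_apply, LinearMap.smul_apply] at ht ⊢
    rw [derP_mul G hx, map_add, tmap_mul, map_smul, par_mul_of_mem G hx, ht, par_mul_of_mem G hx,
      map_smul, derP_mul G hx, h.op_pow, G.op_pow_of_mem hx, map_smul, map_smul]
    simp only [map_smul, smul_mul_assoc, mul_smul_comm, smul_smul, smul_add]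
    congr 2
    ring
  exact DFunLike.congr_fun this t

variable {G} in
theorem derP_comm {a b : ZMod 2} {A B : V →ₗ[ℂ] V} (hA : HasParity G a A) (hB : HasParity G b B)
    (t : TA V) :
    derP G a A (derP G b B t)
      = sgn (a * b) • derP G b B (derP G a A t)
        + derP G (a + b) (A.comp B - sgn (a * b) • B.comp A) t := by
  have : (derP G a A).comp (derP G b B) = sgn (a * b) • (derP G b B).comp (derP G a A)
      + derP G (a + b) (A.comp B - sgn (a * b) • B.comp A) := by
    refine ta_hom_ext G (by simp) fun p x hx t ht => ?_
    simp only [LinearMap.comp_apply, LinearMap.add_apply, LinearMap.smul_apply] at ht ⊢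
    have h1 := hA.mem hx
    have h2 := hB.mem hx
    simp only [derP_mul G hx, map_add, derP_mul G h1, derP_mul G h2, map_smul, ht, mul_add,
      LinearMap.sub_apply, LinearMap.comp_apply, LinearMap.smul_apply, map_sub, sub_mul,
      smul_mul_assoc, mul_smul_comm]
    rcases zmod2_cases a with rfl | rfl <;> rcases zmod2_cases b with rfl | rfl <;>
      rcases zmod2_cases p with rfl | rfl <;> simp [one_add_one_zmod2] <;> module
  exact DFunLike.congr_fun this t

theorem derP_zero (a : ZMod 2) : derP G a (0 : V →ₗ[ℂ] V) = 0 := map_zero (derL (G.op ^ a.val))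

theorem aug_der (ρ A : V →ₗ[ℂ] V) (t : TA V) :
    TensorAlgebra.algebraMapInv (der ρ A t) = (0 : ℂ) := by
  have : (TensorAlgebra.algebraMapInv (R := ℂ) (M := V)).toLinearMap.comp (der ρ A) = 0 :=
    ta_cases_ext (by simp) fun x t => by simp [der_mul]
  exact DFunLike.congr_fun this t

/-! ### The quadratic coderivation of a bracket -/

variable (b : V →ₗ[ℂ] V →ₗ[ℂ] V)

/-- The derivation `b(x, ·)` of parity `|x| + 1`. -/
def adB : V →ₗ[ℂ] TA V →ₗ[ℂ] TA V :=
  ∑ q : ZMod 2, (derL (G.op ^ (1 + q).val)).comp (b.comp (G.proj q))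

theorem adB_of_mem {p : ZMod 2} {x : V} (hx : x ∈ G.part p) :
    adB G b x = derP G (1 + p) (b x) := by
  rw [adB, LinearMap.sum_apply, Finset.sum_eq_single p]
  · simp [SuperGrading.proj_of_mem _ hx]; rfl
  · intro q _ hq; simp [SuperGrading.proj_of_mem _ hx, hq]
  · simp

/-- The coderivation that replaces pairs of letters by their bracket. -/
def quad : TA V →ₗ[ℂ] TA V :=
  recL 0 (adB G b) ((LinearMap.mul ℂ (TA V)).comp (lt.comp G.op))

@[simp] theorem quad_one : quad G b 1 = 0 := recL_one _ _ _

theorem quad_mul (x : V) (t : TA V) :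
    quad G b (lt x * t) = adB G b x t + lt (G.op x) * quad G b t := recL_mul _ _ _ _ _

theorem quad_mul_of_mem {p : ZMod 2} {x : V} (hx : x ∈ G.part p) (t : TA V) :
    quad G b (lt x * t) = adB G b x t + sgn p • (lt x * quad G b t) := by
  rw [quad_mul, G.op_of_mem hx, map_smul, smul_mul_assoc]

theorem adB_mul_of_mem {p q : ZMod 2} {x y : V} (hx : x ∈ G.part p) (hy : y ∈ G.part q)
    (t : TA V) :
    adB G b x (lt y * t) = lt (b x y) * t + sgn ((1 + p) * q) • (lt y * adB G b x t) := by
  rw [adB_of_mem G b hx, derP_mul G hy]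

theorem aug_quad (t : TA V) : TensorAlgebra.algebraMapInv (quad G b t) = (0 : ℂ) := by
  have : (TensorAlgebra.algebraMapInv (R := ℂ) (M := V)).toLinearMap.comp (quad G b) = 0 := by
    refine ta_hom_ext G (by simp) fun p x hx t _ => ?_
    simp [quad_mul, adB_of_mem G b hx, aug_der]
  exact DFunLike.congr_fun this t

variable (d : V →ₗ[ℂ] V)

/-- An odd symmetric form of the laws of a DG Lie algebra, on the suspension. -/
structure OddLie : Prop where
  op_d : ∀ x, G.op (d x) = -d (G.op x)
  d_d : ∀ x, d (d x) = 0
  op_b : ∀ x y, G.op (b x y) = -b (G.op x) (G.op y)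
  symm : ∀ {p q : ZMod 2} {x y : V}, x ∈ G.part p → y ∈ G.part q → b y x = sgn (p * q) • b x y
  leib : ∀ x y, d (b x y) + b (d x) y + b (G.op x) (d y) = 0
  jac : ∀ {p q : ZMod 2} {x y : V}, x ∈ G.part p → y ∈ G.part q → ∀ z,
    b (b x y) z + b (G.op x) (b y z) + sgn (p * q + q) • b y (b x z) = 0

/-- The codifferential on the tensor algebra. -/
def codiff : TA V →ₗ[ℂ] TA V := derP G 1 d + quad G b

@[simp] theorem codiff_one : codiff G b d 1 = 0 := by simp [codiff]

theorem codiff_mul_of_mem {p : ZMod 2} {x : V} (hx : x ∈ G.part p) (t : TA V) :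
    codiff G b d (lt x * t)
      = lt (d x) * t + adB G b x t + sgn p • (lt x * codiff G b d t) := by
  simp only [codiff, LinearMap.add_apply, derP_mul G hx, quad_mul_of_mem G b hx, mul_add, smul_add,
    one_mul]
  abel

theorem aug_codiff (t : TA V) : TensorAlgebra.algebraMapInv (codiff G b d t) = (0 : ℂ) := by
  simp [codiff, aug_der, aug_quad]

end Operators

/-! ### The codifferential of an odd Lie algebra squares to zero. -/

section OddLie

variable {V : Type*} [AddCommGroup V] [Module ℂ V] {G : SuperGrading V}
variable {b : V →ₗ[ℂ] V →ₗ[ℂ] V} {d : V →ₗ[ℂ] V}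

namespace OddLie

theorem parity_d (h : OddLie G b d) : HasParity G 1 d := fun x => by simp [h.op_d]

theorem d_mem (h : OddLie G b d) {p : ZMod 2} {x : V} (hx : x ∈ G.part p) : d x ∈ G.part (1 + p) :=
  h.parity_d.mem hx

theorem parity_b (h : OddLie G b d) {p : ZMod 2} {x : V} (hx : x ∈ G.part p) :
    HasParity G (1 + p) (b x) := fun y => by
  rw [h.op_b, G.op_of_mem hx, sgn_add, mul_smul]
  simp

theorem b_mem (h : OddLie G b d) {p q : ZMod 2} {x y : V} (hx : x ∈ G.part p) (hy : y ∈ G.part q) :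
    b x y ∈ G.part (1 + p + q) := (h.parity_b hx).mem hy

/-- The Jacobi identity expresses the graded commutator of the operators `b x` and `b y` through `b
(b x y)`. Passing to derivations respects graded commutators by `derP_comm`. -/
theorem adB_adB (h : OddLie G b d) {p q : ZMod 2} {x y : V} (hx : x ∈ G.part p) (hy : y ∈ G.part q)
    (t : TA V) : adB G b (b x y) t + sgn p • adB G b x (adB G b y t)
      + sgn (p * q + q) • adB G b y (adB G b x t) = 0 := by
  have h1 : (b x).comp (b y) - sgn ((1 + p) * (1 + q)) • (b y).comp (b x)
      = -(sgn p • b (b x y)) := by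
    ext z
    have := h.jac hx hy z
    rw [G.op_of_mem hx] at this
    simp only [LinearMap.sub_apply, LinearMap.comp_apply, LinearMap.smul_apply, LinearMap.neg_apply]
    simp only [map_smul, LinearMap.smul_apply] at this
    rcases zmod2_cases p with rfl | rfl <;> rcases zmod2_cases q with rfl | rfl <;>
      simp [one_add_one_zmod2] at this ⊢ <;>
      first
      | linear_combination (norm := module) this
      | linear_combination (norm := module) -this
  have h2 := derP_comm (h.parity_b hx) (h.parity_b hy) t
  have e : 1 + p + (1 + q) = 1 + (1 + p + q) := by ring
  have h3 : derP G (1 + p + (1 + q)) (-(sgn p • b (b x y)))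
      = -(sgn p • adB G b (b x y)) := by
    rw [adB_of_mem G b (h.b_mem hx hy), e]
    exact ((derL _).map_neg _).trans (congrArg _ ((derL _).map_smul _ _))
  rw [h1, h3, ← adB_of_mem G b hx, ← adB_of_mem G b hy] at h2
  rw [h2]
  rcases zmod2_cases p with rfl | rfl <;> rcases zmod2_cases q with rfl | rfl <;>
    simp [one_add_one_zmod2]

/-- This is precisely the contribution of a first letter `x` to the square of the codifferential. It
follows by induction on words from the Leibniz rule and the Jacobi identity. -/
theorem adB_codiff (h : OddLie G b d) {p : ZMod 2} {x : V} (hx : x ∈ G.part p) (t : TA V) :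
    adB G b (d x) t + codiff G b d (adB G b x t) + sgn p • adB G b x (codiff G b d t) = 0 := by
  have : adB G b (d x) + (codiff G b d).comp (adB G b x)
      + sgn p • (adB G b x).comp (codiff G b d) = 0 := by
    have hone : ∀ {r : ZMod 2} {z : V}, z ∈ G.part r → adB G b z 1 = 0 := fun hz => by
      rw [adB_of_mem G b hz, der_one]
    refine ta_hom_ext G ?_ fun q y hy t ht => ?_
    · simp [hone hx, hone (h.d_mem hx)]
    · simp only [LinearMap.comp_apply, LinearMap.add_apply, LinearMap.smul_apply,
        LinearMap.zero_apply] at ht ⊢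
      -- Three inputs at the first letter `y`: the Leibniz rule where `y` is differentiated or
      -- bracketed with `x`, `adB_adB` where `x` and `y` both act on the tail, and the induction
      -- hypothesis behind `y`.
      have hl := congrArg (fun z => lt z * t) (h.leib x y)
      have hj := h.adB_adB hx hy t
      have ht' := congrArg (fun z => lt y * z) ht
      rw [G.op_of_mem hx] at hl
      simp only [mul_add, mul_smul_comm, mul_zero, map_add, add_mul, map_zero, zero_mul,
        map_smul, LinearMap.smul_apply, smul_mul_assoc] at hl ht'
      simp only [adB_mul_of_mem G b hx hy, adB_mul_of_mem G b (h.d_mem hx) hy,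
        codiff_mul_of_mem G b d hy, adB_mul_of_mem G b hx (h.d_mem hy),
        codiff_mul_of_mem G b d (h.b_mem hx hy), map_add, map_smul, smul_add]
      rcases zmod2_cases p with rfl | rfl <;> rcases zmod2_cases q with rfl | rfl <;>
        simp [one_add_one_zmod2] at hl hj ht' ⊢
      · linear_combination (norm := module) hl + hj + ht'
      · linear_combination (norm := module) hl + hj + ht'
      · linear_combination (norm := module) hl + hj + ht'
      · linear_combination (norm := module) hl + hj - ht'
  exact DFunLike.congr_fun this t

/-- The square vanishes on the tensor algebra itself, before symmetrising: a bracket is placed where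
its second letter was, and for this convention the Leibniz form of the Jacobi identity suffices. -/
theorem codiff_codiff (h : OddLie G b d) (t : TA V) : codiff G b d (codiff G b d t) = 0 := by
  have : (codiff G b d).comp (codiff G b d) = 0 := by
    refine ta_hom_ext G (by simp) fun p x hx t ht => ?_
    simp only [LinearMap.comp_apply, LinearMap.zero_apply] at ht ⊢
    have := h.adB_codiff hx t
    simp only [codiff_mul_of_mem _ _ _ hx, codiff_mul_of_mem _ _ _ (h.d_mem hx), map_add, map_smul,
      ht, h.d_d, sgn_add]
    refine Eq.trans ?_ this
    simp [smul_add]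
    abel
  exact DFunLike.congr_fun this t

end OddLie

end OddLie

end MoritaLInf

end

noncomputable section

namespace MoritaLInf

open TensorAlgebra

open scoped TensorProduct

section Coproduct

variable {V : Type*} [AddCommGroup V] [Module ℂ V] (G : SuperGrading V)

/-! ### The unshuffle coproduct -/

/-- Multiplication by a letter on `T ⊗ T`. -/
def act : V →ₗ[ℂ] (TA V ⊗[ℂ] TA V →ₗ[ℂ] TA V ⊗[ℂ] TA V) :=
  (TensorProduct.mapBilinear (RingHom.id ℂ) (TA V) (TA V) (TA V) (TA V)).flip LinearMap.id ∘ₗ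
      (LinearMap.mul ℂ (TA V)) ∘ₗ lt
    + ∑ q : ZMod 2, (TensorProduct.mapBilinear (RingHom.id ℂ) (TA V) (TA V) (TA V) (TA V)
        (par G q).toLinearMap) ∘ₗ (LinearMap.mul ℂ (TA V)) ∘ₗ lt ∘ₗ (G.proj q)

theorem act_tmul {p : ZMod 2} {x : V} (hx : x ∈ G.part p) (s r : TA V) :
    act G x (s ⊗ₜ r) = (lt x * s) ⊗ₜ r + par G p s ⊗ₜ (lt x * r) := by
  simp only [act, LinearMap.add_apply, LinearMap.sum_apply]
  congr 1
  rw [Finset.sum_eq_single p]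
  · simp [SuperGrading.proj_of_mem _ hx]
  · intro q _ hq; simp [SuperGrading.proj_of_mem _ hx, hq]
  · simp

/-- The unshuffle coproduct. -/
def cop : TA V →ₗ[ℂ] TA V ⊗[ℂ] TA V := recL (1 ⊗ₜ 1) 0 (act G)

@[simp] theorem cop_one : cop G 1 = 1 ⊗ₜ 1 := recL_one _ _ _

theorem cop_mul (x : V) (t : TA V) : cop G (lt x * t) = act G x (cop G t) := by
  rw [cop, recL_mul]; simp

/-- The extension of an operator of parity `a` to `T ⊗ T` as a coderivation would. -/
def ext₂ (a : ZMod 2) (D : TA V →ₗ[ℂ] TA V) : TA V ⊗[ℂ] TA V →ₗ[ℂ] TA V ⊗[ℂ] TA V :=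
  TensorProduct.map D LinearMap.id + TensorProduct.map (par G a).toLinearMap D

theorem ext₂_tmul (a : ZMod 2) (D : TA V →ₗ[ℂ] TA V) (s r : TA V) :
    ext₂ G a D (s ⊗ₜ r) = D s ⊗ₜ r + par G a s ⊗ₜ D r := rfl

variable {G} in
theorem HasParity.cop_derP {a : ZMod 2} {A : V →ₗ[ℂ] V} (hA : HasParity G a A) (t : TA V) :
    cop G (derP G a A t) = ext₂ G a (derP G a A) (cop G t) := by
  have : (cop G).comp (derP G a A) = (ext₂ G a (derP G a A)).comp (cop G) := by
    refine ta_hom_ext G (by simp [ext₂_tmul]) fun q y hy t ht => ?_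
    simp only [LinearMap.comp_apply] at ht ⊢
    rw [derP_mul G hy, map_add, map_smul, cop_mul, cop_mul, ht, cop_mul]
    induction cop G t using TensorProduct.induction_on with
    | zero => simp
    | add u v hu hv => simp only [map_add, smul_add, ← hu, ← hv]; abel
    | tmul s r =>
      have h1 := hA.mem hy
      simp only [act_tmul G hy, act_tmul G h1, ext₂_tmul, map_add, derP_mul G hy,
        hA.par_derP, par_mul_of_mem G hy, TensorProduct.tmul_add, TensorProduct.add_tmul,
        TensorProduct.tmul_smul, TensorProduct.smul_tmul', par_par, smul_add, smul_smul,
        sgn_mul_self, one_smul, add_comm q a]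
      abel
  exact DFunLike.congr_fun this t

variable {G} {b : V →ₗ[ℂ] V →ₗ[ℂ] V} {d : V →ₗ[ℂ] V}

theorem OddLie.par_adB (h : OddLie G b d) {p : ZMod 2} {x : V} (hx : x ∈ G.part p) (q : ZMod 2)
    (t : TA V) : par G q (adB G b x t) = sgn ((1 + p) * q) • adB G b x (par G q t) := by
  rw [adB_of_mem G b hx, (h.parity_b hx).par_derP]

theorem OddLie.par_quad (h : OddLie G b d) (q : ZMod 2)
    (t : TA V) : par G q (quad G b t) = sgn q • quad G b (par G q t) := by
  have : (par G q).toLinearMap.comp (quad G b)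
      = sgn q • (quad G b).comp (par G q).toLinearMap := by
    refine ta_hom_ext G (by simp) fun p x hx t ht => ?_
    simp only [LinearMap.comp_apply, AlgHom.toLinearMap_apply, LinearMap.smul_apply] at ht ⊢
    rw [quad_mul_of_mem G b hx, map_add, h.par_adB hx, map_smul, par_mul_of_mem G hx, ht,
      par_mul_of_mem G hx, map_smul, quad_mul_of_mem G b hx]
    rcases zmod2_cases p with rfl | rfl <;> rcases zmod2_cases q with rfl | rfl <;>
      simp [one_add_one_zmod2]
  exact DFunLike.congr_fun this t

/-- A first letter `x` acts on the tail by the derivation `adB x`, which is compatible with `cop`.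
Its action on the two tensor factors matches the two factors into which `act` can put `x`. -/
theorem OddLie.cop_quad (h : OddLie G b d) (t : TA V) :
    cop G (quad G b t) = ext₂ G 1 (quad G b) (cop G t) := by
  have : (cop G).comp (quad G b) = (ext₂ G 1 (quad G b)).comp (cop G) := by
    refine ta_hom_ext G (by simp [ext₂_tmul]) fun q y hy t ht => ?_
    simp only [LinearMap.comp_apply] at ht ⊢
    rw [quad_mul_of_mem G b hy, map_add, map_smul, cop_mul, adB_of_mem G b hy,
      (h.parity_b hy).cop_derP, ht, cop_mul, ← adB_of_mem G b hy]
    induction cop G t using TensorProduct.induction_on with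
    | zero => simp
    | add u v hu hv => simp only [map_add, smul_add, ← hu, ← hv]; abel
    | tmul s r =>
      simp only [act_tmul G hy, ext₂_tmul, map_add, quad_mul_of_mem G b hy,
        h.par_quad, par_mul_of_mem G hy, TensorProduct.tmul_add, TensorProduct.add_tmul,
        TensorProduct.tmul_smul, TensorProduct.smul_tmul', par_par, smul_add, smul_smul,
        sgn_mul_self, one_smul, one_mul, add_comm q 1]
      abel
  exact DFunLike.congr_fun this t

theorem ext₂_add (a : ZMod 2) (D D' : TA V →ₗ[ℂ] TA V) :
    ext₂ G a (D + D') = ext₂ G a D + ext₂ G a D' := by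
  refine TensorProduct.ext' fun s r => ?_
  simp only [ext₂_tmul, LinearMap.add_apply, TensorProduct.tmul_add, TensorProduct.add_tmul]
  abel

theorem OddLie.cop_codiff (h : OddLie G b d) (t : TA V) :
    cop G (codiff G b d t) = ext₂ G 1 (codiff G b d) (cop G t) := by
  rw [codiff, ext₂_add, LinearMap.add_apply, map_add, h.parity_d.cop_derP, h.cop_quad,
    LinearMap.add_apply]

theorem OddLie.par_codiff (h : OddLie G b d) (q : ZMod 2)
    (t : TA V) : par G q (codiff G b d t) = sgn q • codiff G b d (par G q t) := by
  rw [codiff, LinearMap.add_apply, map_add, h.par_quad, h.parity_d.par_derP, one_mul,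
    LinearMap.add_apply, smul_add]

theorem cop_tmap {V' : Type*} [AddCommGroup V'] [Module ℂ V'] {G' : SuperGrading V'}
    (f : V →ₗ[ℂ] V') (hf : ∀ x, f (G.op x) = G'.op (f x)) (t : TA V) :
    cop G' (tmap f t) = TensorProduct.map (tmap f).toLinearMap (tmap f).toLinearMap (cop G t) := by
  have : (cop G').comp (tmap f).toLinearMap
      = (TensorProduct.map (tmap f).toLinearMap (tmap f).toLinearMap).comp (cop G) := by
    refine ta_hom_ext G (by simp) fun q y hy t ht => ?_
    simp only [LinearMap.comp_apply, AlgHom.toLinearMap_apply] at ht ⊢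
    have hy' : f y ∈ G'.part q := by
      rw [SuperGrading.mem_part, ← hf, G.op_of_mem hy, map_smul]
    have hp : ∀ s, par G' q (tmap f s) = tmap f (par G q s) := by
      intro s
      have : (par G' q).comp (tmap f) = (tmap f).comp (par G q) := by
        ext x
        rcases zmod2_cases q with rfl | rfl <;> simp [val_one_zmod2, hf]
      exact DFunLike.congr_fun this s
    rw [tmap_mul, cop_mul, cop_mul, ht]
    induction cop G t using TensorProduct.induction_on with
    | zero => simp
    | add u v hu hv => simp only [map_add, hu, hv]
    | tmul s r => simp [act_tmul G hy, act_tmul G' hy', hp]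
  exact DFunLike.congr_fun this t

end Coproduct

/-! ### The ideal of graded commutators -/

section Ideal

variable {V : Type*} [AddCommGroup V] [Module ℂ V] (G : SuperGrading V)

/-- The graded commutator of two letters of parities `p` and `q`. -/
def comRel (p q : ZMod 2) (x y : V) : TA V := lt x * lt y - sgn (p * q) • (lt y * lt x)

/-- The two-sided ideal generated by the graded commutators of letters. -/
def comIdeal : Submodule ℂ (TA V) :=
  Submodule.span ℂ {t | ∃ (p q : ZMod 2) (x y : V) (s r : TA V), x ∈ G.part p ∧ y ∈ G.part q ∧
    t = s * comRel p q x y * r}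

variable {G}

theorem comRel_mem {p q : ZMod 2} {x y : V} (hx : x ∈ G.part p) (hy : y ∈ G.part q) (s r : TA V) :
    s * comRel p q x y * r ∈ comIdeal G := Submodule.subset_span ⟨p, q, x, y, s, r, hx, hy, rfl⟩

theorem comRel_mul_mem {p q : ZMod 2} {x y : V} (hx : x ∈ G.part p) (hy : y ∈ G.part q) (r : TA V) :
    comRel p q x y * r ∈ comIdeal G := by
  simpa using comRel_mem hx hy 1 r

theorem mul_mem_comIdeal (u : TA V) {t : TA V} (ht : t ∈ comIdeal G) : u * t ∈ comIdeal G := by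
  refine Submodule.span_induction (p := fun t _ => u * t ∈ comIdeal G) ?_ (by simp) ?_ ?_ ht
  · rintro _ ⟨p, q, x, y, s, r, hx, hy, rfl⟩
    rw [← mul_assoc, ← mul_assoc]
    exact comRel_mem hx hy (u * s) r
  · intro s t _ _ hs ht; rw [mul_add]; exact add_mem hs ht
  · intro c t _ ht; rw [mul_smul_comm]; exact Submodule.smul_mem _ _ ht

/-- A criterion for a linear map to vanish on the ideal of commutators modulo a submodule. -/
theorem map_mem_of_comIdeal {M : Type*} [AddCommGroup M] [Module ℂ M] (D : TA V →ₗ[ℂ] M)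
    (K : Submodule ℂ M)
    (base : ∀ {p q : ZMod 2} {x y : V}, x ∈ G.part p → y ∈ G.part q → ∀ r,
      D (comRel p q x y * r) ∈ K)
    (step : ∀ {p : ZMod 2} {x : V}, x ∈ G.part p → ∀ t ∈ comIdeal G, D t ∈ K → D (lt x * t) ∈ K)
    {t : TA V} (ht : t ∈ comIdeal G) : D t ∈ K := by
  refine Submodule.span_induction (p := fun t _ => D t ∈ K) ?_ (by simp) ?_ ?_ ht
  · rintro _ ⟨p, q, x, y, s, r, hx, hy, rfl⟩
    refine ta_hom_induction G (C := fun s => D (s * comRel p q x y * r) ∈ K) ?_ ?_ ?_ ?_ s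
    · simpa using base hx hy r
    · intro s t hs ht; rw [add_mul, add_mul, map_add]; exact add_mem hs ht
    · intro c t ht; rw [smul_mul_assoc, smul_mul_assoc, map_smul]; exact Submodule.smul_mem _ _ ht
    · intro p' x' hx' t ht
      rw [mul_assoc, mul_assoc, ← mul_assoc t]
      exact step hx' _ (comRel_mem hx hy t r) ht
  · intro s t _ _ hs ht; rw [map_add]; exact add_mem hs ht
  · intro c t _ ht; rw [map_smul]; exact Submodule.smul_mem _ _ ht

theorem HasParity.derP_mem {a : ZMod 2} {A : V →ₗ[ℂ] V} (hA : HasParity G a A) {t : TA V}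
    (ht : t ∈ comIdeal G) : derP G a A t ∈ comIdeal G := by
  refine map_mem_of_comIdeal (derP G a A) (comIdeal G) ?_ ?_ ht
  · intro p q x y hx hy r
    have h1 := comRel_mul_mem (hA.mem hx) hy r
    have h2 := comRel_mul_mem hx (hA.mem hy) r
    have h3 := comRel_mul_mem hx hy (derP G a A r)
    have : derP G a A (comRel p q x y * r)
        = comRel (a + p) q (A x) y * r + sgn (a * p) • (comRel p (a + q) x (A y) * r)
          + sgn (a * p + a * q) • (comRel p q x y * derP G a A r) := by
      simp only [comRel, sub_mul, smul_mul_assoc, map_sub, map_smul, mul_assoc, derP_mul G hx,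
        derP_mul G hy, mul_add, mul_smul_comm]
      rcases zmod2_cases p with rfl | rfl <;> rcases zmod2_cases q with rfl | rfl <;>
        rcases zmod2_cases a with rfl | rfl <;>
        simp [one_add_one_zmod2] <;> abel
    rw [this]
    exact add_mem (add_mem h1 (Submodule.smul_mem _ _ h2)) (Submodule.smul_mem _ _ h3)
  · intro p x hx t ht hD
    rw [derP_mul G hx]
    exact add_mem (mul_mem_comIdeal _ ht) (Submodule.smul_mem _ _ (mul_mem_comIdeal _ hD))

variable {b : V →ₗ[ℂ] V →ₗ[ℂ] V} {d : V →ₗ[ℂ] V}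

theorem OddLie.adB_mem (h : OddLie G b d) {p : ZMod 2} {x : V} (hx : x ∈ G.part p) {t : TA V}
    (ht : t ∈ comIdeal G) : adB G b x t ∈ comIdeal G := by
  rw [adB_of_mem G b hx]
  exact (h.parity_b hx).derP_mem ht

/-- Symmetry of `b` cancels the bracket of the two commuted letters, and the terms in which one of
them acts on `r` agree in both orders. Only the commutator followed by `quad r` remains. -/
theorem OddLie.quad_mem (h : OddLie G b d) {t : TA V}
    (ht : t ∈ comIdeal G) : quad G b t ∈ comIdeal G := by
  refine map_mem_of_comIdeal (quad G b) (comIdeal G) ?_ ?_ ht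
  · intro p q x y hx hy r
    have h3 := comRel_mul_mem hx hy (quad G b r)
    have : quad G b (comRel p q x y * r)
        = sgn (p + q) • (comRel p q x y * quad G b r) := by
      simp only [comRel, sub_mul, smul_mul_assoc, map_sub, map_smul, mul_assoc,
        quad_mul_of_mem G b hx, adB_mul_of_mem G b hx hy, adB_mul_of_mem G b hy hx,
        quad_mul_of_mem G b hy, mul_add, mul_smul_comm, h.symm hx hy]
      rcases zmod2_cases p with rfl | rfl <;> rcases zmod2_cases q with rfl | rfl <;>
        simp [one_add_one_zmod2] <;> abel
    rw [this]
    exact Submodule.smul_mem _ _ h3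
  · intro p x hx t ht hD
    rw [quad_mul_of_mem G b hx]
    exact add_mem (h.adB_mem hx ht) (Submodule.smul_mem _ _ (mul_mem_comIdeal _ hD))

theorem OddLie.codiff_mem (h : OddLie G b d) {t : TA V}
    (ht : t ∈ comIdeal G) : codiff G b d t ∈ comIdeal G := by
  rw [codiff]
  exact add_mem (h.parity_d.derP_mem ht) (h.quad_mem ht)

/-! ### Convolution with the identity -/

variable (G)

/-- Applies `φ` to a subset of the letters and puts the result in front of the others. -/
def conv : (TA V →ₗ[ℂ] V) →ₗ[ℂ] (TA V →ₗ[ℂ] TA V) where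
  toFun φ := (LinearMap.mul' ℂ (TA V)).comp
    ((TensorProduct.map (lt.comp φ) LinearMap.id).comp (cop G))
  map_add' φ ψ := by
    rw [LinearMap.comp_add, TensorProduct.map_add_left, LinearMap.add_comp, LinearMap.comp_add]
  map_smul' c φ := by
    rw [LinearMap.comp_smul, TensorProduct.map_smul_left, LinearMap.smul_comp, LinearMap.comp_smul]
    rfl

theorem conv_apply (φ : TA V →ₗ[ℂ] V) (t : TA V) :
    conv G φ t = LinearMap.mul' ℂ (TA V) (TensorProduct.map (lt.comp φ) LinearMap.id (cop G t)) := rfl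

@[simp] theorem conv_one (φ : TA V →ₗ[ℂ] V) : conv G φ 1 = lt (φ 1) := by
  simp [conv_apply]

variable {G}

theorem lt_mul_swap_mem {p : ZMod 2} {x : V} (hx : x ∈ G.part p) (v : V) (r : TA V) :
    lt ((G.op ^ p.val) v) * (lt x * r) - lt x * (lt v * r) ∈ comIdeal G := by
  refine G.hom_induction (C := fun v => lt ((G.op ^ p.val) v) * (lt x * r) - lt x * (lt v * r)
    ∈ comIdeal G) (fun v w hv hw => ?_) (fun q v hv => ?_) v
  · have := add_mem hv hw
    simp only [map_add, add_mul, mul_add] at this ⊢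
    convert this using 1
    abel
  · have h1 := comRel_mul_mem hx hv r
    have : lt ((G.op ^ p.val) v) * (lt x * r) - lt x * (lt v * r)
        = -(comRel p q x v * r) := by
      rw [G.op_pow_of_mem hv, comRel, sub_mul, map_smul, smul_mul_assoc, smul_mul_assoc, mul_assoc,
        mul_assoc, neg_sub]
    rw [this]
    exact neg_mem h1

/-- The letter `x` is either an argument of `φ` or stays outside. In the latter case it ends up
behind the value of `φ` and has to be moved in front of it, which is possible only modulo
commutators. -/
theorem conv_mul_sub_mem {p e : ZMod 2} {x : V} (hx : x ∈ G.part p) (φ : TA V →ₗ[ℂ] V)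
    (hφ : ∀ t, φ (par G p t) = sgn (e * p) • (G.op ^ p.val) (φ t)) (t : TA V) :
    conv G φ (lt x * t) - (conv G (shiftBy φ x) t + sgn (e * p) • (lt x * conv G φ t))
      ∈ comIdeal G := by
  rw [conv_apply, conv_apply, conv_apply, cop_mul]
  induction cop G t using TensorProduct.induction_on with
  | zero => simp
  | add u v hu hv =>
    have := add_mem hu hv
    simp only [map_add, mul_add, smul_add] at this ⊢
    convert this using 1
    abel
  | tmul s r =>
    have := Submodule.smul_mem _ (sgn (e * p)) (lt_mul_swap_mem hx (φ s) r)
    rw [act_tmul G hx]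
    simp only [map_add, TensorProduct.map_tmul, LinearMap.mul'_apply, LinearMap.comp_apply, hφ,
      LinearMap.id_apply, LinearMap.mulLeft_apply, map_smul, smul_mul_assoc]
    rw [smul_sub] at this
    convert this using 1
    abel

/-- The functional `t ↦ ε(t) v`. -/
abbrev augSmul (v : V) : TA V →ₗ[ℂ] V :=
  (LinearMap.toSpanSingleton ℂ V v).comp
    (TensorAlgebra.algebraMapInv (R := ℂ) (M := V)).toLinearMap

theorem aug_par (q : ZMod 2) (t : TA V) :
    TensorAlgebra.algebraMapInv (par G q t) = (TensorAlgebra.algebraMapInv t : ℂ) := by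
  have : (TensorAlgebra.algebraMapInv (R := ℂ) (M := V)).comp (par G q)
      = TensorAlgebra.algebraMapInv := by
    ext x
    simp [aug_lt]
  exact DFunLike.congr_fun this t

/-- Only the empty subset of letters contributes: this is the counit property of `cop`. -/
theorem conv_augSmul (v : V) (t : TA V) : conv G (augSmul v) t = lt v * t := by
  have : conv G (augSmul v) = LinearMap.mulLeft ℂ (lt v) := by
    refine ta_hom_ext G (by simp) fun p x hx t ht => ?_
    have h1 : ∀ t, TensorProduct.lid ℂ (TA V) (TensorProduct.map
        (TensorAlgebra.algebraMapInv (R := ℂ) (M := V)).toLinearMap LinearMap.id (cop G t)) = t := by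
      intro t
      refine ta_hom_induction G (C := fun t => TensorProduct.lid ℂ (TA V) (TensorProduct.map
        (TensorAlgebra.algebraMapInv (R := ℂ) (M := V)).toLinearMap LinearMap.id (cop G t)) = t)
        (by simp) (fun s t hs ht => by simp only [map_add, hs, ht])
        (fun c t ht => by simp only [map_smul, ht]) (fun p x hx t ht => ?_) t
      rw [cop_mul]
      nth_rewrite 2 [← ht]
      induction cop G t using TensorProduct.induction_on with
      | zero => simp
      | add u v hu hv => simp only [map_add, hu, hv, mul_add]
      | tmul s r => simp [act_tmul G hx, aug_par]
    rw [LinearMap.mulLeft_apply]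
    nth_rewrite 2 [← h1 (lt x * t)]
    rw [conv_apply]
    induction cop G (lt x * t) using TensorProduct.induction_on with
    | zero => simp
    | add u v hu hv => simp only [map_add, hu, hv, mul_add]
    | tmul s r => simp
  exact DFunLike.congr_fun this t

theorem pr₁_par (q : ZMod 2) (t : TA V) : pr₁ (par G q t) = (G.op ^ q.val) (pr₁ t) := by
  have : pr₁.comp (par G q).toLinearMap = (G.op ^ q.val).comp pr₁ :=
    ta_cases_ext (by simp) fun x t => by
      simp only [LinearMap.comp_apply, AlgHom.toLinearMap_apply, tmap_mul, pr₁_mul, map_smul]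
      rw [aug_par]
  exact DFunLike.congr_fun this t

theorem HasParity.conv_derP {a : ZMod 2} {A : V →ₗ[ℂ] V} (hA : HasParity G a A) (t : TA V) :
    conv G (pr₁.comp (derP G a A)) t - derP G a A t ∈ comIdeal G := by
  refine ta_hom_induction G (C := fun t => conv G (pr₁.comp (derP G a A)) t - derP G a A t
    ∈ comIdeal G) (by simp) (fun s t hs ht => ?_) (fun c t ht => ?_) (fun q y hy t ht => ?_) t
  · convert add_mem hs ht using 1
    simp only [map_add]; abel
  · convert Submodule.smul_mem _ c ht using 1
    simp only [map_smul, smul_sub]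
  · have h1 := conv_mul_sub_mem (e := a) hy (pr₁.comp (derP G a A)) (fun t => by
      have := hA.par_derP q t
      rw [LinearMap.comp_apply, LinearMap.comp_apply, ← pr₁_par, this, map_smul, sgn_smul_sgn_smul]) t
    have h2 := Submodule.smul_mem _ (sgn (a * q)) (mul_mem_comIdeal (lt y) ht)
    have h3 : shiftBy (pr₁.comp (derP G a A)) y = augSmul (A y) := by
      ext u
      simp [derP_mul G hy, pr₁_mul, aug_der]
    rw [h3, conv_augSmul] at h1
    convert add_mem h1 h2 using 1
    rw [derP_mul G hy, mul_sub, smul_sub]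
    abel

/-- A coderivation of the symmetric coalgebra is determined by its components. Hence the subset
formula of `compCoder` can be replaced by the operator `codiff` inside any functional that kills
commutators. -/
theorem OddLie.conv_codiff (h : OddLie G b d) (t : TA V) :
    conv G (pr₁.comp (codiff G b d)) t - codiff G b d t ∈ comIdeal G := by
  refine ta_hom_induction G (C := fun t => conv G (pr₁.comp (codiff G b d)) t - codiff G b d t
    ∈ comIdeal G) (by simp) (fun s t hs ht => ?_) (fun c t ht => ?_) (fun q y hy t ht => ?_) t
  · convert add_mem hs ht using 1
    simp only [map_add]; abel
  · convert Submodule.smul_mem _ c ht using 1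
    simp only [map_smul, smul_sub]
  · have h1 := conv_mul_sub_mem (e := 1) hy (pr₁.comp (codiff G b d)) (fun t => by
      have := h.par_codiff q t
      rw [LinearMap.comp_apply, LinearMap.comp_apply, ← pr₁_par, this, map_smul, one_mul,
        sgn_smul_sgn_smul]) t
    have h2 := Submodule.smul_mem _ (sgn q) (mul_mem_comIdeal (lt y) ht)
    -- With `y` as first letter, `codiff` contributes to degree one either `d y`, when nothing
    -- follows, or the action of `y` on the rest; the term with `y` left in place has too many
    -- letters.
    have h3 : shiftBy (pr₁.comp (codiff G b d)) y
        = augSmul (d y) + pr₁.comp (adB G b y) := by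
      ext u
      simp [codiff_mul_of_mem G b d hy, pr₁_mul, aug_codiff]
    have h4 := (h.parity_b hy).conv_derP t
    rw [← adB_of_mem G b hy] at h4
    rw [h3, map_add, LinearMap.add_apply, conv_augSmul, one_mul] at h1
    convert add_mem (add_mem h1 h2) h4 using 1
    rw [codiff_mul_of_mem G b d hy, mul_sub, smul_sub]
    abel

end Ideal

end MoritaLInf

end

noncomputable section

namespace MoritaLInf

open TensorAlgebra

open scoped TensorProduct

/-! ## Comparison of the operations with operators on the tensor algebra -/

section Sublist

variable {V : Type*}

/-- The letters with indices satisfying `P`. -/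
def sublist {n : ℕ} (x : Fin n → V) (P : Fin n → Prop) [DecidablePred P] : List V :=
  ((List.finRange n).filter fun i => P i).map x

/-- Both lists are increasing and have the same elements, hence coincide. -/
theorem ofFn_restrictTo {n : ℕ} (x : Fin n → V) (S : Finset (Fin n)) :
    List.ofFn (restrictTo x S) = sublist x (· ∈ S) := by
  have h1 : List.ofFn (fun t : Fin S.card => S.orderEmbOfFin rfl t)
      = (List.finRange n).filter fun i => i ∈ S := by
    have hn : (List.ofFn (fun t : Fin S.card => S.orderEmbOfFin rfl t)).Nodup :=
      List.nodup_ofFn.2 (S.orderEmbOfFin rfl).injective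
    refine List.Perm.eq_of_pairwise (le := (· ≤ ·)) (fun a b _ _ h h' => le_antisymm h h') ?_ ?_ ?_
    · rw [List.pairwise_ofFn]
      intro i j hij
      exact (S.orderEmbOfFin rfl).monotone hij.le
    · refine List.Pairwise.filter _ ?_
      exact (List.pairwise_lt_finRange n).imp fun h => h.le
    · rw [List.perm_ext_iff_of_nodup hn ((List.nodup_finRange n).filter _)]
      intro a
      have : a ∈ Set.range (S.orderEmbOfFin rfl) ↔ a ∈ S := by
        rw [Finset.range_orderEmbOfFin]; rfl
      rw [List.mem_ofFn, List.mem_filter, decide_eq_true_iff, ← this]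
      exact ⟨fun h => ⟨List.mem_finRange a, h⟩, fun h => h.2⟩
  rw [sublist, ← h1, List.map_ofFn]
  rfl

theorem sublist_congr {n : ℕ} (x : Fin n → V) {P Q : Fin n → Prop} [DecidablePred P]
    [DecidablePred Q] (h : ∀ i, P i ↔ Q i) : sublist x P = sublist x Q := by
  simp [sublist, h]

theorem sublist_succ {n : ℕ} (x : Fin (n + 1) → V) (P : Fin (n + 1) → Prop) [DecidablePred P] :
    sublist x P = if P 0 then x 0 :: sublist (Fin.tail x) (fun i => P i.succ)
      else sublist (Fin.tail x) (fun i => P i.succ) := by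
  have e : ((List.map Fin.succ (List.finRange n)).filter fun i => P i)
      = ((List.finRange n).filter fun i => P i.succ).map Fin.succ := by
    rw [List.filter_map]; rfl
  rw [sublist, List.finRange_succ, List.filter_cons, e]
  by_cases h : P 0
  · rw [if_pos h, if_pos (by simpa using h), List.map_cons, List.map_map]
    rfl
  · rw [if_neg h, if_neg (by simpa using h), List.map_map]
    rfl

end Sublist

/-! ### Koszul-signed sums over subsets and partitions, expressed by the coproduct. -/

section Shuffle

variable {V : Type*} [AddCommGroup V] [Module ℂ V]

theorem tprod_restrictTo {n : ℕ} (x : Fin n → V) (S : Finset (Fin n)) :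
    TensorAlgebra.tprod ℂ V _ (restrictTo x S) = word (sublist x (· ∈ S)) := by
  rw [tprod_eq_word, ofFn_restrictTo]

theorem par_sublist (G : SuperGrading V) (q : ZMod 2) {n : ℕ} {p : Fin n → ZMod 2} {x : Fin n → V}
    (hx : ∀ i, x i ∈ G.part (p i)) (P : Fin n → Prop) [DecidablePred P] :
    par G q (word (sublist x P))
      = (∏ i, if P i then sgn (q * p i) else 1) • word (sublist x P) := by
  induction n with
  | zero => simp [sublist]
  | succ n ih =>
    have ih' := ih (p := Fin.tail p) (x := Fin.tail x) (fun i => hx i.succ) (fun i => P i.succ)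
    rw [sublist_succ, Fin.prod_univ_succ]
    split_ifs with h0
    · rw [word_cons, par_mul_of_mem G (hx 0), ih', mul_smul_comm, smul_smul]
      rfl
    · rw [ih', one_mul]
      rfl

/-- The new first index is crossed exactly by the later indices of colour `0`, and only if its own
colour is `1`. -/
theorem koszulSign_cons {n : ℕ} (p : Fin (n + 1) → ZMod 2) (e : Fin 2) (c : Fin n → Fin 2) :
    koszulSign p (fun i => ((Fin.cons e c : Fin (n + 1) → Fin 2) i : ℕ))
      = (∏ j : Fin n, if e = 1 ∧ c j = 0 then sgn (p 0 * p j.succ) else 1)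
        * koszulSign (Fin.tail p) (fun i => (c i : ℕ)) := by
  have he : ∀ j, c j < e ↔ (e = 1 ∧ c j = 0) := by
    intro j
    generalize c j = f
    revert e f
    decide
  simp [koszulSign, Fin.prod_univ_succ, he, Fin.tail]

/-- The unshuffle coproduct of a product of homogeneous letters. -/
theorem cop_tprod (G : SuperGrading V) {n : ℕ} {p : Fin n → ZMod 2} {x : Fin n → V}
    (hx : ∀ i, x i ∈ G.part (p i)) :
    cop G (TensorAlgebra.tprod ℂ V n x) = ∑ c : Fin n → Fin 2,
      koszulSign p (fun i => (c i : ℕ)) •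
        (word (sublist x fun i => c i = 0) ⊗ₜ[ℂ] word (sublist x fun i => c i = 1)) := by
  induction n with
  | zero => simp [sublist, koszulSign]
  | succ n ih =>
    have ih' := ih (p := Fin.tail p) (x := Fin.tail x) (fun i => hx i.succ)
    have e : TensorAlgebra.tprod ℂ V (n + 1) x
        = lt (x 0) * TensorAlgebra.tprod ℂ V n (Fin.tail x) := by
      rw [tprod_eq_word, tprod_eq_word, List.ofFn_succ, word_cons]
      rfl
    rw [e, cop_mul, ih', map_sum,
      ← (Fin.consEquiv fun _ : Fin (n + 1) => Fin 2).sum_comp, Fintype.sum_prod_type,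
      Fin.sum_univ_two, ← Finset.sum_add_distrib]
    refine Finset.sum_congr rfl fun c _ => ?_
    have h0 : ∀ e : Fin 2, (Fin.consEquiv fun _ : Fin (n + 1) => Fin 2) (e, c)
      = (Fin.cons e c : Fin (n + 1) → Fin 2) := fun _ => rfl
    have hp := par_sublist G (p 0) (p := Fin.tail p) (x := Fin.tail x) (fun i => hx i.succ)
      (fun i => c i = 0)
    rw [map_smul, act_tmul G (hx 0), hp]
    simp only [h0, koszulSign_cons, sublist_succ, Fin.cons_zero, Fin.cons_succ]
    simp [TensorProduct.smul_tmul', smul_smul, Fin.tail, mul_comm]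

variable {V' : Type*} [AddCommGroup V'] [Module ℂ V']

/-- The functional `φ` on the tensor algebra has components `F`. -/
def Represents (φ : TA V →ₗ[ℂ] V') (F : Ops V V') : Prop :=
  ∀ n x, F n x = φ (TensorAlgebra.tprod ℂ V n x)

/-- Subsets `S` correspond to the two-colourings in the coproduct, with `S` coloured `0` as the left
tensor factor. -/
theorem compCoder_eq (G : SuperGrading V) {φ : TA V →ₗ[ℂ] V'} {F : Ops V V'} (hF : Represents φ F)
    {ψ : TA V →ₗ[ℂ] V} {ℓ : Ops V V} (hℓ : Represents ψ ℓ) {n : ℕ} {p : Fin n → ZMod 2}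
    {x : Fin n → V} (hx : ∀ i, x i ∈ G.part (p i)) :
    compCoder F ℓ p x = φ (conv G ψ (TensorAlgebra.tprod ℂ V n x)) := by
  rw [conv_apply, cop_tprod G hx, map_sum, map_sum, map_sum, compCoder]
  refine Finset.sum_nbij' (fun S i => if i ∈ S then 0 else 1)
    (fun c => Finset.univ.filter fun i => c i = 0) (by simp) (by simp) ?_ ?_ ?_
  · intro S _
    ext i
    by_cases h : i ∈ S <;> simp [h]
  · intro c _
    funext i
    have : ∀ e : Fin 2, (if e = 0 then (0 : Fin 2) else 1) = e := by decide
    simpa using this (c i)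
  · intro S _
    have e1 : koszulSign p (fun i => ((if i ∈ S then 0 else 1 : Fin 2) : ℕ))
        = koszulSign p (fun i => if i ∈ S then 0 else 1) := by
      congr 1
      funext i
      split_ifs <;> rfl
    have e2 : ∀ (y : V) (z : Fin Sᶜ.card → V), TensorAlgebra.tprod ℂ V (Sᶜ.card + 1)
        (Fin.cons y z : Fin (Sᶜ.card + 1) → V) = lt y * TensorAlgebra.tprod ℂ V _ z := by
      intro y z
      rw [tprod_eq_word, tprod_eq_word, List.ofFn_succ, word_cons]
      simp
    rw [map_smul, map_smul, map_smul, e1, TensorProduct.map_tmul, LinearMap.mul'_apply, hF, hℓ, e2,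
      tprod_restrictTo, tprod_restrictTo]
    simp only [LinearMap.comp_apply, LinearMap.id_apply]
    congr 3
    · congr 3
      exact sublist_congr _ fun i => by by_cases h : i ∈ S <;> simp [h]
    · congr 1
      exact sublist_congr _ fun i => by by_cases h : i ∈ S <;> simp [h]

/-- The pairing of `φ ⊗ φ` with a bilinear map. -/
def pairing (b' : V' →ₗ[ℂ] V' →ₗ[ℂ] V') (φ : TA V →ₗ[ℂ] V') : TA V ⊗[ℂ] TA V →ₗ[ℂ] V' :=
  (TensorProduct.lift b').comp (TensorProduct.map φ φ)

@[simp] theorem pairing_tmul (b' : V' →ₗ[ℂ] V' →ₗ[ℂ] V') (φ : TA V →ₗ[ℂ] V') (s r : TA V) :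
    pairing b' φ (s ⊗ₜ r) = b' (φ s) (φ r) := rfl

/-- Only partitions into one or two blocks occur when the target has just a differential and a
bracket. Surjectivity of the colouring may be dropped because `φ 1 = 0` kills an empty block, and
`2⁻¹` is the factor `1/2!`. -/
theorem compMor_eq (G : SuperGrading V) {φ : TA V →ₗ[ℂ] V'} {F : Ops V V'} (hF : Represents φ F)
    (hφ : φ 1 = 0) {ℓ' : Ops V' V'} {d' : V' →ₗ[ℂ] V'} {b' : V' →ₗ[ℂ] V' →ₗ[ℂ] V'}
    (h1 : ∀ v, ℓ' 1 v = d' (v 0)) (h2 : ∀ v, ℓ' 2 v = b' (v 0) (v 1))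
    (h0 : ∀ k, k ≠ 1 → k ≠ 2 → ℓ' k = 0) {n : ℕ} {p : Fin n → ZMod 2}
    {x : Fin n → V} (hx : ∀ i, x i ∈ G.part (p i)) :
    compMor ℓ' F p x = d' (φ (TensorAlgebra.tprod ℂ V n x))
      + (2⁻¹ : ℂ) • pairing b' φ (cop G (TensorAlgebra.tprod ℂ V n x)) := by
  classical
  have hblock : ∀ {k : ℕ} (c : Fin n → Fin k) (b : Fin k),
      F (block c b).card (restrictTo x (block c b)) = φ (word (sublist x fun i => c i = b)) := by
    intro k c b
    rw [hF, tprod_restrictTo]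
    congr 2
    exact sublist_congr _ fun i => by simp [block]
  have hempty : ∀ {k : ℕ} (c : Fin n → Fin k) (b : Fin k), (∀ i, c i ≠ b) →
      φ (word (sublist x fun i => c i = b)) = 0 := by
    intro k c b hb
    have : (sublist x fun i => c i = b) = [] := by simp [sublist, hb]
    rw [this, word_nil, hφ]
  set f : ℕ → V' := fun k => (k.factorial : ℂ)⁻¹ •
    ∑ c : Fin n → Fin k, if Function.Surjective c then
      koszulSign p (fun i => (c i : ℕ)) •
        ℓ' k fun b => F (block c b).card (restrictTo x (block c b))
    else 0 with hf
  have hbig : ∀ k, n < k → f k = 0 := by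
    intro k hk
    rw [hf]
    refine smul_eq_zero_of_right _ (Finset.sum_eq_zero fun c _ => if_neg fun hc => ?_)
    have := Fintype.card_le_of_surjective c hc
    simp at this
    omega
  have hsum : compMor ℓ' F p x = f 1 + f 2 := by
    have e : compMor ℓ' F p x = ∑ k ∈ Finset.range (n + 1), f k := by
      simp only [compMor, hf]
    rw [e]
    -- The range is enlarged so that it contains `1` and `2` even for small `n`; the added terms
    -- have no surjective colouring.
    have e2 : ∑ k ∈ Finset.range (n + 1), f k = ∑ k ∈ Finset.range (n + 3), f k := by
      refine Finset.sum_subset (by intro k; simp; omega) fun k _ hk => hbig k ?_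
      simp at hk
      omega
    rw [e2, ← Finset.sum_subset (s₁ := {1, 2}) (by intro k; simp; omega)]
    · simp
    · intro k _ hk
      simp only [Finset.mem_insert, Finset.mem_singleton, not_or] at hk
      simp [hf, h0 k hk.1 hk.2]
  rw [hsum]
  congr 1
  · have hw : (sublist x fun i => (0 : Fin 1) = 0) = List.ofFn x := by
      simp [sublist, List.ofFn_eq_map]
    have hk : koszulSign p (fun _ => ((0 : Fin 1) : ℕ)) = 1 := by simp [koszulSign]
    have hu : ∀ c : Fin n → Fin 1, c = fun _ => 0 := fun c => Subsingleton.elim _ _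
    simp only [hf]
    rw [Finset.sum_eq_single_of_mem (fun _ => 0) (Finset.mem_univ _)
      (fun c _ hc => absurd (hu c) hc), h1, hblock, hw, hk, tprod_eq_word]
    split_ifs with hs
    · simp
    -- The only nonsurjective colouring by one colour is that of the empty set, where `φ 1 = 0`
    -- makes both sides agree.
    · have : n = 0 := by
        by_contra hn
        exact hs fun b => ⟨⟨0, by omega⟩, Subsingleton.elim _ _⟩
      subst this
      simp [hφ]
  · rw [cop_tprod G hx, map_sum]
    simp only [hf]
    congr 1
    refine Finset.sum_congr rfl fun c _ => ?_
    rw [map_smul, pairing_tmul, h2, hblock, hblock]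
    split_ifs with hs
    · rfl
    · obtain ⟨b, hb⟩ : ∃ b, ∀ i, c i ≠ b := by
        by_contra hb
        refine hs fun b => ?_
        by_contra hc
        exact hb (Exists.intro b fun i hi => hc (Exists.intro i hi))
      have : b = 0 ∨ b = 1 := by
        clear hb
        revert b
        decide
      rcases this with rfl | rfl
      · simp [hempty c 0 hb]
      · simp [hempty c 1 hb]

end Shuffle

end MoritaLInf

end

noncomputable section

namespace MoritaLInf

open TensorAlgebra

open scoped TensorProduct

/-! ## Graded symmetry -/

section Symmetry

/-- An adjacent transposition changes the relative order of just one pair. Since signs square to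
one, creating an inversion and removing one have the same effect. -/
theorem koszulSign_mul_swap {n : ℕ} (p : Fin (n + 1) → ZMod 2) (σ : Equiv.Perm (Fin (n + 1)))
    (k : Fin n) :
    koszulSign p (fun i => ((σ * Equiv.swap k.castSucc k.succ).symm i : ℕ))
      = sgn (p (σ k.castSucc) * p (σ k.succ)) * koszulSign p (fun i => (σ.symm i : ℕ)) := by
  set s := Equiv.swap k.castSucc k.succ with hs
  set g : Fin (n + 1) → Fin (n + 1) → ℂ := fun a b => sgn (p (σ a) * p (σ b)) with hg
  -- Reindexing by `σ` turns the colours into positions, where the transposition only exchanges two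
  -- neighbours.
  have hre : ∀ c : Fin (n + 1) → ℕ, koszulSign p c
      = ∏ a, ∏ b, if σ a < σ b ∧ c (σ b) < c (σ a) then g a b else 1 := by
    intro c
    rw [koszulSign, ← Equiv.prod_comp σ]
    refine Finset.prod_congr rfl fun a _ => ?_
    rw [← Equiv.prod_comp σ]
  have hne : k.castSucc ≠ k.succ := (Fin.castSucc_lt_succ).ne
  have hlt : k.castSucc < k.succ := Fin.castSucc_lt_succ
  have hcases : ∀ a, s a = if a = k.castSucc then k.succ else if a = k.succ then k.castSucc else a :=
    fun a => Equiv.swap_apply_def _ _ _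
  have hsq : ∀ a b, g a b * g a b = 1 := fun a b => sgn_mul_self _
  rw [hre, hre]
  -- The first factor is the inversion that the transposition creates, the second cancels the one
  -- that it removes; exactly one of them is nontrivially present, depending on the order of the two
  -- images under `σ`.
  have key : ∀ a b, (if σ a < σ b ∧ ((σ * s).symm (σ b) : ℕ) < ((σ * s).symm (σ a) : ℕ)
        then g a b else 1)
      = ((if a = k.castSucc then if b = k.succ then if σ a < σ b then g a b else 1 else 1 else 1)
        * (if a = k.succ then if b = k.castSucc then if σ a < σ b then g a b else 1 else 1 else 1))
        * (if σ a < σ b ∧ (σ.symm (σ b) : ℕ) < (σ.symm (σ a) : ℕ) then g a b else 1) := by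
    intro a b
    have e : ∀ a, (σ * s).symm (σ a) = s a := by
      intro a
      rw [Equiv.symm_apply_eq, Equiv.Perm.mul_apply, hs, Equiv.swap_apply_self]
    rw [e, e, Equiv.symm_apply_apply, Equiv.symm_apply_apply, hcases a, hcases b]
    have hk : (k.castSucc : Fin (n + 1)).val = k := rfl
    have hk' : (k.succ : Fin (n + 1)).val = k + 1 := rfl
    by_cases hσ : σ a < σ b
    · by_cases ha : a = k.castSucc
      · subst ha
        by_cases hb : b = k.succ
        · subst hb
          simp [hσ, hne, hne.symm]
        · by_cases hb' : b = k.castSucc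
          · subst hb'
            exact absurd hσ (lt_irrefl _)
          · have : b.val < k.val + 1 ↔ b.val < k.val := by
              have : b.val ≠ k.val := fun h => hb' (Fin.ext h)
              omega
            simp [hσ, hb, hb', hne, this]
      · by_cases ha' : a = k.succ
        · subst ha'
          by_cases hb : b = k.castSucc
          · subst hb
            simp [hσ, hne.symm, hsq]
          · by_cases hb' : b = k.succ
            · subst hb'
              exact absurd hσ (lt_irrefl _)
            · have : b.val < k.val + 1 ↔ b.val < k.val := by
                have : b.val ≠ k.val := fun h => hb (Fin.ext h)
                omega
              simp [hσ, hb, hb', hne.symm, this]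
        · have h1 : a.val ≠ k.val := fun h => ha (Fin.ext h)
          have h2 : a.val ≠ k.val + 1 := fun h => ha' (Fin.ext h)
          by_cases hb : b = k.castSucc
          · subst hb
            have : k.val + 1 < a.val ↔ k.val < a.val := by omega
            simp [hσ, ha, ha', this]
          · by_cases hb' : b = k.succ
            · subst hb'
              have : k.val + 1 < a.val ↔ k.val < a.val := by omega
              simp [hσ, ha, ha', hb, this]
            · simp [hσ, ha, ha', hb, hb']
    · simp [hσ]
  have hprod : ∀ (u v : Fin (n + 1)) (f : Fin (n + 1) → Fin (n + 1) → ℂ),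
      ∏ a, ∏ b, (if a = u then if b = v then f a b else 1 else 1) = f u v := by
    intro u v f
    rw [Finset.prod_eq_single u, Finset.prod_eq_single v] <;> simp +contextual
  simp only [key, Finset.prod_mul_distrib, hprod]
  congr 1
  rcases lt_or_gt_of_ne (fun h => hne (σ.injective h) : σ k.castSucc ≠ σ k.succ) with h | h
  · simp [h, h.le, hg]
  · simp [h, h.le, hg, mul_comm]

variable {V V' : Type*} [AddCommGroup V] [Module ℂ V] [AddCommGroup V'] [Module ℂ V']

theorem tprod_succ {n : ℕ} (x : Fin (n + 1) → V) : TensorAlgebra.tprod ℂ V (n + 1) x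
    = lt (x 0) * TensorAlgebra.tprod ℂ V n (Fin.tail x) := by
  rw [tprod_eq_word, tprod_eq_word, List.ofFn_succ, word_cons]
  rfl

@[simp] theorem tprod_zero (x : Fin 0 → V) : TensorAlgebra.tprod ℂ V 0 x = 1 := by
  simp

variable {G : SuperGrading V} {G' : SuperGrading V'}

theorem tprod_swap_mem {n : ℕ} {p : Fin (n + 1) → ZMod 2} {x : Fin (n + 1) → V}
    (hx : ∀ i, x i ∈ G.part (p i)) (k : Fin n) :
    TensorAlgebra.tprod ℂ V (n + 1) (fun i => x (Equiv.swap k.castSucc k.succ i))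
      - sgn (p k.castSucc * p k.succ) • TensorAlgebra.tprod ℂ V (n + 1) x ∈ comIdeal G := by
  induction n with
  | zero => exact k.elim0
  | succ n ih =>
    refine Fin.cases ?_ (fun k => ?_) k
    · have h := comRel_mul_mem (hx 1) (hx 0)
        (TensorAlgebra.tprod ℂ V n (Fin.tail (Fin.tail x)))
      have e1 : Fin.tail (Fin.tail fun i => x (Equiv.swap 0 1 i)) = Fin.tail (Fin.tail x) := by
        funext i
        simp only [Fin.tail]
        rw [Equiv.swap_apply_of_ne_of_ne (by simp [Fin.ext_iff]) (by simp [Fin.ext_iff])]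
      rw [comRel, sub_mul, smul_mul_assoc, mul_assoc, mul_assoc, mul_comm (p 1)] at h
      simp only [Fin.castSucc_zero, Fin.succ_zero_eq_one, tprod_succ, e1]
      simp only [Fin.tail, Fin.succ_zero_eq_one, Equiv.swap_apply_left, Equiv.swap_apply_right]
      exact h
    · have h := mul_mem_comIdeal (lt (x 0)) (ih (p := Fin.tail p) (x := Fin.tail x)
        (fun i => hx i.succ) k)
      rw [mul_sub, mul_smul_comm] at h
      rw [tprod_succ, tprod_succ x]
      have e0 : Equiv.swap k.succ.castSucc k.succ.succ (0 : Fin (n + 1 + 1)) = 0 :=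
        Equiv.swap_apply_of_ne_of_ne (by simp [Fin.ext_iff]) (by simp [Fin.ext_iff])
      have e1 : (Fin.tail fun i => x (Equiv.swap k.succ.castSucc k.succ.succ i))
          = fun i => Fin.tail x (Equiv.swap k.castSucc k.succ i) := by
        funext i
        have : Equiv.swap k.succ.castSucc k.succ.succ i.succ
            = (Equiv.swap k.castSucc k.succ i).succ := by
          rw [Fin.castSucc_succ, (Fin.succ_injective _).swap_apply]
        simp only [Fin.tail]
        rw [this]
      rw [e0, e1]
      exact h

/-- Adjacent transpositions generate the symmetric group, and each of them costs one commutator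
relation. -/
theorem tprod_perm_mem {n : ℕ} {p : Fin n → ZMod 2} {x : Fin n → V}
    (hx : ∀ i, x i ∈ G.part (p i)) (τ : Equiv.Perm (Fin n)) :
    TensorAlgebra.tprod ℂ V n (fun i => x (τ i))
      - koszulSign p (fun i => (τ.symm i : ℕ)) • TensorAlgebra.tprod ℂ V n x ∈ comIdeal G := by
  have h1 : ∀ (n : ℕ) (p : Fin n → ZMod 2), koszulSign p (fun i => (i : ℕ)) = 1 := by
    intro n p
    refine Finset.prod_eq_one fun i _ => Finset.prod_eq_one fun j _ => if_neg ?_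
    rintro ⟨h, h'⟩
    exact absurd h (not_lt_of_gt h')
  rcases n with _ | n
  · have : τ = 1 := Subsingleton.elim _ _
    subst this
    have := h1 0 p
    change _ - koszulSign p (fun i => (i : ℕ)) • _ ∈ _
    rw [this]
    simp
  · have hτ : τ ∈ Submonoid.closure
        (Set.range fun i : Fin n => Equiv.swap i.castSucc i.succ) := by
      rw [Equiv.Perm.mclosure_swap_castSucc_succ]
      trivial
    induction hτ using Submonoid.closure_induction_right with
    | one =>
      change _ - koszulSign p (fun i => (i : ℕ)) • _ ∈ _
      rw [h1]
      simp
    | mul_right σ _ s hs ih =>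
      obtain ⟨k, rfl⟩ := hs
      have h2 := tprod_swap_mem (p := fun i => p (σ i)) (x := fun i => x (σ i))
        (fun i => hx _) k
      have h3 := add_mem h2 (Submodule.smul_mem _ (sgn (p (σ k.castSucc) * p (σ k.succ))) ih)
      rw [koszulSign_mul_swap, mul_smul]
      convert h3 using 1
      rw [smul_sub]
      simp only [Equiv.Perm.mul_apply]
      abel

theorem par_tprod {n : ℕ} {p : Fin n → ZMod 2} {x : Fin n → V}
    (hx : ∀ i, x i ∈ G.part (p i)) :
    par G 1 (TensorAlgebra.tprod ℂ V n x) = sgn (∑ i, p i) • TensorAlgebra.tprod ℂ V n x := by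
  induction n with
  | zero => simp
  | succ n ih =>
    have ih' := ih (p := Fin.tail p) (x := Fin.tail x) (fun i => hx i.succ)
    rw [tprod_succ, par_mul_of_mem G (hx 0), ih', one_mul, mul_smul_comm, smul_smul, ← sgn_add,
      Fin.sum_univ_succ]
    rfl

/-- Vanishing on the ideal of commutators is graded symmetry of all components at once, and
compatibility with the parity automorphism is homogeneity. -/
theorem isGradedSymm_of_represents {G : SuperGrading V} {G' : SuperGrading V'} {e : ZMod 2}
    {φ : TA V →ₗ[ℂ] V'} {F : Ops V V'}
    (hF : Represents φ F) (hI : ∀ t ∈ comIdeal G.shift, φ t = 0)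
    (hpar : ∀ t, φ (par G.shift 1 t) = sgn e • G'.shift.op (φ t)) : IsGradedSymm G G' e F where
  parity n p x hx := by
    have h := hpar (TensorAlgebra.tprod ℂ V n x)
    rw [par_tprod hx, map_smul] at h
    rw [SuperGrading.mem_part, hF, sgn_add, mul_smul, h, sgn_smul_sgn_smul]
  symm n p x hx τ := by
    have h := hI _ (tprod_perm_mem hx τ)
    rw [map_sub, map_smul, sub_eq_zero] at h
    rw [hF, hF, h]

end Symmetry

end MoritaLInf

end

noncomputable section

namespace MoritaLInf

open TensorAlgebra

open scoped TensorProduct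

/-! ## DG Lie algebras -/

section DGLie

variable {V V' : Type*} [AddCommGroup V] [Module ℂ V] [AddCommGroup V'] [Module ℂ V']

/-- The laws of a super DG Lie algebra. -/
structure DGLie (G : SuperGrading V) (d : V →ₗ[ℂ] V) (br : V →ₗ[ℂ] V →ₗ[ℂ] V) : Prop where
  d_mem : ∀ {p : ZMod 2} {x : V}, x ∈ G.part p → d x ∈ G.part (1 + p)
  d_d : ∀ x, d (d x) = 0
  br_mem : ∀ {p q : ZMod 2} {x y : V}, x ∈ G.part p → y ∈ G.part q → br x y ∈ G.part (p + q)
  skew : ∀ {p q : ZMod 2} {x y : V}, x ∈ G.part p → y ∈ G.part q →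
    br y x = -(sgn (p * q) • br x y)
  leib : ∀ {p q : ZMod 2} {x y : V}, x ∈ G.part p → y ∈ G.part q →
    d (br x y) = br (d x) y + sgn p • br x (d y)
  jac : ∀ {p q r : ZMod 2} {x y z : V}, x ∈ G.part p → y ∈ G.part q → z ∈ G.part r →
    br x (br y z) = br (br x y) z + sgn (p * q) • br y (br x z)

variable {G : SuperGrading V} {d : V →ₗ[ℂ] V} {br : V →ₗ[ℂ] V →ₗ[ℂ] V}

/-- The symmetric bracket on the suspension. -/
abbrev susp (G : SuperGrading V) (br : V →ₗ[ℂ] V →ₗ[ℂ] V) : V →ₗ[ℂ] V →ₗ[ℂ] V :=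
  br.comp G.shift.op

/-- This is the décalage: the sign in `susp` turns a graded skew bracket into an odd graded
symmetric one. Each law is reduced to homogeneous elements, where it is a comparison of signs. -/
theorem DGLie.oddLie (h : DGLie G d br) : OddLie G.shift (susp G br) d := by
  have hshift : ∀ {p : ZMod 2} {x : V}, x ∈ G.shift.part p → x ∈ G.part (p + 1) :=
    fun hx => G.mem_shift_part.1 hx
  have hop : ∀ {p : ZMod 2} {x : V}, x ∈ G.shift.part p → G.shift.op x = sgn p • x :=
    fun hx => G.shift.op_of_mem hx
  have hd : ∀ {p : ZMod 2} {x : V}, x ∈ G.shift.part p → d x ∈ G.shift.part (1 + p) := by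
    intro p x hx
    rw [G.mem_shift_part]
    have := h.d_mem (hshift hx)
    rwa [← add_assoc] at this
  have hb : ∀ {p q : ZMod 2} {x y : V}, x ∈ G.shift.part p → y ∈ G.shift.part q →
      br x y ∈ G.shift.part (1 + p + q) := by
    intro p q x y hx hy
    rw [G.mem_shift_part]
    have := h.br_mem (hshift hx) (hshift hy)
    convert this using 2
    ring
  refine ⟨fun x => ?_, h.d_d, fun x y => ?_, fun {p q x y} hx hy => ?_, fun x y => ?_,
    fun {p q x y} hx hy z => ?_⟩
  · refine G.shift.hom_induction (C := fun x => G.shift.op (d x) = -d (G.shift.op x))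
      (fun x y hx hy => by simp only [map_add, hx, hy, neg_add]) (fun p x hx => ?_) x
    rw [hop (hd hx), hop hx, map_smul, sgn_add]
    simp
  · refine G.shift.hom_induction (C := fun x => G.shift.op (susp G br x y)
      = -susp G br (G.shift.op x) (G.shift.op y))
      (fun x y hx hy => by simp only [map_add, hx, hy, neg_add, LinearMap.add_apply])
      (fun p x hx => ?_) x
    refine G.shift.hom_induction (C := fun y => G.shift.op (susp G br x y)
      = -susp G br (G.shift.op x) (G.shift.op y))
      (fun x y hx hy => by simp only [map_add, hx, hy, neg_add]) (fun q y hy => ?_) y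
    simp only [LinearMap.comp_apply, hop hx, hop hy, map_smul, LinearMap.smul_apply, hop (hb hx hy),
      sgn_add]
    rcases zmod2_cases p with rfl | rfl <;> rcases zmod2_cases q with rfl | rfl <;> simp
  · simp only [LinearMap.comp_apply, hop hx, hop hy, map_smul, LinearMap.smul_apply,
      h.skew (hshift hx) (hshift hy)]
    rcases zmod2_cases p with rfl | rfl <;> rcases zmod2_cases q with rfl | rfl <;>
      simp [one_add_one_zmod2]
  · refine G.shift.hom_induction (C := fun x => d (susp G br x y) + susp G br (d x) y
      + susp G br (G.shift.op x) (d y) = 0)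
      (fun x y hx hy => ?_) (fun p x hx => ?_) x
    · have := congrArg₂ (· + ·) hx hy
      simp only [map_add, LinearMap.add_apply, add_zero] at this ⊢
      rw [← this]
      abel
    · refine G.shift.hom_induction (C := fun y => d (susp G br x y) + susp G br (d x) y
        + susp G br (G.shift.op x) (d y) = 0)
        (fun x y hx hy => ?_) (fun q y hy => ?_) y
      · have := congrArg₂ (· + ·) hx hy
        simp only [map_add, add_zero] at this ⊢
        rw [← this]
        abel
      · simp only [LinearMap.comp_apply, hop hx, hop (hd hx), map_smul, LinearMap.smul_apply,
          h.leib (hshift hx) (hshift hy)]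
        rcases zmod2_cases p with rfl | rfl <;> rcases zmod2_cases q with rfl | rfl <;>
          simp [one_add_one_zmod2]
  · refine G.shift.hom_induction (C := fun z => susp G br (susp G br x y) z
      + susp G br (G.shift.op x) (susp G br y z)
      + sgn (p * q + q) • susp G br y (susp G br x z) = 0)
      (fun x y hx hy => ?_) (fun r z hz => ?_) z
    · have := congrArg₂ (· + ·) hx hy
      simp only [map_add, add_zero, smul_add] at this ⊢
      rw [← this]
      abel
    · simp only [LinearMap.comp_apply, hop hx, hop hy, map_smul, LinearMap.smul_apply,
        hop (hb hx hy), h.jac (hshift hx) (hshift hy) (hshift hz)]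
      rcases zmod2_cases p with rfl | rfl <;> rcases zmod2_cases q with rfl | rfl <;>
        simp [one_add_one_zmod2]

theorem pr₁_codiff (G : SuperGrading V) (b : V →ₗ[ℂ] V →ₗ[ℂ] V) (d : V →ₗ[ℂ] V) (x : V) (t : TA V) :
    pr₁ (codiff G b d (lt x * t)) = TensorAlgebra.algebraMapInv t • d x + b x (pr₁ t) := by
  refine G.hom_induction (C := fun x => pr₁ (codiff G b d (lt x * t))
    = TensorAlgebra.algebraMapInv t • d x + b x (pr₁ t)) (fun x y hx hy => ?_) (fun p x hx => ?_) x
  · simp only [map_add, add_mul, hx, hy, LinearMap.add_apply, smul_add]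
    abel
  · have : pr₁.comp (adB G b x) = (b x).comp pr₁ := by
      rw [adB_of_mem G b hx]
      exact ta_cases_ext (by simp) fun y t => by simp [der_mul, pr₁_mul, aug_der]
    have h2 : pr₁ (adB G b x t) = b x (pr₁ t) := DFunLike.congr_fun this t
    rw [codiff_mul_of_mem G b d hx, map_add, map_add, h2, map_smul, pr₁_mul, pr₁_mul, aug_codiff,
      zero_smul, smul_zero, add_zero]

theorem represents_dgLieOps (G : SuperGrading V) (d : V →ₗ[ℂ] V) (br : V →ₗ[ℂ] V →ₗ[ℂ] V) :
    Represents (pr₁.comp (codiff G.shift (susp G br) d)) (dgLieOps G d br) := by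
  intro n x
  rw [LinearMap.comp_apply]
  match n with
  | 0 => simp [dgLieOps]
  | 1 =>
    rw [tprod_succ, pr₁_codiff]
    simp only [tprod_zero, map_one, one_smul, pr₁_one, map_zero, add_zero]
    rfl
  | 2 =>
    rw [tprod_succ, pr₁_codiff, tprod_succ, tprod_zero, mul_one, pr₁_lt]
    rw [aug_lt, zero_smul, zero_add]
    rfl
  | n + 3 =>
    rw [tprod_succ, pr₁_codiff, tprod_succ, tprod_succ, pr₁_mul_mul, aug_mul]
    simp [dgLieOps]

theorem represents_strictOps (f : V →ₗ[ℂ] V') : Represents (f.comp pr₁) (strictOps f) := by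
  intro n x
  rw [LinearMap.comp_apply]
  match n with
  | 0 => simp [strictOps]
  | 1 =>
    rw [tprod_succ, pr₁_mul]
    simp only [tprod_zero, map_one, one_smul]
    rfl
  | n + 2 =>
    rw [tprod_succ, tprod_succ, pr₁_mul_mul]
    simp [strictOps]

theorem pr₁_comIdeal (G : SuperGrading V) {t : TA V} (ht : t ∈ comIdeal G) : pr₁ t = 0 := by
  -- The counit has to be carried along, since the degree one part of `x t` is the counit of `t`
  -- times `x`.
  have := map_mem_of_comIdeal (G := G) ((pr₁ (V := V)).prod
    (TensorAlgebra.algebraMapInv (R := ℂ) (M := V)).toLinearMap) ⊥ ?_ ?_ ht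
  · rw [Submodule.mem_bot] at this
    exact congrArg Prod.fst this
  · intro p q x y hx hy r
    simp [comRel, sub_mul, mul_assoc]
  · intro p x hx t ht h
    rw [Submodule.mem_bot] at h ⊢
    have : (TensorAlgebra.algebraMapInv t : ℂ) = 0 := congrArg Prod.snd h
    simp [pr₁_mul, this]

theorem counit_left (G : SuperGrading V) (t : TA V) : TensorProduct.lid ℂ (TA V) (TensorProduct.map
    (TensorAlgebra.algebraMapInv (R := ℂ) (M := V)).toLinearMap LinearMap.id (cop G t)) = t := by
  refine ta_hom_induction G (C := fun t => TensorProduct.lid ℂ (TA V) (TensorProduct.map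
    (TensorAlgebra.algebraMapInv (R := ℂ) (M := V)).toLinearMap LinearMap.id (cop G t)) = t)
    (by simp) (fun s t hs ht => by simp only [map_add, hs, ht])
    (fun c t ht => by simp only [map_smul, ht]) (fun p x hx t ht => ?_) t
  rw [cop_mul]
  nth_rewrite 2 [← ht]
  induction cop G t using TensorProduct.induction_on with
  | zero => simp
  | add u v hu hv => simp only [map_add, hu, hv, mul_add]
  | tmul s r => simp [act_tmul G hx, aug_par]

theorem counit_right (G : SuperGrading V) (t : TA V) : TensorProduct.rid ℂ (TA V) (TensorProduct.map
    LinearMap.id (TensorAlgebra.algebraMapInv (R := ℂ) (M := V)).toLinearMap (cop G t)) = t := by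
  refine ta_hom_induction G (C := fun t => TensorProduct.rid ℂ (TA V) (TensorProduct.map
    LinearMap.id (TensorAlgebra.algebraMapInv (R := ℂ) (M := V)).toLinearMap (cop G t)) = t)
    (by simp) (fun s t hs ht => by simp only [map_add, hs, ht])
    (fun c t ht => by simp only [map_smul, ht]) (fun p x hx t ht => ?_) t
  rw [cop_mul]
  nth_rewrite 2 [← ht]
  induction cop G t using TensorProduct.induction_on with
  | zero => simp
  | add u v hu hv => simp only [map_add, hu, hv, mul_add]
  | tmul s r => simp [act_tmul G hx]

/-- The coproduct sees an unordered pair of letters twice, once with each of them on the left; by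
symmetry of `b` the two contributions are equal, whence the factor `2⁻¹`. -/
theorem OddLie.pr₁_codiff_eq {G : SuperGrading V} {b : V →ₗ[ℂ] V →ₗ[ℂ] V} (h : OddLie G b d)
    (t : TA V) :
    pr₁ (codiff G b d t) = d (pr₁ t) + (2⁻¹ : ℂ) • pairing b pr₁ (cop G t) := by
  have : pr₁.comp (codiff G b d) = d.comp pr₁ + (2⁻¹ : ℂ) • (pairing b pr₁).comp (cop G) := by
    refine ta_hom_ext G (by simp) fun p x hx t _ => ?_
    simp only [LinearMap.comp_apply, LinearMap.add_apply, LinearMap.smul_apply, pr₁_codiff, cop_mul,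
      pr₁_mul, map_smul]
    have h1 : pairing b pr₁ (act G x (cop G t)) = b x (pr₁ (TensorProduct.lid ℂ (TA V)
        (TensorProduct.map (TensorAlgebra.algebraMapInv (R := ℂ) (M := V)).toLinearMap
          LinearMap.id (cop G t)))) + b x (pr₁ (TensorProduct.rid ℂ (TA V) (TensorProduct.map
        LinearMap.id (TensorAlgebra.algebraMapInv (R := ℂ) (M := V)).toLinearMap (cop G t)))) := by
      induction cop G t using TensorProduct.induction_on with
      | zero => simp
      | add u v hu hv => simp only [map_add, hu, hv]; abel
      | tmul s r =>
        have h2 : ∀ v, b ((G.op ^ p.val) v) x = b x v := by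
          refine G.hom_induction (fun v w hv hw => ?_) (fun q v hv => ?_)
          · simp only [map_add, LinearMap.add_apply, hv, hw]
          · rw [G.op_pow_of_mem hv, map_smul, LinearMap.smul_apply, h.symm hx hv, sgn_smul_sgn_smul]
        simp only [act_tmul G hx, map_add, pairing_tmul, pr₁_mul, map_smul, LinearMap.smul_apply,
          TensorProduct.map_tmul, TensorProduct.lid_tmul, TensorProduct.rid_tmul,
          AlgHom.toLinearMap_apply, LinearMap.id_apply, pr₁_par, h2]
    rw [h1, counit_left, counit_right, ← two_smul ℂ, smul_smul]
    norm_num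
  exact DFunLike.congr_fun this t

/-- Modulo commutators, which the representing functional kills, `compCoder` computes the degree one
part of the square of `codiff`, and that square is zero. -/
theorem DGLie.isLInfAlgebra (h : DGLie G d br) : IsLInfAlgebra G (dgLieOps G d br) := by
  have hI : ∀ t ∈ comIdeal G.shift, (pr₁.comp (codiff G.shift (susp G br) d)) t = 0 :=
    fun t ht => pr₁_comIdeal G.shift (h.oddLie.codiff_mem ht)
  refine ⟨isGradedSymm_of_represents (represents_dgLieOps G d br) hI fun t => ?_, rfl,
    fun n p x hx => ?_⟩
  · have := h.oddLie.par_codiff 1 t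
    have h2 : pr₁ (par G.shift 1 (codiff G.shift (susp G br) d t))
      = G.shift.op (pr₁ (codiff G.shift (susp G br) d t)) := by
      rw [pr₁_par, val_one_zmod2, pow_one]
    rw [LinearMap.comp_apply, LinearMap.comp_apply, ← h2, this, map_smul, sgn_smul_sgn_smul]
  · rw [compCoder_eq G.shift (represents_dgLieOps G d br) (represents_dgLieOps G d br) hx]
    have := hI _ (h.oddLie.conv_codiff (TensorAlgebra.tprod ℂ V n x))
    rw [map_sub, sub_eq_zero] at this
    rw [this, LinearMap.comp_apply, h.oddLie.codiff_codiff, map_zero]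

/-- A functional on the tensor algebra that satisfies the equations of a morphism. -/
theorem isLInfMorphism_of_represents {G' : SuperGrading V'} {d' : V' →ₗ[ℂ] V'}
    {br' : V' →ₗ[ℂ] V' →ₗ[ℂ] V'} (h : DGLie G d br) {φ : TA V →ₗ[ℂ] V'} {F : Ops V V'}
    (hF : Represents φ F) (h1 : φ 1 = 0) (hI : ∀ t ∈ comIdeal G.shift, φ t = 0)
    (hpar : ∀ t, φ (par G.shift 1 t) = G'.shift.op (φ t))
    (hφ : ∀ t, φ (codiff G.shift (susp G br) d t)
      = d' (φ t) + (2⁻¹ : ℂ) • pairing (susp G' br') φ (cop G.shift t)) :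
    IsLInfMorphism G G' (dgLieOps G d br) (dgLieOps G' d' br') F := by
  refine ⟨isGradedSymm_of_represents hF hI fun t => by rw [hpar, sgn_zero, one_smul], ?_,
    fun n p x hx => ?_⟩
  · ext x
    rw [hF, tprod_zero, h1]
    rfl
  · rw [compCoder_eq G.shift hF (represents_dgLieOps G d br) hx,
      compMor_eq G.shift hF h1 (d' := d') (b' := susp G' br') (fun v => rfl) (fun v => rfl) ?_ hx]
    · have := hI _ (h.oddLie.conv_codiff (TensorAlgebra.tprod ℂ V n x))
      rw [map_sub, sub_eq_zero] at this
      rw [this, hφ]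
    · intro k hk1 hk2
      match k, hk1, hk2 with
      | 0, _, _ => rfl
      | k + 3, _, _ => rfl

theorem pairing_comp {b : V →ₗ[ℂ] V →ₗ[ℂ] V} {b' : V' →ₗ[ℂ] V' →ₗ[ℂ] V'} {f : V →ₗ[ℂ] V'}
    (hb : ∀ x y, f (b x y) = b' (f x) (f y)) (φ : TA V →ₗ[ℂ] V) (u : TA V ⊗[ℂ] TA V) :
    pairing b' (f.comp φ) u = f (pairing b φ u) := by
  induction u using TensorProduct.induction_on with
  | zero => simp
  | add u v hu hv => simp only [map_add, hu, hv]
  | tmul s r => simp [hb]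

/-- A morphism of DG Lie algebras is an `L∞`-morphism without higher components. -/
theorem isLInfMorphism_strictOps {G' : SuperGrading V'} {d' : V' →ₗ[ℂ] V'}
    {br' : V' →ₗ[ℂ] V' →ₗ[ℂ] V'} (h : DGLie G d br) {f : V →ₗ[ℂ] V'}
    (hop : ∀ x, f (G.op x) = G'.op (f x)) (hd : ∀ x, f (d x) = d' (f x))
    (hbr : ∀ x y, f (br x y) = br' (f x) (f y)) :
    IsLInfMorphism G G' (dgLieOps G d br) (dgLieOps G' d' br') (strictOps f) := by
  refine isLInfMorphism_of_represents h (represents_strictOps f) (by simp)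
    (fun t ht => by rw [LinearMap.comp_apply, pr₁_comIdeal _ ht, map_zero])
    (fun t => ?_) (fun t => ?_)
  · simp [pr₁_par, val_one_zmod2, SuperGrading.shift_op, hop]
  · rw [LinearMap.comp_apply, h.oddLie.pr₁_codiff_eq, pairing_comp (b := susp G br), map_add, hd,
      map_smul]
    · rfl
    · intro x y
      simp [SuperGrading.shift_op, hbr, hop]

/-- A chain map that is injective and surjective on cohomology induces an isomorphism. -/
theorem cohomology_equiv {d : V →ₗ[ℂ] V} {d' : V' →ₗ[ℂ] V'} (f : V →ₗ[ℂ] V')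
    (hf : ∀ x, f (d x) = d' (f x))
    (inj : ∀ z y', d z = 0 → f z = d' y' → ∃ y, z = d y)
    (surj : ∀ z', d' z' = 0 → ∃ z y', d z = 0 ∧ z' = f z + d' y') :
    ∃ e : Cohomology d ≃ₗ[ℂ] Cohomology d',
      ∀ (z : LinearMap.ker d) (z' : LinearMap.ker d'), f z = z' →
        e (Submodule.Quotient.mk z) = Submodule.Quotient.mk z' := by
  set g : LinearMap.ker d →ₗ[ℂ] LinearMap.ker d' := f.restrict fun x hx => by
    rw [LinearMap.mem_ker] at hx ⊢
    rw [← hf, hx, map_zero] with hg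
  have hle : (LinearMap.range d).submoduleOf (LinearMap.ker d)
      ≤ ((LinearMap.range d').submoduleOf (LinearMap.ker d')).comap g := by
    rintro ⟨z, hz⟩ ⟨y, hy⟩
    exact ⟨f y, by rw [← hf, hy]; rfl⟩
  set k := Submodule.mapQ _ _ g hle with hk
  have hinj : Function.Injective k := by
    rw [← LinearMap.ker_eq_bot, Submodule.eq_bot_iff]
    intro u hu
    obtain ⟨z, rfl⟩ := Submodule.Quotient.mk_surjective _ u
    rw [LinearMap.mem_ker, hk, Submodule.mapQ_apply, Submodule.Quotient.mk_eq_zero] at hu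
    obtain ⟨y', hy'⟩ := hu
    obtain ⟨y, hy⟩ := inj z y' z.2 hy'.symm
    exact (Submodule.Quotient.mk_eq_zero _).2 ⟨y, hy.symm⟩
  have hsurj : Function.Surjective k := by
    intro u
    obtain ⟨z', rfl⟩ := Submodule.Quotient.mk_surjective _ u
    obtain ⟨z, y', hz, h⟩ := surj z' z'.2
    refine ⟨Submodule.Quotient.mk ⟨z, hz⟩, ?_⟩
    rw [hk, Submodule.mapQ_apply, Submodule.Quotient.eq]
    refine ⟨-y', ?_⟩
    rw [map_neg]
    change -d' y' = f z - z'
    rw [h]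
    abel
  refine ⟨LinearEquiv.ofBijective k ⟨hinj, hsurj⟩, fun z z' h => ?_⟩
  have : g z = z' := Subtype.ext h
  rw [← this]
  rfl

end DGLie

end MoritaLInf

end

noncomputable section

namespace MoritaLInf

open TensorAlgebra

/-! ## Contractions -/

section Contraction

variable {L H : Type*} [AddCommGroup L] [Module ℂ L] [AddCommGroup H] [Module ℂ H]

/-- A contraction of `H` to `L`: an inclusion `f` of complexes with an even retraction `p` and an
odd homotopy `s` from `f p` to the identity. -/
structure Contraction (G₁ : SuperGrading L) (G₂ : SuperGrading H) (dL : L →ₗ[ℂ] L) (dH : H →ₗ[ℂ] H)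
    (f : L →ₗ[ℂ] H) (p : H →ₗ[ℂ] L) (s : H →ₗ[ℂ] H) : Prop where
  op_f : ∀ x, f (G₁.op x) = G₂.op (f x)
  d_f : ∀ x, f (dL x) = dH (f x)
  p_f : ∀ x, p (f x) = x
  d_p : ∀ x, p (dH x) = dL (p x)
  op_p : ∀ x, p (G₂.op x) = G₁.op (p x)
  op_s : ∀ x, s (G₂.op x) = -G₂.op (s x)
  s_f : ∀ x, s (f x) = 0
  homotopy : ∀ x, dH (s x) + s (dH x) = x - f (p x)

/-- A linear section over the range of `D` exists and extends to the whole vector space. -/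
theorem exists_pseudoinverse (D : H →ₗ[ℂ] H) : ∃ s : H →ₗ[ℂ] H, ∀ x, D (s (D x)) = D x := by
  obtain ⟨g, hg⟩ := D.rangeRestrict.exists_rightInverse_of_surjective D.range_rangeRestrict
  obtain ⟨s, hs⟩ := LinearMap.exists_extend g
  refine ⟨s, fun x => ?_⟩
  have h1 : s (D x) = g (D.rangeRestrict x) := DFunLike.congr_fun hs (D.rangeRestrict x)
  have h2 := congrArg Subtype.val (DFunLike.congr_fun hg (D.rangeRestrict x))
  rw [h1]
  exact h2

/-- An injective map of complexes with acyclic cokernel is part of a contraction. -/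
theorem exists_contraction {G₁ : SuperGrading L} {G₂ : SuperGrading H} {dL : L →ₗ[ℂ] L}
    {dH : H →ₗ[ℂ] H} {f : L →ₗ[ℂ] H} (hinj : Function.Injective f)
    (hop : ∀ x, f (G₁.op x) = G₂.op (f x)) (hd : ∀ x, f (dL x) = dH (f x))
    (hodd : ∀ x, G₂.op (dH x) = -dH (G₂.op x)) (hdd : ∀ x, dH (dH x) = 0)
    (hac : ∀ x, dH x ∈ LinearMap.range f → ∃ y, x - dH y ∈ LinearMap.range f) :
    ∃ p s, Contraction G₁ G₂ dL dH f p s := by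
  obtain ⟨r₀, hr₀⟩ := f.exists_leftInverse_of_injective (LinearMap.ker_eq_bot.2 hinj)
  have hr₀' : ∀ x, r₀ (f x) = x := fun x => DFunLike.congr_fun hr₀ x
  obtain ⟨r, hrf, hrop⟩ : ∃ r : H →ₗ[ℂ] L, (∀ x, r (f x) = x) ∧ ∀ x, r (G₂.op x) = G₁.op (r x) := by
    -- Averaging over the parity operators makes the retraction even and keeps it a left inverse of
    -- `f`.
    refine ⟨(2⁻¹ : ℂ) • (r₀ + G₁.op.comp (r₀.comp G₂.op)), fun x => ?_, fun x => ?_⟩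
    · simp only [LinearMap.smul_apply, LinearMap.add_apply, LinearMap.comp_apply, hr₀', ← hop,
        G₁.op_op]
      module
    · simp only [LinearMap.smul_apply, LinearMap.add_apply, LinearMap.comp_apply, map_smul, map_add,
        G₁.op_op, G₂.op_op]
      rw [add_comm]
  set e : H →ₗ[ℂ] H := LinearMap.id - f.comp r with he
  have eap : ∀ x, e x = x - f (r x) := fun x => rfl
  have hef : ∀ x, e (f x) = 0 := fun x => by rw [eap, hrf, sub_self]
  have hee : ∀ x, e (e x) = e x := fun x => by rw [eap x, map_sub, hef, sub_zero, eap]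
  have hre : ∀ x, r (e x) = 0 := fun x => by rw [eap, map_sub, hrf, sub_self]
  have heop : ∀ x, e (G₂.op x) = G₂.op (e x) := fun x => by rw [eap, hrop, hop, eap, map_sub]
  -- On the complement `e H` of the image of `f`, the operator `D` is the differential of the
  -- cokernel; it is exact there by `hac`.
  set D : H →ₗ[ℂ] H := e.comp dH with hDdef
  have Dap : ∀ x, D x = e (dH x) := fun x => rfl
  have hDf : ∀ x, D (f x) = 0 := fun x => by rw [Dap, ← hd, hef]
  have hDe : ∀ x, D (e x) = D x := fun x => by rw [eap, map_sub, hDf, sub_zero]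
  have heD : ∀ x, e (D x) = D x := fun x => by rw [Dap, hee]
  have hDD : ∀ x, D (D x) = 0 := fun x => by
    rw [Dap x, hDe, Dap, hdd, map_zero]
  have hDop : ∀ x, D (G₂.op x) = -G₂.op (D x) := fun x => by
    rw [Dap, Dap, ← heop, hodd, map_neg, neg_neg]
  have hDac : ∀ x, D x = 0 → ∃ y, e x = D y := by
    intro x hx
    obtain ⟨y, z, hz⟩ := hac x ⟨r (dH x), by
      rw [Dap, eap, sub_eq_zero] at hx
      exact hx.symm⟩
    refine ⟨y, ?_⟩
    have := congrArg e hz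
    rw [hef, map_sub] at this
    exact (sub_eq_zero.1 this.symm)
  obtain ⟨s₀, hs₀⟩ := exists_pseudoinverse D
  obtain ⟨s₁, hs₁, hs₁e, hes₁, hs₁op⟩ : ∃ s₁ : H →ₗ[ℂ] H, (∀ x, D (s₁ (D x)) = D x) ∧
      (∀ x, s₁ (e x) = s₁ x) ∧ (∀ x, e (s₁ x) = s₁ x) ∧ ∀ x, s₁ (G₂.op x) = -G₂.op (s₁ x) := by
    -- The pseudoinverse is replaced by its odd part and compressed to the complement on both sides.
    refine ⟨e.comp (((2⁻¹ : ℂ) • (s₀ - G₂.op.comp (s₀.comp G₂.op))).comp e), fun x => ?_,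
      fun x => ?_, fun x => ?_, fun x => ?_⟩
    · simp only [LinearMap.comp_apply, LinearMap.smul_apply, LinearMap.sub_apply, hDe, heD,
        map_smul, map_sub, hDop]
      have : G₂.op (D x) = -D (G₂.op x) := by rw [hDop, neg_neg]
      rw [this, map_neg, map_neg, hs₀, hs₀, hDop]
      simp only [neg_neg, G₂.op_op]
      module
    · simp only [LinearMap.comp_apply, hee]
    · simp only [LinearMap.comp_apply, hee]
    · simp only [LinearMap.comp_apply, LinearMap.smul_apply, LinearMap.sub_apply, heop,
        map_smul, map_sub, G₂.op_op]
      module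
  -- The correction applies `s₁` to `e x - s₁ (D x)`, which is a cycle and hence a boundary by
  -- exactness; this turns the pseudoinverse into a contracting homotopy of the complement.
  set s : H →ₗ[ℂ] H := s₁ - s₁.comp (s₁.comp D) with hs
  have sap : ∀ x, s x = s₁ x - s₁ (s₁ (D x)) := fun x => rfl
  have hDs : ∀ x, D (s x) + s (D x) = e x := by
    intro x
    have h1 : D (e x - s₁ (D x)) = 0 := by rw [map_sub, hDe, hs₁, sub_self]
    obtain ⟨y, hy⟩ := hDac _ h1
    rw [map_sub, hee, hes₁] at hy
    have h2 : s x = s₁ (e x - s₁ (D x)) := by rw [sap, map_sub, hs₁e]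
    rw [h2, hy, hs₁, ← hy, sap, hDD, map_zero, map_zero, sub_zero, sub_add_cancel]
  have hsf : ∀ x, s (f x) = 0 := fun x => by
    rw [sap, hDf, map_zero, map_zero, sub_zero, ← hs₁e, hef, map_zero]
  have hrs : ∀ x, r (s x) = 0 := fun x => by
    rw [sap, map_sub, ← hes₁, hre, ← hes₁, hre, sub_zero]
  have hsop : ∀ x, s (G₂.op x) = -G₂.op (s x) := fun x => by
    rw [sap, hs₁op, hDop, map_neg, hs₁op, neg_neg, hs₁op, sap, map_sub]
    abel
  have hse : ∀ x, s (dH x) = s (D x) := fun x => by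
    rw [Dap, eap, map_sub, hsf, sub_zero]
  -- The retraction `r` is not a chain map. The subtracted term is the component of `dH ∘ s` along
  -- the image of `f`, which the homotopy identity for `D` leaves out.
  refine ⟨r - r.comp (dH.comp s), s, hop, hd, fun x => ?_, fun x => ?_, fun x => ?_, hsop, hsf,
    fun x => ?_⟩
  · simp only [LinearMap.sub_apply, LinearMap.comp_apply, hsf, map_zero, sub_zero, hrf]
  · simp only [LinearMap.sub_apply, LinearMap.comp_apply]
    have h1 : s (dH x) = e x - D (s x) := by rw [hse, ← hDs, add_sub_cancel_left]
    rw [h1, eap, Dap, eap]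
    simp only [map_sub, hdd, ← hd, hrf, map_zero]
    abel
  · simp only [LinearMap.sub_apply, LinearMap.comp_apply, hrop, hsop, map_neg, map_sub]
    rw [← hrop (dH _), hodd, map_neg]
  · have h1 := hDs x
    rw [Dap, eap, eap, ← hse] at h1
    simp only [LinearMap.sub_apply, LinearMap.comp_apply, map_sub]
    rw [← sub_eq_zero] at h1 ⊢
    rw [← h1]
    abel

variable {G₁ : SuperGrading L} {G₂ : SuperGrading H} {dL : L →ₗ[ℂ] L} {dH : H →ₗ[ℂ] H}
  {f : L →ₗ[ℂ] H} {p : H →ₗ[ℂ] L} {s : H →ₗ[ℂ] H}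

theorem Contraction.shift (h : Contraction G₁ G₂ dL dH f p s) :
    Contraction G₁.shift G₂.shift dL dH f p s where
  op_f x := by simp [SuperGrading.shift_op, h.op_f]
  d_f := h.d_f
  p_f := h.p_f
  d_p := h.d_p
  op_p x := by simp [SuperGrading.shift_op, h.op_p]
  op_s x := by simp [SuperGrading.shift_op, h.op_s]
  s_f := h.s_f
  homotopy := h.homotopy

theorem Contraction.cohomology_f (h : Contraction G₁ G₂ dL dH f p s) :
    ∃ e : Cohomology dL ≃ₗ[ℂ] Cohomology dH,
      ∀ (z : LinearMap.ker dL) (z' : LinearMap.ker dH), f z = z' →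
        e (Submodule.Quotient.mk z) = Submodule.Quotient.mk z' := by
  refine cohomology_equiv f h.d_f (fun z y' _ hz => ⟨p y', ?_⟩) fun z' hz' => ⟨p z', s z', ?_, ?_⟩
  · rw [← h.d_p, ← hz, h.p_f]
  · rw [← h.d_p, hz', map_zero]
  · have := h.homotopy z'
    rw [hz', map_zero, add_zero] at this
    rw [this]
    abel

theorem Contraction.cohomology_p (h : Contraction G₁ G₂ dL dH f p s) :
    ∃ e : Cohomology dH ≃ₗ[ℂ] Cohomology dL,
      ∀ (z : LinearMap.ker dH) (z' : LinearMap.ker dL), p z = z' →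
        e (Submodule.Quotient.mk z) = Submodule.Quotient.mk z' := by
  -- For a cycle `z` the homotopy gives `z = d (s z) + f (p z)`, and `p z = d y'` makes the last
  -- term the boundary of `f y'`.
  refine cohomology_equiv p h.d_p (fun z y' hz hz' => ⟨f y' + s z, ?_⟩)
    fun z' hz' => ⟨f z', 0, ?_, ?_⟩
  · have := h.homotopy z
    rw [hz, map_zero, add_zero, hz', h.d_f] at this
    rw [map_add, this]
    abel
  · rw [← h.d_f, hz', map_zero]
  · rw [h.p_f, map_zero, add_zero]

end Contraction

end MoritaLInf

end

noncomputable section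

namespace MoritaLInf

open TensorAlgebra

/-! ## The number of letters in the image of a projection -/

section Weight

variable {V : Type*} [AddCommGroup V] [Module ℂ V] (π : V →ₗ[ℂ] V)

/-- For an idempotent `π`, the `k`-th component is the inverse of `N + k`, where `N` counts the
letters in the image of `π`, with `0⁻¹ = 0`. -/
def weightInv : TA V →ₗ[ℂ] (ℕ → TA V) :=
  recL (fun k => (k : ℂ)⁻¹ • 1) 0
    (LinearMap.mk₂ ℂ (fun x u k => lt (x - π x) * u k + lt (π x) * u (k + 1))
      (fun x y u => funext fun k => by simp [add_mul, sub_mul]; abel)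
      (fun c x u => funext fun k => by simp [sub_mul, smul_sub])
      (fun x u v => funext fun k => by simp [mul_add]; abel)
      (fun c x u => funext fun k => by simp))

theorem weightInv_one (k : ℕ) : weightInv π 1 k = (k : ℂ)⁻¹ • 1 := by
  rw [weightInv, recL_one]

theorem weightInv_mul (x : V) (t : TA V) (k : ℕ) :
    weightInv π (lt x * t) k
      = lt (x - π x) * weightInv π t k + lt (π x) * weightInv π t (k + 1) := by
  rw [weightInv, recL_mul]; simp

theorem weightInv_induction {C : TA V → (ℕ → TA V) → Prop}
    (one : C 1 (fun k => (k : ℂ)⁻¹ • 1)) (add : ∀ s t u v, C s u → C t v → C (s + t) (u + v))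
    (smul : ∀ (c : ℂ) t u, C t u → C (c • t) (c • u))
    (mul : ∀ x t u, C t u →
      C (lt x * t) fun k => lt (x - π x) * u k + lt (π x) * u (k + 1)) (t : TA V) :
    C t (weightInv π t) := by
  refine ta_induction (C := fun t => C t (weightInv π t)) ?_ ?_ ?_ ?_ t
  · convert one with k
    rw [weightInv_one]
  · intro s t hs ht; rw [map_add]; exact add _ _ _ _ hs ht
  · intro c t ht; rw [map_smul]; exact smul _ _ _ ht
  · intro x t ht
    convert mul x t _ ht with k
    rw [weightInv_mul]

variable {π}

theorem tmap_one_sub_mul (x : V) (t : TA V) :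
    tmap (LinearMap.id - π) (lt x * t) = lt (x - π x) * tmap (LinearMap.id - π) t := by
  rw [tmap_mul]; rfl

/-- The derivation extending `π` multiplies a word in letters of the kernel and the image of `π` by
the number `N` of the latter. For `k > 0` the operator `N + k` is invertible; for `k = 0` its kernel
consists of the words without such letters, and the convention `0⁻¹ = 0` leaves the projection to
them as the defect. -/
theorem der_weightInv (hπ : ∀ x, π (π x) = π x) (t : TA V) (k : ℕ) :
    der LinearMap.id π (weightInv π t k) + (k : ℂ) • weightInv π t k
      = t - if k = 0 then tmap (LinearMap.id - π) t else 0 := by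
  refine weightInv_induction π (C := fun t u => ∀ k, der LinearMap.id π (u k) + (k : ℂ) • u k
      = t - if k = 0 then tmap (LinearMap.id - π) t else 0) ?_ ?_ ?_ ?_ t k
  · intro k
    rcases eq_or_ne k 0 with rfl | hk
    · simp
    · have : (k : ℂ) ≠ 0 := by exact_mod_cast hk
      simp [hk, this, smul_smul]
  · intro s t u v hu hv k
    have := congrArg₂ (· + ·) (hu k) (hv k)
    simp only [Pi.add_apply, map_add, smul_add] at this ⊢
    split_ifs at this ⊢ <;> linear_combination (norm := module) this
  · intro c t u hu k
    have := congrArg (c • ·) (hu k)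
    simp only [Pi.smul_apply, map_smul, smul_add, smul_sub] at this ⊢
    rw [smul_comm c] at this
    rw [this]
    split_ifs <;> simp
  · intro x t u hu k
    have h1 := congrArg (lt (x - π x) * ·) (hu k)
    have h2 := congrArg (lt (π x) * ·) (hu (k + 1))
    simp only [mul_add, mul_sub, mul_smul_comm, Nat.succ_ne_zero, if_false, sub_zero,
      add_smul, Nat.cast_add, Nat.cast_one, one_smul] at h1 h2
    have h3 : π (x - π x) = 0 := by rw [map_sub, hπ, sub_self]
    simp only [map_add, der_mul, h3, hπ, LinearMap.id_apply, map_zero, zero_mul, smul_add,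
      zero_add, tmap_one_sub_mul]
    have h4 : lt x * t = lt (x - π x) * t + lt (π x) * t := by rw [← add_mul, ← map_add, sub_add_cancel]
    rw [h4]
    split_ifs at h1 ⊢ <;> try simp only [mul_zero] at h1
    all_goals linear_combination (norm := module) h1 + h2

theorem weightInv_der (hπ : ∀ x, π (π x) = π x) (t : TA V) (k : ℕ) :
    weightInv π (der LinearMap.id π t) k + (k : ℂ) • weightInv π t k
      = t - if k = 0 then tmap (LinearMap.id - π) t else 0 := by
  refine ta_induction (C := fun t => ∀ k, weightInv π (der LinearMap.id π t) k
      + (k : ℂ) • weightInv π t k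
      = t - if k = 0 then tmap (LinearMap.id - π) t else 0) ?_ ?_ ?_ ?_ t k
  · intro k
    rw [weightInv_one]
    rcases eq_or_ne k 0 with rfl | hk
    · simp
    · have : (k : ℂ) ≠ 0 := by exact_mod_cast hk
      simp [hk, this, smul_smul]
  · intro s t hu hv k
    have := congrArg₂ (· + ·) (hu k) (hv k)
    simp only [Pi.add_apply, map_add, smul_add] at this ⊢
    split_ifs at this ⊢ <;> linear_combination (norm := module) this
  · intro c t hu k
    have := congrArg (c • ·) (hu k)
    simp only [Pi.smul_apply, map_smul, smul_add, smul_sub] at this ⊢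
    rw [smul_comm c] at this
    rw [this]
    split_ifs <;> simp
  · intro x t hu k
    have h1 := congrArg (lt (x - π x) * ·) (hu k)
    have h2 := congrArg (lt (π x) * ·) (hu (k + 1))
    simp only [mul_add, mul_sub, mul_smul_comm, Nat.succ_ne_zero, if_false, sub_zero,
      add_smul, Nat.cast_add, Nat.cast_one, one_smul] at h1 h2
    simp only [der_mul, map_add, Pi.add_apply, weightInv_mul, hπ, LinearMap.id_apply, sub_self,
      map_zero, zero_mul, smul_add, zero_add, tmap_one_sub_mul]
    have h4 : lt x * t = lt (x - π x) * t + lt (π x) * t := by rw [← add_mul, ← map_add, sub_add_cancel]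
    rw [h4]
    split_ifs at h1 ⊢ <;> try simp only [mul_zero] at h1
    all_goals linear_combination (norm := module) h1 + h2

variable {G : SuperGrading V}

theorem par_weightInv (hop : ∀ x, π (G.op x) = G.op (π x)) (q : ZMod 2) (t : TA V) (k : ℕ) :
    par G q (weightInv π t k) = weightInv π (par G q t) k := by
  have hop' : ∀ x, π ((G.op ^ q.val) x) = (G.op ^ q.val) (π x) := by
    rcases zmod2_cases q with rfl | rfl
    · intro x; simp
    · intro x; rw [val_one_zmod2, pow_one, hop]
  refine ta_induction (C := fun t => ∀ k, par G q (weightInv π t k) = weightInv π (par G q t) k)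
    ?_ ?_ ?_ ?_ t k
  · intro k; simp [weightInv_one]
  · intro s t hs ht k; simp only [map_add, Pi.add_apply, hs, ht]
  · intro c t ht k; simp only [map_smul, Pi.smul_apply, ht]
  · intro x t ht k
    rw [tmap_mul, weightInv_mul, weightInv_mul, map_add, tmap_mul, tmap_mul, ht, ht, map_sub, hop']

/-- Splitting both letters of a commutator by `π` gives four commutators, followed by components
with index raised by the number of letters taken in the image of `π`. -/
theorem weightInv_mem (hop : ∀ x, π (G.op x) = G.op (π x)) {t : TA V} (ht : t ∈ comIdeal G)
    (k : ℕ) : weightInv π t k ∈ comIdeal G := by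
  have hπm : ∀ {p : ZMod 2} {x : V}, x ∈ G.part p → π x ∈ G.part p := by
    intro p x hx
    rw [SuperGrading.mem_part, ← hop, G.op_of_mem hx, map_smul]
  have hm : ∀ {p : ZMod 2} {x : V}, x ∈ G.part p → x - π x ∈ G.part p := fun hx =>
    sub_mem hx (hπm hx)
  have := map_mem_of_comIdeal (weightInv π) (Submodule.pi Set.univ fun _ : ℕ => comIdeal G) ?_ ?_ ht
  · exact this k trivial
  · intro p q x y hx hy r k _
    have h1 := comRel_mul_mem (hm hx) (hm hy) (weightInv π r k)
    have h2 := comRel_mul_mem (hm hx) (hπm hy) (weightInv π r (k + 1))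
    have h3 := comRel_mul_mem (hπm hx) (hm hy) (weightInv π r (k + 1))
    have h4 := comRel_mul_mem (hπm hx) (hπm hy) (weightInv π r (k + 2))
    change _ ∈ comIdeal G
    convert add_mem (add_mem h1 h2) (add_mem h3 h4) using 1
    simp only [comRel, sub_mul, smul_mul_assoc, mul_assoc]
    simp only [map_sub (weightInv π), map_smul, Pi.sub_apply, Pi.smul_apply, weightInv_mul, mul_add,
      smul_add, add_assoc, Nat.reduceAdd]
    abel
  · intro p x hx t ht h k _
    rw [weightInv_mul]
    exact add_mem (mul_mem_comIdeal _ (h k trivial)) (mul_mem_comIdeal _ (h (k + 1) trivial))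

/-! ### Word length -/

/-- The span of the words of length `n`. -/
def wordSpan (V : Type*) [AddCommGroup V] [Module ℂ V] (n : ℕ) : Submodule ℂ (TA V) :=
  Submodule.span ℂ {t | ∃ l : List V, l.length = n ∧ word l = t}

/-- The span of the words of length `n - 1`, which vanishes if `n = 0`. -/
def predSpan (V : Type*) [AddCommGroup V] [Module ℂ V] : ℕ → Submodule ℂ (TA V)
  | 0 => ⊥
  | n + 1 => wordSpan V n

theorem word_mem (l : List V) : word l ∈ wordSpan V l.length :=
  Submodule.subset_span ⟨l, rfl, rfl⟩

theorem lt_mul_mem (x : V) {n : ℕ} {t : TA V} (ht : t ∈ wordSpan V n) :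
    lt x * t ∈ wordSpan V (n + 1) := by
  refine Submodule.span_induction (p := fun t _ => lt x * t ∈ wordSpan V (n + 1)) ?_ (by simp)
    ?_ ?_ ht
  · rintro _ ⟨l, rfl, rfl⟩
    exact word_mem (x :: l)
  · intro s t _ _ hs ht; rw [mul_add]; exact add_mem hs ht
  · intro c t _ ht; rw [mul_smul_comm]; exact Submodule.smul_mem _ _ ht

/-- A criterion for a family of linear maps to change the length of words in a prescribed way. -/
theorem wordSpan_induction {M : Type*} [AddCommGroup M] [Module ℂ M] (D : TA V →ₗ[ℂ] M)
    (K : ℕ → Submodule ℂ M) (one : D 1 ∈ K 0)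
    (mul : ∀ x n, ∀ t ∈ wordSpan V n, D t ∈ K n → D (lt x * t) ∈ K (n + 1)) {n : ℕ} {t : TA V}
    (ht : t ∈ wordSpan V n) : D t ∈ K n := by
  have key : ∀ l : List V, D (word l) ∈ K l.length := by
    intro l
    induction l with
    | nil => simpa using one
    | cons x l ih => rw [word_cons]; exact mul x _ _ (word_mem l) ih
  refine Submodule.span_induction (p := fun t _ => D t ∈ K n) ?_ (by simp) ?_ ?_ ht
  · rintro _ ⟨l, rfl, rfl⟩
    exact key l
  · intro s t _ _ hs ht; rw [map_add]; exact add_mem hs ht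
  · intro c t _ ht; rw [map_smul]; exact Submodule.smul_mem _ _ ht

theorem der_mem_wordSpan (ρ A : V →ₗ[ℂ] V) {n : ℕ} {t : TA V} (ht : t ∈ wordSpan V n) :
    der ρ A t ∈ wordSpan V n := by
  refine wordSpan_induction (der ρ A) (wordSpan V) (by simp) (fun x n t ht h => ?_) ht
  rw [der_mul]
  exact add_mem (lt_mul_mem _ ht) (lt_mul_mem _ h)

theorem adB_mem_wordSpan (b : V →ₗ[ℂ] V →ₗ[ℂ] V) (x : V) {n : ℕ} {t : TA V}
    (ht : t ∈ wordSpan V n) : adB G b x t ∈ wordSpan V n := by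
  refine G.hom_induction (C := fun x => adB G b x t ∈ wordSpan V n) (fun x y hx hy => ?_)
    (fun p x hx => ?_) x
  · rw [map_add]; exact add_mem hx hy
  · rw [adB_of_mem G b hx]
    exact der_mem_wordSpan _ _ ht

theorem quad_mem_wordSpan (b : V →ₗ[ℂ] V →ₗ[ℂ] V) {n : ℕ} {t : TA V}
    (ht : t ∈ wordSpan V n) :
    quad G b t ∈ predSpan V n := by
  refine wordSpan_induction (quad G b) (predSpan V) (by simp) (fun x n t ht h => ?_) ht
  rw [quad_mul]
  refine add_mem (adB_mem_wordSpan b x ht) ?_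
  match n, h with
  | 0, h =>
    have h : quad G b t = 0 := h
    rw [h, mul_zero]
    exact zero_mem _
  | n + 1, h => exact lt_mul_mem _ h

theorem weightInv_mem_wordSpan {n : ℕ} {t : TA V} (ht : t ∈ wordSpan V n) (k : ℕ) :
    weightInv π t k ∈ wordSpan V n := by
  refine wordSpan_induction (weightInv π)
    (fun n => Submodule.pi Set.univ fun _ : ℕ => wordSpan V n) (fun k _ => ?_)
    (fun x n t ht h k _ => ?_) ht k trivial
  · rw [weightInv_one]
    exact Submodule.smul_mem _ _ (word_mem [])
  · rw [weightInv_mul]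
    exact add_mem (lt_mul_mem _ (h k trivial)) (lt_mul_mem _ (h (k + 1) trivial))

/-- A linear map on the tensor algebra that lowers the length of words is locally nilpotent. -/
theorem exists_pow_eq_zero {X : Module.End ℂ (TA V)} (zero : ∀ t ∈ wordSpan V 0, X t = 0)
    (succ : ∀ n, ∀ t ∈ wordSpan V (n + 1), X t ∈ wordSpan V n) (t : TA V) :
    ∃ k, (X ^ k) t = 0 := by
  have key : ∀ n, ∀ t ∈ wordSpan V n, (X ^ (n + 1)) t = 0 := by
    intro n
    induction n with
    | zero => intro t ht; simpa using zero t ht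
    | succ n ih => intro t ht; rw [pow_succ, Module.End.mul_apply]; exact ih _ (succ n t ht)
  refine word_induction (C := fun t => ∃ k, (X ^ k) t = 0) ?_ ?_ ?_ t
  · rintro s t ⟨k, hk⟩ ⟨l, hl⟩
    refine ⟨k + l, ?_⟩
    rw [map_add, pow_add, Module.End.mul_apply, Module.End.mul_apply, hl, map_zero, add_zero,
      ← Module.End.mul_apply, ← pow_add, add_comm, pow_add, Module.End.mul_apply, hk, map_zero]
  · rintro c t ⟨k, hk⟩
    exact ⟨k, by rw [map_smul, hk, smul_zero]⟩
  · exact fun l => ⟨_, key _ _ (word_mem l)⟩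

end Weight

/-! ### Inverting one plus a locally nilpotent operator. -/

section LocallyNilpotent

variable {V : Type*} [AddCommGroup V] [Module ℂ V] {X : Module.End ℂ V}

/-- On the kernel `X` acts as `-1`, and no power of that annihilates a nonzero vector. -/
theorem one_add_injective (hX : ∀ t, ∃ k, (X ^ k) t = 0) :
    Function.Injective (LinearMap.id + X : V →ₗ[ℂ] V) := by
  rw [← LinearMap.ker_eq_bot, Submodule.eq_bot_iff]
  intro t ht
  have h1 : X t = (-1 : ℂ) • t := by
    rw [LinearMap.mem_ker, LinearMap.add_apply, LinearMap.id_apply, add_comm] at ht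
    rw [neg_one_smul]
    exact eq_neg_of_add_eq_zero_left ht
  have h2 : ∀ k, (X ^ k) t = (-1 : ℂ) ^ k • t := by
    intro k
    induction k with
    | zero => simp
    | succ k ih => rw [pow_succ, Module.End.mul_apply, h1, map_smul, ih, smul_smul, pow_succ']
  obtain ⟨k, hk⟩ := hX t
  rw [h2] at hk
  exact (smul_eq_zero.1 hk).resolve_left (pow_ne_zero _ (by norm_num))

/-- The solution is the alternating geometric series in `X`, finite on each vector; it stays in
every subspace stable under `X`. This is used below for the ideal of commutators. -/
theorem one_add_surjOn (hX : ∀ t, ∃ k, (X ^ k) t = 0) (S : Submodule ℂ V)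
    (hS : ∀ t ∈ S, X t ∈ S) {t : V} (ht : t ∈ S) : ∃ u ∈ S, u + X u = t := by
  obtain ⟨k, hk⟩ := hX t
  induction k generalizing t with
  | zero => exact ⟨0, zero_mem _, by simpa using hk.symm⟩
  | succ k ih =>
    obtain ⟨u, hu, h⟩ := ih (hS t ht) (by rwa [pow_succ, Module.End.mul_apply] at hk)
    refine ⟨t - u, sub_mem ht hu, ?_⟩
    rw [map_sub, ← h]
    abel

end LocallyNilpotent

end MoritaLInf

end

noncomputable section

namespace MoritaLInf

open TensorAlgebra

open scoped TensorProduct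

/-! ## Transfer along a contraction to a DG Lie subalgebra -/

section Transfer

variable {V V' : Type*} [AddCommGroup V] [Module ℂ V] [AddCommGroup V'] [Module ℂ V']

theorem pr₁_tmap (f : V →ₗ[ℂ] V') (t : TA V) : pr₁ (tmap f t) = f (pr₁ t) := by
  have ha : ∀ t : TA V, (TensorAlgebra.algebraMapInv (tmap f t) : ℂ)
      = TensorAlgebra.algebraMapInv t := fun t => by
    have : (TensorAlgebra.algebraMapInv (R := ℂ)).comp (tmap f) = TensorAlgebra.algebraMapInv := by
      ext x
      simp [aug_lt]
    exact DFunLike.congr_fun this t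
  have : pr₁.comp (tmap f).toLinearMap = f.comp pr₁ :=
    ta_cases_ext (by simp) fun x t => by simp [pr₁_mul, tmap_mul, ha, -map_mul]
  exact DFunLike.congr_fun this t

theorem tmap_tmap {X : Type*} [AddCommGroup X] [Module ℂ X] (f : V →ₗ[ℂ] V') (p : X →ₗ[ℂ] V)
    (t : TA X) :
    tmap f (tmap p t) = tmap (f.comp p) t := by
  have : (tmap f).comp (tmap p) = tmap (f.comp p) := by
    ext x
    simp
  exact DFunLike.congr_fun this t

theorem der_tmap (f : V →ₗ[ℂ] V') {ρ A : V →ₗ[ℂ] V} {ρ' A' : V' →ₗ[ℂ] V'}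
    (hρ : ∀ x, f (ρ x) = ρ' (f x)) (hA : ∀ x, f (A x) = A' (f x)) (t : TA V) :
    der ρ' A' (tmap f t) = tmap f (der ρ A t) := by
  have : (der ρ' A').comp (tmap f).toLinearMap = (tmap f).toLinearMap.comp (der ρ A) :=
    ta_ext (by simp) fun x t ht => by
      simp only [LinearMap.comp_apply, AlgHom.toLinearMap_apply] at ht ⊢
      rw [tmap_mul, der_mul, der_mul, map_add, tmap_mul, tmap_mul, ht, hρ, hA]
  exact DFunLike.congr_fun this t

theorem par_one_par_one (G : SuperGrading V) (t : TA V) : par G 1 (par G 1 t) = t := by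
  have : ((par G 1).comp (par G 1)) = AlgHom.id ℂ (TA V) := by
    ext x
    simp [val_one_zmod2, G.op_op]
  exact DFunLike.congr_fun this t

variable {G : SuperGrading V} {G' : SuperGrading V'} {b : V →ₗ[ℂ] V →ₗ[ℂ] V}
  {b' : V' →ₗ[ℂ] V' →ₗ[ℂ] V'} {d : V →ₗ[ℂ] V} {d' : V' →ₗ[ℂ] V'}

theorem op_pow_map {f : V →ₗ[ℂ] V'} (hop : ∀ x, f (G.op x) = G'.op (f x)) (q : ZMod 2) (x : V) :
    f ((G.op ^ q.val) x) = (G'.op ^ q.val) (f x) := by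
  rcases zmod2_cases q with rfl | rfl
  · simp
  · rw [val_one_zmod2, pow_one, pow_one, hop]

theorem codiff_tmap {f : V →ₗ[ℂ] V'} (hop : ∀ x, f (G.op x) = G'.op (f x))
    (hd : ∀ x, f (d x) = d' (f x)) (hb : ∀ x y, f (b x y) = b' (f x) (f y)) (t : TA V) :
    codiff G' b' d' (tmap f t) = tmap f (codiff G b d t) := by
  have hq : (quad G' b').comp (tmap f).toLinearMap = (tmap f).toLinearMap.comp (quad G b) := by
    refine ta_hom_ext G (by simp) fun p x hx t ht => ?_
    have hx' : f x ∈ G'.part p := by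
      rw [SuperGrading.mem_part, ← hop, G.op_of_mem hx, map_smul]
    simp only [LinearMap.comp_apply, AlgHom.toLinearMap_apply] at ht ⊢
    rw [tmap_mul, quad_mul_of_mem G b hx, quad_mul_of_mem G' b' hx', ht, map_add, map_smul,
      tmap_mul, adB_of_mem G b hx, adB_of_mem G' b' hx']
    congr 1
    exact der_tmap f (op_pow_map hop _) (hb x) t
  rw [codiff, codiff, LinearMap.add_apply, LinearMap.add_apply, map_add]
  exact congrArg₂ _ (der_tmap f (op_pow_map hop _) hd t) (DFunLike.congr_fun hq t)

theorem weightInv_tmap {π : V' →ₗ[ℂ] V'} {f : V →ₗ[ℂ] V'} (hf : ∀ x, π (f x) = 0) (t : TA V)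
    (k : ℕ) : weightInv π (tmap f t) k = (k : ℂ)⁻¹ • tmap f t := by
  refine ta_induction (C := fun t => weightInv π (tmap f t) k = (k : ℂ)⁻¹ • tmap f t) ?_ ?_ ?_ ?_ t
  · simp [weightInv_one]
  · intro s t hs ht; simp only [map_add, Pi.add_apply, hs, ht, smul_add]
  · intro c t ht; simp only [map_smul, Pi.smul_apply, ht]; rw [smul_comm]
  · intro x t ht
    rw [tmap_mul, weightInv_mul, hf, sub_zero, map_zero, zero_mul, add_zero, ht, mul_smul_comm]

/-- A strict inclusion of odd Lie algebras that is part of a contraction has a left inverse up to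
homotopy, as a morphism with higher components. -/
theorem OddLie.exists_morphism (h : OddLie G b d) (h' : OddLie G' b' d') {f : V →ₗ[ℂ] V'}
    {p : V' →ₗ[ℂ] V} {s : V' →ₗ[ℂ] V'} (c : Contraction G G' d d' f p s)
    (hb : ∀ x y, f (b x y) = b' (f x) (f y)) :
    ∃ φ : TA V' →ₗ[ℂ] V, φ 1 = 0 ∧ (∀ v, φ (lt v) = p v) ∧ (∀ t ∈ comIdeal G', φ t = 0) ∧
      (∀ t, φ (par G' 1 t) = G.op (φ t)) ∧
      ∀ t, φ (codiff G' b' d' t) = d (φ t) + (2⁻¹ : ℂ) • pairing b φ (cop G' t) := by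
  -- `π` projects to the kernel of `p` along the image of `f`; by the homotopy identity it is the
  -- commutator of `d'` and `s`.
  set π : V' →ₗ[ℂ] V' := LinearMap.id - f.comp p with hπdef
  have πap : ∀ x, π x = x - f (p x) := fun x => rfl
  have hπf : ∀ x, π (f x) = 0 := fun x => by rw [πap, c.p_f, sub_self]
  have hpπ : ∀ x, p (π x) = 0 := fun x => by rw [πap, map_sub, c.p_f, sub_self]
  have hππ : ∀ x, π (π x) = π x := fun x => by rw [πap (π x), hpπ, map_zero, sub_zero]
  have hπop : ∀ x, π (G'.op x) = G'.op (π x) := fun x => by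
    rw [πap, πap, map_sub, c.op_p, c.op_f]
  have hid : LinearMap.id - π = f.comp p := by rw [hπdef]; abel
  have hs : HasParity G' 1 s := fun x => by simp [c.op_s]
  set N : TA V' →ₗ[ℂ] TA V' := der LinearMap.id π with hN
  set η : TA V' →ₗ[ℂ] TA V' := derP G' 1 s with hη
  set Q : TA V' →ₗ[ℂ] TA V' := codiff G' b' d' with hQ
  set q : TA V' →ₗ[ℂ] TA V' := quad G' b' with hq
  set R : TA V' →ₗ[ℂ] TA V' := q.comp η + η.comp q with hR
  set Θ : TA V' →ₗ[ℂ] TA V' := (LinearMap.proj 0).comp (weightInv π) with hΘ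
  have Rap : ∀ t, R t = q (η t) + η (q t) := fun t => rfl
  have Θap : ∀ t, Θ t = weightInv π t 0 := fun t => rfl
  -- The linear part of `Q` contributes the derivation extending `π`, the brackets contribute `R`,
  -- which shortens words by one.
  have hQη : ∀ t, Q (η t) + η (Q t) = N t + R t := by
    intro t
    have h1 := derP_comm h'.parity_d hs t
    have h2 : d'.comp s - sgn (1 * 1) • s.comp d' = π := by
      ext x
      have := c.homotopy x
      rw [mul_one, sgn_one, neg_one_smul, sub_neg_eq_add, πap, ← this]
      rfl
    rw [h2] at h1
    have h3 : derP G' (1 + 1) π = N := rfl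
    rw [h3, mul_one, sgn_one] at h1
    have h4 : ∀ u, Q u = derP G' 1 d' u + q u := fun u => rfl
    rw [h4, h4, map_add, h1, Rap]
    module
  have hNΘ : ∀ t, N (Θ t) = t - tmap f (tmap p t) := by
    intro t
    have := der_weightInv hππ t 0
    rw [hid, Nat.cast_zero, zero_smul, add_zero, if_pos rfl] at this
    rw [Θap, this, tmap_tmap]
  have hΘN : ∀ t, Θ (N t) = t - tmap f (tmap p t) := by
    intro t
    have := weightInv_der hππ t 0
    rw [hid, Nat.cast_zero, zero_smul, add_zero, if_pos rfl] at this
    rw [Θap, this, tmap_tmap]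
  have hηf : ∀ u, η (tmap f u) = 0 := by
    intro u
    have h1 := der_tmap f (A := 0) (A' := s) (op_pow_map c.op_f 1) (fun x => by simp [c.s_f]) u
    rw [hη, h1]
    exact (congrArg (fun D => tmap f (D u)) (derP_zero G 1)).trans (map_zero _)
  have hQf : ∀ u, Q (tmap f u) = tmap f (codiff G b d u) := codiff_tmap c.op_f c.d_f hb
  have hNf : ∀ u, N (tmap f u) = 0 := by
    intro u
    have h1 := der_tmap f (ρ := LinearMap.id) (A := 0) (A' := π) (ρ' := LinearMap.id)
      (fun x => rfl) (fun x => by simp [hπf]) u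
    rw [hN, h1]
    exact (congrArg (fun D => tmap f (D u)) (derP_zero G 0)).trans (map_zero _)
  have hRf : ∀ u, R (tmap f u) = 0 := by
    intro u
    have := hQη (tmap f u)
    rw [hηf, hQf, hηf, hNf, map_zero, zero_add, zero_add] at this
    exact this.symm
  have hΘf : ∀ u, Θ (tmap f u) = 0 := fun u => by
    rw [Θap, weightInv_tmap hπf, Nat.cast_zero, inv_zero, zero_smul]
  set X : Module.End ℂ (TA V') := R.comp Θ with hX
  have Xap : ∀ t, X t = R (Θ t) := fun t => rfl
  have hRspan : ∀ {n : ℕ} {t : TA V'}, t ∈ wordSpan V' n → R t ∈ predSpan V' n := by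
    intro n t ht
    refine add_mem (quad_mem_wordSpan b' (der_mem_wordSpan _ _ ht)) ?_
    have h1 := quad_mem_wordSpan (G := G') b' ht
    match n, h1 with
    | 0, h1 =>
      have h1 : q t = 0 := h1
      rw [LinearMap.comp_apply, h1, map_zero]
      exact zero_mem _
    | n + 1, h1 => exact der_mem_wordSpan _ _ h1
  have hnil : ∀ t, ∃ k, (X ^ k) t = 0 := exists_pow_eq_zero
    (fun t ht => hRspan (weightInv_mem_wordSpan ht 0))
    (fun n t ht => hRspan (weightInv_mem_wordSpan ht 0))
  have hsurj : ∀ t, ∃ u, u + X u = t := fun t =>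
    (one_add_surjOn hnil ⊤ (fun _ _ => trivial) (t := t) trivial).imp fun u hu => hu.2
  set e : TA V' ≃ₗ[ℂ] TA V' := LinearEquiv.ofBijective (LinearMap.id + X)
    ⟨one_add_injective hnil, hsurj⟩ with he
  have eap : ∀ t, e t = t + X t := fun t => rfl
  -- This equation is forced: if `F` kills `N + R`, then composing with `Θ` shows that `F` of `t + X
  -- t` equals `F` of the projection of `t` to words in the image of `f`, where `F` is to be `pr₁`.
  obtain ⟨F, hF⟩ : ∃ F : TA V' →ₗ[ℂ] V, ∀ t, F (t + X t) = p (pr₁ t) :=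
    ⟨(p.comp pr₁).comp e.symm.toLinearMap, fun t => by
      rw [← eap]; simp⟩
  have hFf : ∀ u, F (tmap f u) = pr₁ u := by
    intro u
    have := hF (tmap f u)
    rwa [Xap, hΘf, map_zero, add_zero, pr₁_tmap, c.p_f] at this
  -- The choice `N t` in `hF` recovers `(N + R) t`, as `R` vanishes on words in the image of `f`;
  -- the right side is then zero because `p` kills the image of `π`.
  have hFM : ∀ t, F (Q (η t) + η (Q t)) = 0 := by
    intro t
    have h1 := hF (N t)
    rw [Xap, hΘN, map_sub, hRf, sub_zero, ← hQη] at h1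
    rw [h1]
    have : pr₁.comp N = π.comp pr₁ :=
      ta_cases_ext (by simp [hN]) fun x t => by simp [hN, der_mul, pr₁_mul, aug_der]
    rw [show pr₁ (N t) = π (pr₁ t) from DFunLike.congr_fun this t, hpπ]
  have hQQ : ∀ t, Q (Q t) = 0 := h'.codiff_codiff
  have hparη : ∀ t, par G' 1 (η t) = -η (par G' 1 t) := fun t => by
    rw [hη, hs.par_derP, mul_one, sgn_one, neg_one_smul]
  have hparq : ∀ t, par G' 1 (q t) = -q (par G' 1 t) := fun t => by
    rw [hq, h'.par_quad, sgn_one, neg_one_smul]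
  have hparQ : ∀ t, par G' 1 (Q t) = -Q (par G' 1 t) := fun t => by
    rw [hQ, h'.par_codiff, sgn_one, neg_one_smul]
  have hparX : ∀ t, par G' 1 (X t) = X (par G' 1 t) := by
    intro t
    rw [Xap, Xap, Rap, Rap, map_add, hparη, hparq, hparη, hparq, map_neg, map_neg, neg_neg, neg_neg,
      Θap, par_weightInv hπop, ← Θap]
  have hE : ∀ t, F (Q t) - d (F t) - (2⁻¹ : ℂ) • pairing b F (cop G' t) = 0 := by
    set E : TA V' →ₗ[ℂ] V := F.comp Q - d.comp F - (2⁻¹ : ℂ) • (pairing b F).comp (cop G') with hE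
    have Eap : ∀ t, E t = F (Q t) - d (F t) - (2⁻¹ : ℂ) • pairing b F (cop G' t) := fun t => rfl
    have hEf : ∀ u, E (tmap f u) = 0 := by
      intro u
      have h1 : pairing b F (cop G' (tmap f u)) = pairing b pr₁ (cop G u) := by
        rw [cop_tmap f c.op_f]
        induction cop G u using TensorProduct.induction_on with
        | zero => simp
        | add u v hu hv => simp only [map_add, hu, hv]
        | tmul s r => simp [hFf]
      rw [Eap, hQf, hFf, hFf, h1, h.pr₁_codiff_eq]
      abel
    -- The even operator `Qη + ηQ` commutes with `Q` and acts on a coproduct by the sum of its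
    -- actions on the two factors, so each term of the defect contains `F` applied to its image.
    have hEM : ∀ t, E (Q (η t) + η (Q t)) = 0 := by
      intro t
      have h1 : Q (Q (η t) + η (Q t)) = Q (η (Q t)) + η (Q (Q t)) := by
        rw [map_add, hQQ, hQQ, map_zero, zero_add, add_zero]
      have h2 : pairing b F (cop G' (Q (η t) + η (Q t))) = 0 := by
        rw [map_add, h'.cop_codiff, hs.cop_derP, hs.cop_derP, h'.cop_codiff]
        induction cop G' t using TensorProduct.induction_on with
        | zero => simp
        | add u v hu hv =>
          simp only [map_add] at hu hv ⊢
          rw [add_add_add_comm, hu, hv, add_zero]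
        | tmul s r =>
          simp only [ext₂_tmul, map_add, ← hQ, ← hη, par_one_par_one, hparη, hparQ,
            TensorProduct.neg_tmul, map_neg, pairing_tmul]
          have h3 := congrArg (fun v => b v (F r)) (hFM s)
          have h4 := congrArg (b (F s)) (hFM r)
          simp only [map_add, LinearMap.add_apply, map_zero, LinearMap.zero_apply] at h3 h4
          linear_combination (norm := module) h3 + h4
      rw [Eap, h1, hFM, hFM, h2, map_zero, smul_zero, sub_zero, sub_zero]
    intro t
    obtain ⟨u, rfl⟩ := hsurj t
    rw [← Eap]
    -- Every element is of the form `u + X u`, and this decomposition puts it into the sum of the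
    -- two subspaces on which the defect vanishes.
    have h1 : u + X u = (Q (η (Θ u)) + η (Q (Θ u))) + tmap f (tmap p u) := by
      rw [hQη, hNΘ, Xap]
      abel
    rw [h1, map_add, hEM, hEf, add_zero]
  refine ⟨F, ?_, fun v => ?_, fun t ht => ?_, fun t => ?_, fun t => ?_⟩
  · have := hFf 1
    rwa [map_one, pr₁_one] at this
  · have h1 := hF (lt v)
    -- There is no bracket of a single letter, so on letters `F` is unperturbed and equals `p`.
    have h2 : ∀ w, R (lt w) = 0 := by
      intro w
      have hq1 : ∀ w, q (lt w) = 0 := fun w => by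
        rw [← mul_one (lt w), hq, quad_mul, quad_one, mul_zero, add_zero]
        refine G'.hom_induction (C := fun w => adB G' b' w 1 = 0) (fun x y hx hy => ?_)
          (fun p x hx => ?_) w
        · rw [map_add, LinearMap.add_apply, hx, hy, add_zero]
        · rw [adB_of_mem G' b' hx, der_one]
      have hη1 : η (lt w) = lt (s w) := by
        have := der_mul (G'.op ^ (1 : ZMod 2).val) s w 1
        rwa [mul_one, der_one, mul_zero, mul_one, add_zero] at this
      rw [Rap, hq1, map_zero, hη1, hq1, add_zero]
    have h3 : Θ (lt v) = lt (π v) := by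
      have := weightInv_mul π v 1 0
      rw [Θap, ← mul_one (lt v), this]
      simp [weightInv_one]
    rwa [Xap, h3, h2, add_zero, pr₁_lt] at h1
  · have hXI : ∀ t ∈ comIdeal G', X t ∈ comIdeal G' := fun t ht => by
      have h1 := weightInv_mem (π := π) hπop ht 0
      exact add_mem (h'.quad_mem (hs.derP_mem h1)) (hs.derP_mem (h'.quad_mem h1))
    obtain ⟨u, hu, rfl⟩ := one_add_surjOn hnil (comIdeal G') hXI ht
    rw [hF, pr₁_comIdeal G' hu, map_zero]
  · obtain ⟨u, rfl⟩ := hsurj t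
    rw [map_add, hparX, hF, hF, pr₁_par, val_one_zmod2, pow_one, c.op_p]
  · rw [← sub_eq_zero, ← hE t]
    abel

end Transfer

/-! ## Quasi-isomorphisms of DG Lie algebras -/

section QuasiIso

variable {L H : Type*} [AddCommGroup L] [Module ℂ L] [AddCommGroup H] [Module ℂ H]
  {G₁ : SuperGrading L} {G₂ : SuperGrading H} {dL : L →ₗ[ℂ] L} {dH : H →ₗ[ℂ] H}
  {brL : L →ₗ[ℂ] L →ₗ[ℂ] L} {brH : H →ₗ[ℂ] H →ₗ[ℂ] H}

theorem lin_dgLieOps (G : SuperGrading L) (d : L →ₗ[ℂ] L) (br : L →ₗ[ℂ] L →ₗ[ℂ] L) :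
    lin (dgLieOps G d br 1) = d :=
  (MultilinearMap.ofSubsingleton ℂ L L 0).symm_apply_apply d

theorem lin_strictOps (f : L →ₗ[ℂ] H) : lin (strictOps f 1) = f :=
  (MultilinearMap.ofSubsingleton ℂ L H 0).symm_apply_apply f

/-- An injective morphism of DG Lie algebras with acyclic cokernel is a quasi-isomorphism, and there
is an `L∞`-quasi-isomorphism in the opposite direction. -/
theorem isLInfQuasiIso_strictOps (hL : DGLie G₁ dL brL) (hH : DGLie G₂ dH brH) {f : L →ₗ[ℂ] H}
    (hinj : Function.Injective f) (hop : ∀ x, f (G₁.op x) = G₂.op (f x))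
    (hd : ∀ x, f (dL x) = dH (f x)) (hbr : ∀ x y, f (brL x y) = brH (f x) (f y))
    (hac : ∀ x, dH x ∈ LinearMap.range f → ∃ y, x - dH y ∈ LinearMap.range f) :
    IsLInfQuasiIso G₁ G₂ (dgLieOps G₁ dL brL) (dgLieOps G₂ dH brH) (strictOps f) ∧
    ∃ F : Ops H L,
      IsLInfQuasiIso G₂ G₁ (dgLieOps G₂ dH brH) (dgLieOps G₁ dL brL) F := by
  have hodd : ∀ x, G₂.op (dH x) = -dH (G₂.op x) := fun x => by
    have := hH.oddLie.op_d x
    rw [SuperGrading.shift_op, SuperGrading.shift_op, map_neg, neg_neg] at this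
    rw [← this, neg_neg]
  obtain ⟨p, s, c⟩ := exists_contraction hinj hop hd hodd hH.d_d hac
  refine ⟨⟨hL.isLInfAlgebra, hH.isLInfAlgebra, isLInfMorphism_strictOps hL hop hd hbr, ?_⟩, ?_⟩
  · rw [lin_dgLieOps, lin_dgLieOps, lin_strictOps]
    exact c.cohomology_f
  · obtain ⟨φ, h1, h2, h3, h4, h5⟩ := hL.oddLie.exists_morphism hH.oddLie c.shift
      (fun x y => by simp [SuperGrading.shift_op, hbr, hop])
    have hrep : Represents φ fun n => φ.compMultilinearMap (TensorAlgebra.tprod ℂ H n) :=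
      fun n x => rfl
    refine ⟨fun n => φ.compMultilinearMap (TensorAlgebra.tprod ℂ H n), hH.isLInfAlgebra,
      hL.isLInfAlgebra, isLInfMorphism_of_represents hH hrep h1 h3 h4 h5, ?_⟩
    have hlin : lin (φ.compMultilinearMap (TensorAlgebra.tprod ℂ H 1)) = p := by
      ext x
      rw [← h2 x]
      change φ (TensorAlgebra.tprod ℂ H 1 fun _ => x) = _
      rw [tprod_succ, tprod_zero, mul_one]
    rw [lin_dgLieOps, lin_dgLieOps, hlin]
    exact c.cohomology_p

end QuasiIso

end MoritaLInf

end

noncomputable section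

namespace MoritaLInf

open TensorAlgebra

/-! ## The DG Lie algebra of coderivations -/

section CoderDGLie

variable {U : Type*} [AddCommGroup U] [Module ℂ U]

/-- An odd coderivation of square zero makes the coderivations into a DG Lie algebra. -/
theorem dgLie_coder (G : SuperGrading U) {Q : Coder U} (hQ : Q ∈ (coderGrading G).part 1)
    (hQQ : coderBracket G Q Q = 0) :
    DGLie (coderGrading G) (coderBracket G Q) (coderBracket G) where
  d_mem hx := bracket_mem G hQ hx
  d_d x := by
    refine (coderGrading G).hom_induction
      (C := fun x => coderBracket G Q (coderBracket G Q x) = 0) (fun x y hx hy => ?_)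
      (fun p x hx => ?_) x
    · rw [map_add, map_add, hx, hy, add_zero]
    -- For odd `Q` the Jacobi identity reads `[Q,[Q,x]] = [[Q,Q],x] - [Q,[Q,x]]`, hence twice the
    -- square of the differential is zero.
    · have h := bracket_jacobi G hQ hQ hx
      rw [hQQ, map_zero, LinearMap.zero_apply, zero_add, mul_one, sgn_one, neg_one_smul] at h
      have h2 : (2 : ℂ) • coderBracket G Q (coderBracket G Q x) = 0 := by
        linear_combination (norm := module) h
      exact (smul_eq_zero.1 h2).resolve_left two_ne_zero
  br_mem hx hy := bracket_mem G hx hy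
  skew hx hy := bracket_skew G hx hy
  leib hx hy := by
    rw [bracket_jacobi G hQ hx hy, one_mul]
  jac hx hy hz := bracket_jacobi G hx hy hz

end CoderDGLie

/-! ## Gradings of the algebras -/

section Algebras

variable (N n : ℕ)

theorem isAlgGrading_even (A : Type*) [Ring A] [Algebra ℂ A] :
    IsAlgGrading (SuperGrading.even A) := fun _ _ => rfl

theorem superMat_op (a : SuperMat N n) :
    (superMatGrading N n).op a = sigma N n * (a * sigma N n) := rfl

theorem isAlgGrading_superMat : IsAlgGrading (superMatGrading N n) := fun a b => by
  rw [superMat_op, superMat_op, superMat_op]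
  have : sigma N n * (a * sigma N n) * (sigma N n * (b * sigma N n))
      = sigma N n * a * (sigma N n * sigma N n) * b * sigma N n := by
    simp only [mul_assoc]
  rw [this, sigma_mul_sigma, mul_one]
  simp only [mul_assoc]

theorem superMat_op_smul_one (W : Poly N) :
    (superMatGrading N n).op (W • (1 : SuperMat N n)) = W • (1 : SuperMat N n) := by
  rw [superMat_op, smul_mul_assoc, one_mul, mul_smul_comm, sigma_mul_sigma]

variable {N n} {W : Poly N}

theorem dgLie_coderR (W : Poly N) : DGLie (coderGrading (gradR N))
    (coderBracket (gradR N) (codiffR W)) (coderBracket (gradR N)) :=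
  dgLie_coder _ (curvedCodiff_mem (isAlgGrading_even _) rfl)
    (curvedCodiff_bracket_self (isAlgGrading_even _) rfl fun a => mul_comm _ a)

theorem dgLie_coderA (D : MatrixFactorization W n) : DGLie (coderGrading (gradA D))
    (coderBracket (gradA D) (codiffA D)) (coderBracket (gradA D)) := by
  have h1 : (superMatGrading N n).op (-(W • (1 : SuperMat N n))) = -(W • (1 : SuperMat N n)) := by
    rw [map_neg, superMat_op_smul_one]
  refine dgLie_coder _ (curvedCodiff_mem (isAlgGrading_superMat N n) h1)
    (curvedCodiff_bracket_self (isAlgGrading_superMat N n) h1 fun a => ?_)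
  rw [neg_mul, mul_neg, smul_mul_assoc, one_mul, mul_smul_comm, mul_one]

end Algebras

end MoritaLInf

end

noncomputable section

namespace MoritaLInf

open TensorAlgebra

/-! ## The cotrace map on functionals -/

section Cotrace

variable {N n : ℕ}

/-- The signs on the diagonal of `σ`. -/
def sg : Fin n ⊕ Fin n → ℂ := Sum.elim (fun _ => 1) fun _ => -1

theorem sg_mul_self (k : Fin n ⊕ Fin n) : sg k * sg k = 1 := by
  cases k <;> simp [sg]

theorem sg_pow (k : Fin n ⊕ Fin n) (a b : ℕ) (h : (a : ZMod 2) = b) : sg k ^ a = sg k ^ b := by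
  have h1 := (ZMod.natCast_eq_natCast_iff a b 2).1 h
  rw [← Nat.mod_add_div a 2, ← Nat.mod_add_div b 2, h1, pow_add, pow_add, pow_mul, pow_mul, sq,
    sg_mul_self, one_pow, one_pow]

theorem sigma_mul_apply (a : SuperMat N n) (k l : Fin n ⊕ Fin n) :
    (sigma N n * a) k l = sg k • a k l := by
  rw [sigma, Matrix.diagonal_mul]
  cases k <;> simp [sg]

theorem mul_sigma_apply (a : SuperMat N n) (k l : Fin n ⊕ Fin n) :
    (a * sigma N n) k l = sg l • a k l := by
  rw [sigma, Matrix.mul_diagonal]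
  cases l <;> simp [sg]

theorem sigma_pow_mul_apply (m : ℕ) (a : SuperMat N n) (k l : Fin n ⊕ Fin n) :
    (sigma N n ^ m * a) k l = sg k ^ m • a k l := by
  induction m with
  | zero => simp
  | succ m ih => rw [pow_succ', mul_assoc, sigma_mul_apply, ih, smul_smul, pow_succ']

theorem superMat_op_apply (a : SuperMat N n) (k l : Fin n ⊕ Fin n) :
    (superMatGrading N n).op a k l = (sg k * sg l) • a k l := by
  rw [superMat_op, sigma_mul_apply, mul_sigma_apply, smul_smul]

/-- The matrix of letters `(σ a)_{kl}`. -/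
def letterMat (N n : ℕ) : SuperMat N n →ₗ[ℂ]
    Matrix (Fin n ⊕ Fin n) (Fin n ⊕ Fin n) (TA (Poly N)) where
  toFun a := Matrix.of fun k l => lt (sg k • a k l)
  map_add' a b := by ext k l; simp
  map_smul' c a := by ext k l; simp [smul_comm c]

/-- The product of the matrices of letters along a word. -/
def pathMat (N n : ℕ) :
    TA (SuperMat N n) →ₐ[ℂ] Matrix (Fin n ⊕ Fin n) (Fin n ⊕ Fin n) (TA (Poly N)) :=
  TensorAlgebra.lift ℂ (letterMat N n)

theorem pathMat_one (k l : Fin n ⊕ Fin n) :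
    pathMat N n 1 k l = if k = l then 1 else 0 := by
  rw [map_one, Matrix.one_apply]

theorem pathMat_mul (a : SuperMat N n) (t : TA (SuperMat N n)) (k l : Fin n ⊕ Fin n) :
    pathMat N n (lt a * t) k l = ∑ j, lt (sg k • a k j) * pathMat N n t j l := by
  rw [map_mul, Matrix.mul_apply, pathMat, TensorAlgebra.lift_ι_apply]
  rfl

theorem pathMat_lt (a : SuperMat N n) (k l : Fin n ⊕ Fin n) :
    pathMat N n (lt a) k l = lt (sg k • a k l) := by
  rw [pathMat, TensorAlgebra.lift_ι_apply]
  rfl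

/-- The linear map `t ↦ pathMat t k l`. -/
def pathEntry (k l : Fin n ⊕ Fin n) : TA (SuperMat N n) →ₗ[ℂ] TA (Poly N) :=
  (Matrix.entryLinearMap ℂ (TA (Poly N)) k l).comp (pathMat N n).toLinearMap

theorem pathEntry_apply (k l : Fin n ⊕ Fin n) (t : TA (SuperMat N n)) :
    pathEntry k l t = pathMat N n t k l := rfl

/-- The entry `(k, l)` as a linear map. -/
abbrev entry (k l : Fin n ⊕ Fin n) : SuperMat N n →ₗ[ℂ] Poly N :=
  Matrix.entryLinearMap ℂ (Poly N) k l

theorem pathMat_tprod (m : ℕ) (x : Fin m → SuperMat N n) (k l : Fin n ⊕ Fin n) :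
    pathMat N n (TensorAlgebra.tprod ℂ _ m x) k l
      = ∑ i : Fin (m + 1) → Fin n ⊕ Fin n, if i 0 = k ∧ i (Fin.last m) = l then
          TensorAlgebra.tprod ℂ (Poly N) m
            (fun t => sg (i t.castSucc) • x t (i t.castSucc) (i t.succ)) else 0 := by
  induction m generalizing k with
  | zero =>
    rw [tprod_zero, pathMat_one, ← (Equiv.funUnique (Fin 1) (Fin n ⊕ Fin n)).symm.sum_comp]
    simp only [tprod_zero]
    rw [Finset.sum_eq_single k]
    · simp
    · intro b _ hb
      simp [hb]
    · simp
  | succ m ih =>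
    rw [tprod_succ, pathMat_mul, ← (Fin.consEquiv fun _ => Fin n ⊕ Fin n).sum_comp,
      Fintype.sum_prod_type]
    have h0 : ∀ (j : Fin n ⊕ Fin n) (i : Fin (m + 1) → Fin n ⊕ Fin n),
        (Fin.consEquiv fun _ => Fin n ⊕ Fin n) (j, i) = (Fin.cons j i : Fin (m + 2) → _) :=
      fun j i => rfl
    simp only [h0, Fin.cons_zero, ← Fin.succ_last, Fin.cons_succ]
    symm
    refine (Finset.sum_eq_single k (fun j _ hj => Finset.sum_eq_zero fun i _ => ?_) (by simp)).trans ?_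
    · rw [if_neg fun h => hj h.1]
    · simp_rw [ih, Finset.mul_sum]
      rw [Finset.sum_comm]
      refine Finset.sum_congr rfl fun i _ => ?_
      symm
      refine (Finset.sum_eq_single (i 0) (fun j _ hj => ?_) (by simp)).trans ?_
      · rw [if_neg fun h => hj h.1.symm, mul_zero]
      · simp only [true_and]
        split_ifs with h
        · rw [tprod_succ]
          rfl
        · rw [mul_zero]

theorem gradR_op (r : Poly N) : (gradR N).op r = -r := rfl

/-- All of `R[1]` is odd, so a component of arity `m` has parity `m + 1`. Hence the parity of `Φ`
fixes the parity of its arities, and the sign `σ^{m+1}` becomes independent of `m`. -/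
theorem coderR_apply_eq_zero {q : ZMod 2} {Φ : Coder (Poly N)}
    (hΦ : Φ ∈ (coderGrading (gradR N)).part q) {m : ℕ} (hm : (m : ZMod 2) ≠ q + 1) : Φ m = 0 := by
  have h1 : (-1 : ℂ) * (-1) ^ m = -sgn q := by
    have : sgn (m : ZMod 2) = (-1) ^ m := by
      rw [sgn, ZMod.val_natCast, ← Nat.mod_add_div m 2, pow_add, pow_mul]
      simp
    rw [← this]
    rcases zmod2_cases q with rfl | rfl <;> rcases zmod2_cases (m : ZMod 2) with h | h <;>
      rw [h] at hm ⊢ <;> simp [one_add_one_zmod2] at hm ⊢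
  have h2 := congrArg (fun Ψ : Coder (Poly N) => Ψ m) ((coderGrading (gradR N)).op_of_mem hΦ)
  ext x : 1
  have h3 := congrArg (fun Ψ => Ψ x) h2
  have h4 : ((coderGrading (gradR N)).op Φ m) x = ((-1 : ℂ) * (-1) ^ m) • Φ m x := by
    have e : (fun i => (gradR N).op (x i)) = fun i => (-1 : ℂ) • x i := by
      funext i
      rw [gradR_op, neg_one_smul]
    have : ((coderGrading (gradR N)).op Φ m) x = (gradR N).op (Φ m fun i => (gradR N).op (x i)) := by
      simp [coderGrading, DirectSum.lmap_apply]
    rw [this, e, MultilinearMap.map_smul_univ, gradR_op, mul_smul, neg_one_smul]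
    simp
  have h5 : ((sgn q • Φ) m) x = sgn q • Φ m x := rfl
  simp only [h4, h5, h1] at h3
  have h6 : (2 * sgn q) • Φ m x = 0 := by
    linear_combination (norm := module) -h3
  exact (smul_eq_zero.1 h6).resolve_left (mul_ne_zero two_ne_zero (sgn_ne_zero q))

variable {W : Poly N} (D : MatrixFactorization W n)

/-- Each letter carries one factor `σ` in `pathMat`, the first letter included; the remaining factor
`σ^m` of the definition depends only on `q`, since nonzero components have `m` congruent to `q + 1`.
-/
theorem toFun_cotr {q : ZMod 2} {Φ : Coder (Poly N)} (hΦ : Φ ∈ (coderGrading (gradR N)).part q)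
    (t : TA (SuperMat N n)) (k l : Fin n ⊕ Fin n) :
    toFun (cotr D Φ) t k l = sg k ^ (q.val + 1) • toFun Φ (pathMat N n t k l) := by
  have : (entry k l).comp (toFun (cotr D Φ))
      = sg k ^ (q.val + 1) • (toFun Φ).comp (pathEntry k l) := by
    refine tprod_ext fun m x => ?_
    rw [LinearMap.comp_apply, toFun_tprod, LinearMap.smul_apply, LinearMap.comp_apply,
      pathEntry_apply, pathMat_tprod, map_sum, Finset.smul_sum, cotr, DirectSum.lmap_apply,
      cotrComp, LinearMap.sum_apply, sum_apply, map_sum]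
    refine Finset.sum_congr rfl fun i _ => ?_
    have h1 : ∀ r : Poly N, entry k l (Matrix.single (i 0) (i (Fin.last m)) r)
        = if i 0 = k ∧ i (Fin.last m) = l then r else 0 := fun r => by
      simp [Matrix.single_apply]
    refine (h1 _).trans ?_
    split_ifs with h
    · rw [toFun_tprod]
      by_cases hm : (m : ZMod 2) = q + 1
      · have h2 : (fun t : Fin m => cotrEntry m t (i t.castSucc) (i t.succ) (x t))
            = fun t => (if t.1 = 0 then sg k ^ m else 1) •
              (sg (i t.castSucc) • x t (i t.castSucc) (i t.succ)) := by
          funext t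
          change (sigma N n ^ _ * x t) _ _ = _
          rw [sigma_pow_mul_apply]
          split_ifs with ht
          · have : t.castSucc = 0 := Fin.ext ht
            rw [this, h.1, smul_smul, pow_succ]
          · rw [pow_one, one_smul]
        have h3 : (∏ t : Fin m, if t.1 = 0 then sg k ^ m else 1) = sg k ^ m := by
          cases m with
          | zero => simp
          | succ m => rw [Fin.prod_univ_succ]; simp
        change Φ m (fun t : Fin m => cotrEntry m t (i t.castSucc) (i t.succ) (x t)) = _
        rw [h2, MultilinearMap.map_smul_univ, h3, sg_pow k m (q.val + 1)]
        simp [hm]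
      · rw [coderR_apply_eq_zero hΦ hm]
        simp
    · simp
  exact DFunLike.congr_fun this t

/-! ### Compatibility with the extension of functionals to coderivations -/

/-- The matrix `Ψ` of functionals provides the generality needed for induction: after a letter `a`
has been read, the functional is shifted by combinations of the entries of `a` and need not have the
form of a cotrace. -/
theorem pathMat_front (φ : TA (SuperMat N n) →ₗ[ℂ] SuperMat N n)
    (Ψ : Fin n ⊕ Fin n → Fin n ⊕ Fin n → TA (Poly N) →ₗ[ℂ] Poly N)
    (h : ∀ t k l, φ t k l = ∑ j, Ψ k j (pathMat N n t j l)) (t : TA (SuperMat N n))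
    (k l : Fin n ⊕ Fin n) :
    pathMat N n (front LinearMap.id t φ) k l
      = ∑ j, sg k • front LinearMap.id (pathMat N n t j l) (Ψ k j) := by
  have hone : ∀ (φ : TA (SuperMat N n) →ₗ[ℂ] SuperMat N n)
      (Ψ : Fin n ⊕ Fin n → Fin n ⊕ Fin n → TA (Poly N) →ₗ[ℂ] Poly N),
      (∀ t k l, φ t k l = ∑ j, Ψ k j (pathMat N n t j l)) → ∀ k j, φ 1 k j = Ψ k j 1 := by
    intro φ Ψ h k j
    rw [h, Finset.sum_eq_single j]
    · rw [pathMat_one, if_pos rfl]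
    · intro i _ hi
      rw [pathMat_one, if_neg hi, map_zero]
    · simp
  refine ta_induction (C := fun t => ∀ (φ : TA (SuperMat N n) →ₗ[ℂ] SuperMat N n)
    (Ψ : Fin n ⊕ Fin n → Fin n ⊕ Fin n → TA (Poly N) →ₗ[ℂ] Poly N),
    (∀ t k l, φ t k l = ∑ j, Ψ k j (pathMat N n t j l)) →
    pathMat N n (front LinearMap.id t φ) k l
      = ∑ j, sg k • front LinearMap.id (pathMat N n t j l) (Ψ k j)) ?_ ?_ ?_ ?_ t φ Ψ h
  · intro φ Ψ h
    rw [front_one, LinearMap.id_apply, mul_one, pathMat_lt, hone φ Ψ h, Finset.sum_eq_single l]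
    · rw [pathMat_one, if_pos rfl, front_one, LinearMap.id_apply, mul_one, map_smul]
    · intro i _ hi
      rw [pathMat_one, if_neg hi, map_zero, LinearMap.zero_apply, smul_zero]
    · simp
  · intro s t hs ht φ Ψ h
    simp only [map_add, LinearMap.add_apply, Matrix.add_apply, hs φ Ψ h, ht φ Ψ h, smul_add,
      Finset.sum_add_distrib]
  · intro c t ht φ Ψ h
    simp only [map_smul, LinearMap.smul_apply, Matrix.smul_apply, ht φ Ψ h, Finset.smul_sum]
    exact Finset.sum_congr rfl fun j _ => smul_comm _ _ _
  · intro a t ht φ Ψ h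
    rw [front_mul, LinearMap.id_apply, map_add, Matrix.add_apply, pathMat_mul,
      ht (shiftBy φ a) (fun k j => ∑ i, shiftBy (Ψ k i) (sg i • a i j)) ?_]
    · simp only [hone φ Ψ h, pathMat_mul, map_sum, LinearMap.sum_apply, front_mul, smul_add,
        LinearMap.id_apply, Finset.mul_sum, Finset.smul_sum, Finset.sum_add_distrib]
      congr 1
      · refine Finset.sum_congr rfl fun j _ => Finset.sum_congr rfl fun i _ => ?_
        rw [map_smul (lt : Poly N →ₗ[ℂ] TA (Poly N)) (sg k), smul_mul_assoc]
      · exact Finset.sum_comm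
    · intro t k l
      simp only [LinearMap.comp_apply, LinearMap.mulLeft_apply, h, pathMat_mul, map_sum,
        LinearMap.sum_apply]
      exact Finset.sum_comm

theorem gradA_op_pow_apply (q : ZMod 2) (a : SuperMat N n) (k l : Fin n ⊕ Fin n) :
    (((superMatGrading N n).shift.op ^ q.val) a) k l
      = (sg k ^ q.val * sg l ^ q.val) • ((gradR N).op ^ q.val) (a k l) := by
  rcases zmod2_cases q with rfl | rfl
  · simp
  · rw [val_one_zmod2, pow_one, pow_one, pow_one, pow_one, SuperGrading.shift_op, Matrix.neg_apply,
      superMat_op_apply, gradR_op, smul_neg]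

/-- An index path through a word with one inserted value is an index path through the original word:
the cotrace already sums over the paths inside the arguments of `Φ`. The signs picked up by the
letters that are passed telescope along the path. -/
theorem pathMat_hat {q : ZMod 2} {Φ : Coder (Poly N)} (hΦ : Φ ∈ (coderGrading (gradR N)).part q)
    (t : TA (SuperMat N n)) (k l : Fin n ⊕ Fin n) :
    pathMat N n (hat ((gradA D).op ^ q.val) (toFun (cotr D Φ)) t) k l
      = sg k ^ q.val • hat ((gradR N).op ^ q.val) (toFun Φ) (pathMat N n t k l) := by
  have hss : ∀ k : Fin n ⊕ Fin n, sg k * sg k ^ (q.val + 1) = sg k ^ q.val := fun k => by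
    rw [pow_succ', ← mul_assoc, sg_mul_self, one_mul]
  have hfront : ∀ t k l, pathMat N n (front LinearMap.id t (toFun (cotr D Φ))) k l
      = sg k ^ q.val • front LinearMap.id (pathMat N n t k l) (toFun Φ) := by
    intro t k l
    rw [pathMat_front (toFun (cotr D Φ))
      (fun k j => if k = j then sg k ^ (q.val + 1) • toFun Φ else 0) (fun t k l => ?_) t k l]
    · rw [Finset.sum_eq_single k]
      · rw [if_pos rfl, map_smul, smul_smul, hss]
      · intro j _ hj
        rw [if_neg hj.symm, map_zero, smul_zero]
      · simp
    · rw [toFun_cotr D hΦ, Finset.sum_eq_single k]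
      · rw [if_pos rfl]; rfl
      · intro j _ hj
        rw [if_neg hj.symm, LinearMap.zero_apply]
      · simp
  refine ta_induction (C := fun t => ∀ k l,
    pathMat N n (hat ((gradA D).op ^ q.val) (toFun (cotr D Φ)) t) k l
      = sg k ^ q.val • hat ((gradR N).op ^ q.val) (toFun Φ) (pathMat N n t k l)) ?_ ?_ ?_ ?_ t k l
  · intro k l
    rw [hat_one, pathMat_lt, toFun_cotr D hΦ, smul_smul, hss, pathMat_one]
    split_ifs with h
    · rw [hat_one, map_smul]
    · simp
  · intro s t hs ht k l
    simp only [map_add, Matrix.add_apply, hs, ht, smul_add]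
  · intro c t ht k l
    simp only [map_smul, Matrix.smul_apply, ht]
    rw [smul_comm]
  · intro a t ht k l
    rw [hat_mul, map_add, Matrix.add_apply, hfront, pathMat_mul, pathMat_mul]
    simp only [map_sum, hat_mul, ht, Finset.sum_add_distrib, smul_add, Finset.smul_sum,
      LinearMap.sum_apply]
    congr 1
    refine Finset.sum_congr rfl fun j _ => ?_
    rw [gradA_op_pow_apply, map_smul, map_smul, map_smul ((gradR N).op ^ q.val), map_smul]
    simp only [smul_mul_assoc, mul_smul_comm, smul_smul]
    have h1 : sg j ^ q.val * sg j ^ q.val = 1 := by rw [← mul_pow, sg_mul_self, one_pow]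
    congr 1
    linear_combination (sg k * sg k ^ q.val) * h1

/-! ### The cotrace map is a morphism of DG Lie algebras -/

theorem pathMat_op (t : TA (SuperMat N n)) (k l : Fin n ⊕ Fin n) :
    pathMat N n (tmap (gradA D).op t) k l
      = (sg k * sg l) • tmap (gradR N).op (pathMat N n t k l) := by
  refine ta_induction (C := fun t => ∀ k, pathMat N n (tmap (gradA D).op t) k l
      = (sg k * sg l) • tmap (gradR N).op (pathMat N n t k l)) ?_ ?_ ?_ ?_ t k
  · intro k
    rw [map_one, pathMat_one]
    split_ifs with h
    · rw [h, sg_mul_self, map_one, one_smul]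
    · simp
  · intro s t hs ht k
    simp only [map_add, Matrix.add_apply, hs, ht, smul_add]
  · intro c t ht k
    simp only [map_smul, Matrix.smul_apply, ht]
    rw [smul_comm]
  · intro a t ht k
    rw [tmap_mul, pathMat_mul, pathMat_mul, map_sum, Finset.smul_sum]
    refine Finset.sum_congr rfl fun j _ => ?_
    have h1 := gradA_op_pow_apply 1 a k j
    rw [val_one_zmod2, pow_one, pow_one, pow_one, pow_one] at h1
    rw [h1, ht, tmap_mul]
    simp only [map_smul, smul_mul_assoc, mul_smul_comm, smul_smul]
    congr 1
    linear_combination (sg k * sg k * sg l) * sg_mul_self j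

theorem cotr_mem {q : ZMod 2} {Φ : Coder (Poly N)} (hΦ : Φ ∈ (coderGrading (gradR N)).part q) :
    cotr D Φ ∈ (coderGrading (gradA D)).part q := by
  refine mem_part_of_toFun _ fun t => ?_
  ext1 k l
  have h1 := gradA_op_pow_apply 1 (toFun (cotr D Φ) (tmap (gradA D).op t)) k l
  rw [val_one_zmod2, pow_one, pow_one, pow_one, pow_one] at h1
  have h2 := toFun_tmap (gradR N) hΦ 1 (pathMat N n t k l)
  rw [val_one_zmod2, pow_one, one_mul] at h2
  rw [h1, Matrix.smul_apply, toFun_cotr D hΦ, toFun_cotr D hΦ, pathMat_op]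
  have h3 : ∀ x, (gradR N).op ((gradR N).op x) = x := (gradR N).op_op
  simp only [map_smul, h2, h3, smul_smul]
  congr 1
  linear_combination (sg k ^ (q.val + 1) * sgn q) * (sg l * sg l * sg_mul_self k + sg_mul_self l)

theorem cotr_op (Φ : Coder (Poly N)) :
    cotr D ((coderGrading (gradR N)).op Φ) = (coderGrading (gradA D)).op (cotr D Φ) := by
  refine (coderGrading (gradR N)).hom_induction (C := fun Φ =>
    cotr D ((coderGrading (gradR N)).op Φ) = (coderGrading (gradA D)).op (cotr D Φ))
    (fun x y hx hy => by simp only [map_add, hx, hy]) (fun q x hx => ?_) Φ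
  rw [SuperGrading.op_of_mem _ hx, SuperGrading.op_of_mem _ (cotr_mem D hx), map_smul]

/-- Two applications of the path description: `pathMat_hat` moves the inner coderivation through the
paths and `toFun_cotr` evaluates the outer one. The exponents of the sign agree modulo two. -/
theorem cotr_circ {p q : ZMod 2} {Φ Ψ : Coder (Poly N)} (hΦ : Φ ∈ (coderGrading (gradR N)).part p)
    (hΨ : Ψ ∈ (coderGrading (gradR N)).part q) :
    cotr D (circ (gradR N) q Φ Ψ) = circ (gradA D) q (cotr D Φ) (cotr D Ψ) := by
  refine toFun_injective (LinearMap.ext fun t => ?_)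
  ext1 k l
  rw [toFun_cotr D (circ_mem _ hΦ hΨ), toFun_circ, toFun_circ, LinearMap.comp_apply,
    LinearMap.comp_apply, toFun_cotr D hΦ, pathMat_hat D hΨ, map_smul, smul_smul, ← pow_add,
    sg_pow k ((p + q).val + 1) (p.val + 1 + q.val)]
  simp only [Nat.cast_add, ZMod.natCast_val, ZMod.cast_id', id, Nat.cast_one]
  ring

theorem cotr_bracket (Φ Ψ : Coder (Poly N)) :
    cotr D (coderBracket (gradR N) Φ Ψ) = coderBracket (gradA D) (cotr D Φ) (cotr D Ψ) := by
  refine (coderGrading (gradR N)).hom_induction (C := fun Φ =>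
    cotr D (coderBracket (gradR N) Φ Ψ) = coderBracket (gradA D) (cotr D Φ) (cotr D Ψ))
    (fun x y hx hy => by simp only [map_add, LinearMap.add_apply, hx, hy]) (fun p Φ hΦ => ?_) Φ
  refine (coderGrading (gradR N)).hom_induction (C := fun Ψ =>
    cotr D (coderBracket (gradR N) Φ Ψ) = coderBracket (gradA D) (cotr D Φ) (cotr D Ψ))
    (fun x y hx hy => by simp only [map_add, hx, hy]) (fun q Ψ hΨ => ?_) Ψ
  rw [coderBracket_of_mem _ hΦ hΨ, coderBracket_of_mem _ (cotr_mem D hΦ) (cotr_mem D hΨ), map_sub,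
    map_smul, cotr_circ D hΦ hΨ, cotr_circ D hΨ hΦ]

theorem aug_pathMat (t : TA (SuperMat N n)) (k l : Fin n ⊕ Fin n) :
    TensorAlgebra.algebraMapInv (pathMat N n t k l)
      = if k = l then (TensorAlgebra.algebraMapInv t : ℂ) else 0 := by
  have : (TensorAlgebra.algebraMapInv (R := ℂ)).toLinearMap.comp (pathEntry k l)
      = (if k = l then 1 else 0 : ℂ) •
        (TensorAlgebra.algebraMapInv (R := ℂ) (M := SuperMat N n)).toLinearMap := by
    refine ta_cases_ext ?_ fun a t => ?_
    · rw [LinearMap.comp_apply, pathEntry_apply, pathMat_one]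
      split_ifs <;> simp
    · rw [LinearMap.comp_apply, pathEntry_apply, pathMat_mul, map_sum]
      simp only [AlgHom.toLinearMap_apply, aug_mul, LinearMap.smul_apply]
      simp
  refine (DFunLike.congr_fun this t).trans ?_
  split_ifs <;> simp

theorem pr₁_pathMat (t : TA (SuperMat N n)) (k l : Fin n ⊕ Fin n) :
    pr₁ (pathMat N n t k l) = sg k • pr₁ t k l := by
  have : pr₁.comp (pathEntry (N := N) k l) = sg k • (entry k l).comp pr₁ := by
    refine ta_cases_ext ?_ fun a t => ?_
    · rw [LinearMap.comp_apply, pathEntry_apply, pathMat_one]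
      split_ifs <;> simp
    · rw [LinearMap.comp_apply, pathEntry_apply, pathMat_mul, map_sum, Finset.sum_eq_single l]
      · rw [pr₁_mul, aug_pathMat, if_pos rfl, LinearMap.smul_apply, LinearMap.comp_apply, pr₁_mul,
          map_smul, smul_comm]
        rfl
      · intro j _ hj
        rw [pr₁_mul, aug_pathMat, if_neg hj, zero_smul]
      · simp
  exact DFunLike.congr_fun this t

theorem cotr_codiff (W' : Poly N) :
    cotr D (curvedCodiff (SuperGrading.even (Poly N)) W')
      = curvedCodiff (superMatGrading N n) (W' • (1 : SuperMat N n)) := by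
  have h := curvedCodiff_mem (c := W') (isAlgGrading_even (Poly N)) rfl
  refine toFun_injective (LinearMap.ext fun t => ?_)
  ext1 k l
  rw [toFun_cotr D h, val_one_zmod2, one_add_one_eq_two, sq, sg_mul_self, one_smul]
  have : (muFun (SuperGrading.even (Poly N)) W').comp (pathEntry k l)
      = (entry k l).comp (muFun (superMatGrading N n) (W' • (1 : SuperMat N n))) := by
    refine ta_cases_ext ?_ fun a t => ?_
    · rw [LinearMap.comp_apply, pathEntry_apply, pathMat_one, LinearMap.comp_apply, muFun_one]
      change _ = (W' • (1 : SuperMat N n)) k l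
      rw [Matrix.smul_apply, Matrix.one_apply]
      split_ifs <;> simp
    · rw [LinearMap.comp_apply, pathEntry_apply, pathMat_mul, map_sum, LinearMap.comp_apply,
        muFun_mul]
      change _ = ((superMatGrading N n).shift.op a * pr₁ t) k l
      rw [Matrix.mul_apply]
      refine Finset.sum_congr rfl fun j _ => ?_
      rw [muFun_mul, pr₁_pathMat, SuperGrading.shift_op, SuperGrading.shift_op, Matrix.neg_apply,
        superMat_op_apply, neg_mul, neg_mul]
      congr 1
      change (sg k • a k j) * _ = _
      rw [smul_mul_assoc, smul_mul_assoc, mul_smul_comm, smul_smul]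
  exact DFunLike.congr_fun this t

theorem cotr_codiffR : cotr D (codiffR W) = codiffA D := by
  rw [codiffR, cotr_codiff, codiffA, neg_smul]

/-! ### Restriction to a corner -/

/-- The embedding of `R` as a corner of the matrix algebra. -/
def corner (N : ℕ) {n : ℕ} (o : Fin n ⊕ Fin n) : Poly N →ₗ[ℂ] SuperMat N n :=
  Matrix.singleLinearMap ℂ o o

/-- The restriction of coderivations to a corner. -/
def restrictCorner (N : ℕ) {n : ℕ} (o : Fin n ⊕ Fin n) : Coder (SuperMat N n) →ₗ[ℂ] Coder (Poly N) :=
  DirectSum.lmap fun _ =>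
    ((entry o o).compMultilinearMapₗ ℂ).comp (MultilinearMap.compLinearMapₗ fun _ => corner N o)

theorem toFun_restrictCorner (o : Fin n ⊕ Fin n) (Φ : Coder (SuperMat N n)) (t : TA (Poly N)) :
    toFun (restrictCorner N o Φ) t = toFun Φ (tmap (corner N o) t) o o := by
  have : toFun (restrictCorner N o Φ)
      = (entry o o).comp ((toFun Φ).comp (tmap (corner N o)).toLinearMap) := by
    refine tprod_ext fun m x => ?_
    have h : (tmap (corner N o)) (TensorAlgebra.tprod ℂ (Poly N) m x)
        = TensorAlgebra.tprod ℂ _ m (fun i => corner N o (x i)) := by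
      rw [tprod_eq_word, tprod_eq_word, tmap_word, List.map_ofFn]
      rfl
    rw [toFun_tprod, LinearMap.comp_apply, LinearMap.comp_apply, AlgHom.toLinearMap_apply, h,
      toFun_tprod]
    simp [restrictCorner, DirectSum.lmap_apply]
  exact DFunLike.congr_fun this t

/-- A path of nonzero entries starting at `o` can never leave `o`, and no sign arises because `o` is
even. -/
theorem pathMat_corner {o : Fin n ⊕ Fin n} (ho : sg o = 1) (t : TA (Poly N)) (l : Fin n ⊕ Fin n) :
    pathMat N n (tmap (corner N o) t) o l = if o = l then t else 0 := by
  refine ta_induction (C := fun t => pathMat N n (tmap (corner N o) t) o l = if o = l then t else 0)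
    ?_ ?_ ?_ ?_ t
  · rw [map_one, pathMat_one]
  · intro s t hs ht
    rw [map_add, map_add, Matrix.add_apply, hs, ht]
    split_ifs <;> simp
  · intro c t ht
    rw [map_smul, map_smul, Matrix.smul_apply, ht]
    split_ifs <;> simp
  · intro r t ht
    have hc : ∀ j, corner N o r o j = if o = j then r else 0 := fun j => by
      simp [corner, Matrix.single_apply]
    rw [tmap_mul, pathMat_mul, Finset.sum_eq_single o]
    · rw [ht, hc, if_pos rfl, ho, one_smul]
      split_ifs <;> simp
    · intro j _ hj
      rw [hc, if_neg hj.symm, smul_zero, map_zero, zero_mul]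
    · simp

theorem restrictCorner_cotr {o : Fin n ⊕ Fin n} (ho : sg o = 1) (Φ : Coder (Poly N)) :
    restrictCorner N o (cotr D Φ) = Φ := by
  refine (coderGrading (gradR N)).hom_induction (C := fun Φ => restrictCorner N o (cotr D Φ) = Φ)
    (fun x y hx hy => by simp only [map_add, hx, hy]) (fun q Φ hΦ => ?_) Φ
  refine toFun_injective (LinearMap.ext fun t => ?_)
  rw [toFun_restrictCorner, toFun_cotr D hΦ, pathMat_corner ho, if_pos rfl, ho, one_pow, one_smul]

end Cotrace

end MoritaLInf

end

noncomputable section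

namespace MoritaLInf

open TensorAlgebra

/-! ## The bar differential of an algebra -/

section Bar

variable {A : Type*} [Ring A] [Algebra ℂ A] (G : SuperGrading A)

/-- Two linear maps agree if they agree on `1` and on products with a last letter. -/
theorem ta_cases_ext_right {V M : Type*} [AddCommGroup V] [Module ℂ V] [AddCommGroup M]
    [Module ℂ M] {f g : TA V →ₗ[ℂ] M} (one : f 1 = g 1)
    (mul : ∀ t x, f (t * lt x) = g (t * lt x)) : f = g := by
  refine word_ext fun l => ?_
  rcases List.eq_nil_or_concat l with rfl | ⟨l', x, rfl⟩
  · simpa using one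
  · rw [List.concat_eq_append, word_append, word_cons, word_nil, mul_one]
    exact mul _ _

theorem inFront_muFun_one (φ : TA A →ₗ[ℂ] A) : inFront (muFun G 0) φ 1 = 0 := by
  rw [inFront_apply, front_one, LinearMap.id_apply, mul_one, muFun_lt]

/-- Without curvature the product needs exactly two letters, the value of `φ` and one more. So `φ`
takes everything but the last letter. -/
theorem inFront_muFun_mul_lt (φ : TA A →ₗ[ℂ] A) (t : TA A) (x : A) :
    inFront (muFun G 0) φ (t * lt x) = G.shift.op (φ t) * x := by
  refine ta_induction (C := fun t => ∀ φ : TA A →ₗ[ℂ] A,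
    inFront (muFun G 0) φ (t * lt x) = G.shift.op (φ t) * x) ?_ ?_ ?_ ?_ t φ
  · intro φ
    rw [one_mul, ← mul_one (lt x), inFront_apply, front_mul, front_one, LinearMap.id_apply,
      LinearMap.id_apply, mul_one, map_add, mul_one, muFun_lt, add_zero, muFun_mul, pr₁_lt]
  · intro s t hs ht φ
    simp only [add_mul, map_add, hs, ht]
  · intro c t ht φ
    simp only [smul_mul_assoc, map_smul, ht]
  · intro y t ht φ
    rw [mul_assoc, inFront_apply, front_mul, map_add, ← inFront_apply, ht, LinearMap.id_apply,
      muFun_mul, pr₁_mul, map_mul, aug_lt, mul_zero, zero_smul, mul_zero, zero_add]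
    rfl

/-- The part of the differential of `φ` in which the first letter multiplies the value of `φ`. -/
def lead (p : ZMod 2) (φ : TA A →ₗ[ℂ] A) : TA A →ₗ[ℂ] A :=
  recL 0 ((LinearMap.lcomp ℂ A φ).comp
    ((LinearMap.mul ℂ A).comp (G.shift.op.comp (G.shift.op ^ p.val)))) 0

@[simp] theorem lead_one (p : ZMod 2) (φ : TA A →ₗ[ℂ] A) : lead G p φ 1 = 0 := recL_one _ _ _

theorem lead_mul (p : ZMod 2) (φ : TA A →ₗ[ℂ] A) (x : A) (t : TA A) :
    lead G p φ (lt x * t) = G.shift.op ((G.shift.op ^ p.val) x) * φ t := by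
  rw [lead, recL_mul]; simp

theorem muFun_hat_apply (p : ZMod 2) (φ : TA A →ₗ[ℂ] A) (t : TA A) :
    muFun G 0 (hat (G.shift.op ^ p.val) φ t) = inFront (muFun G 0) φ t + lead G p φ t := by
  have : (muFun G 0).comp (hat (G.shift.op ^ p.val) φ) = inFront (muFun G 0) φ + lead G p φ := by
    refine ta_cases_ext ?_ fun x t => ?_
    · simp [inFront_muFun_one]
    · rw [LinearMap.comp_apply, hat_mul, map_add, LinearMap.add_apply, lead_mul, muFun_mul G 0 _
        (hat _ _ _), pr₁_hat, inFront_apply]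
  exact DFunLike.congr_fun this t

/-- The bar differential. -/
abbrev bar : TA A →ₗ[ℂ] TA A := hat G.shift.op (muFun G 0)

/-- Multiplies the letter `x` with the first letter of a word. -/
def merge (x : A) : TA A →ₗ[ℂ] TA A :=
  recL 0 ((LinearMap.mul ℂ (TA A)).comp (lt.comp (LinearMap.mulLeft ℂ (G.shift.op x)))) 0

@[simp] theorem merge_one (x : A) : merge G x 1 = 0 := recL_one _ _ _

theorem merge_mul (x y : A) (t : TA A) :
    merge G x (lt y * t) = lt (G.shift.op x * y) * t := by
  rw [merge, recL_mul]; simp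

theorem bar_one : bar G 1 = 0 := by rw [hat_one, muFun_one, map_zero]

theorem bar_mul (x : A) (t : TA A) :
    bar G (lt x * t) = merge G x t + lt (G.shift.op x) * bar G t := by
  rw [hat_mul]
  congr 1
  have : ((front LinearMap.id).flip (muFun G 0)).comp (LinearMap.mulLeft ℂ (lt x)) = merge G x := by
    refine ta_cases_ext ?_ fun y t => ?_
    · simp [front_muFun_lt]
    · simp [front_muFun_mul_mul, merge_mul]
  exact DFunLike.congr_fun this t

/-- These are the three kinds of terms of the Hochschild differential: multiplication by the last
letter, multiplication by the first letter, and multiplication of neighbouring arguments. -/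
theorem toFun_bracket_curvedCodiff (hG : IsAlgGrading G) {p : ZMod 2} {Φ : Coder A}
    (hΦ : Φ ∈ (coderGrading G.shift).part p) (t : TA A) :
    toFun (coderBracket G.shift (curvedCodiff G 0) Φ) t
      = inFront (muFun G 0) (toFun Φ) t + lead G p (toFun Φ) t - sgn p • toFun Φ (bar G t) := by
  rw [toFun_bracket _ (curvedCodiff_mem hG (map_zero _)) hΦ, LinearMap.sub_apply,
    LinearMap.comp_apply, muFun_hat_apply, LinearMap.smul_apply, LinearMap.comp_apply, one_mul,
    val_one_zmod2, pow_one]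

end Bar

/-! ## The Morita homotopy -/

section Morita

variable {N n : ℕ}

/-- The signs by which the parity operator of `A[1]` acts on matrix units in the corner row. -/
def cs (i : Fin n ⊕ Fin n) : ℂ := -sg i

theorem cs_mul_self (k : Fin n ⊕ Fin n) : cs k * cs k = 1 := by
  rw [cs, neg_mul_neg, sg_mul_self]

theorem cs_corner {o : Fin n ⊕ Fin n} (ho : sg o = 1) : cs o = -1 := by rw [cs, ho]

theorem shift_op_apply (a : SuperMat N n) (k l : Fin n ⊕ Fin n) :
    (superMatGrading N n).shift.op a k l = -((cs k * cs l) • a k l) := by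
  rw [SuperGrading.shift_op, Matrix.neg_apply, superMat_op_apply, cs, cs, neg_mul_neg]

theorem shift_op_pow_apply (p : ZMod 2) (a : SuperMat N n) (k l : Fin n ⊕ Fin n) :
    (superMatGrading N n).shift.op (((superMatGrading N n).shift.op ^ p.val) a) k l
      = (-(cs k * cs l)) ^ (p.val + 1) • a k l := by
  rcases zmod2_cases p with rfl | rfl
  · simp [shift_op_apply]
  · rw [val_one_zmod2, pow_one, shift_op_apply, shift_op_apply, pow_add, pow_one, smul_neg, neg_neg,
      smul_smul, neg_mul_neg]

variable (o : Fin n ⊕ Fin n)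

/-- The letter of the corner given by the entry `(i, j)`. -/
def cornerEntry (i j : Fin n ⊕ Fin n) : SuperMat N n →ₗ[ℂ] SuperMat N n :=
  (cs i) • (corner N o).comp (entry i j)

theorem cornerEntry_apply (i j : Fin n ⊕ Fin n) (x : SuperMat N n) (k l : Fin n ⊕ Fin n) :
    cornerEntry o i j x k l = if k = o ∧ l = o then cs i • x i j else 0 := by
  simp only [cornerEntry, corner, LinearMap.smul_apply, LinearMap.comp_apply, Matrix.smul_apply,
    Matrix.singleLinearMap_apply, Matrix.single_apply, Matrix.entryLinearMap_apply]
  simp only [eq_comm (a := o)]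
  split_ifs <;> simp

/-- Inserts a matrix unit of the corner row into a word, at all positions, and contracts the letters
before it to letters of the corner. -/
def insertUnit : TA (SuperMat N n) →ₗ[ℂ] (Fin n ⊕ Fin n → TA (SuperMat N n)) :=
  recL (fun i => lt (Matrix.single o i 1))
    (LinearMap.mk₂ ℂ (fun x t i => lt (Matrix.single o i 1) * (lt x * t))
      (fun x y t => funext fun i => by simp [add_mul, mul_add]) (fun c x t => funext fun i => by simp)
      (fun x s t => funext fun i => by simp [mul_add]) (fun c x t => funext fun i => by simp))
    (LinearMap.mk₂ ℂ (fun x u i => ∑ j, lt (cornerEntry o i j x) * u j)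
      (fun x y t => funext fun i => by simp [add_mul, Finset.sum_add_distrib])
      (fun c x t => funext fun i => by simp [Finset.smul_sum])
      (fun x s t => funext fun i => by simp [mul_add, Finset.sum_add_distrib])
      (fun c x t => funext fun i => by simp [Finset.smul_sum]))

theorem insertUnit_one (i : Fin n ⊕ Fin n) :
    insertUnit (N := N) o 1 i = lt (Matrix.single o i 1) := by
  rw [insertUnit, recL_one]

theorem insertUnit_mul (x : SuperMat N n) (t : TA (SuperMat N n)) (i : Fin n ⊕ Fin n) :
    insertUnit o (lt x * t) i = lt (Matrix.single o i 1) * (lt x * t)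
      + ∑ j, lt (cornerEntry o i j x) * insertUnit o t j := by
  rw [insertUnit, recL_mul]
  rfl

variable {o}

theorem shift_op_unit (ho : sg o = 1) (i : Fin n ⊕ Fin n) :
    (superMatGrading N n).shift.op (Matrix.single o i 1) = cs i • Matrix.single o i (1 : Poly N) := by
  ext1 k l
  rw [shift_op_apply, Matrix.smul_apply, Matrix.single_apply]
  split_ifs with h
  · rw [← h.1, ← h.2, ← neg_smul]
    congr 1
    simp [cs_corner ho]
  · simp

theorem shift_op_cornerEntry (ho : sg o = 1) (i j : Fin n ⊕ Fin n) (x : SuperMat N n) :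
    (superMatGrading N n).shift.op (cornerEntry o i j x) = -cornerEntry o i j x := by
  ext1 k l
  rw [shift_op_apply, Matrix.neg_apply, cornerEntry_apply]
  split_ifs with h
  · rw [h.1, h.2]
    simp [cs_corner ho]
  · simp

theorem cornerEntry_shift_op (i j : Fin n ⊕ Fin n) (x : SuperMat N n) :
    cornerEntry o i j ((superMatGrading N n).shift.op x) = -((cs i * cs j) • cornerEntry o i j x) := by
  ext1 k l
  rw [Matrix.neg_apply, Matrix.smul_apply, cornerEntry_apply, cornerEntry_apply, shift_op_apply]
  split_ifs with h
  · rw [smul_neg, smul_comm]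
  · simp

/-- The products of letters in front of the inserted unit cancel. -/
theorem unit_mul_add_sum (ho : sg o = 1) (i : Fin n ⊕ Fin n) (x : SuperMat N n) :
    (superMatGrading N n).shift.op (Matrix.single o i 1) * x
      + ∑ j, (superMatGrading N n).shift.op (cornerEntry o i j x) * Matrix.single o j 1 = 0 := by
  simp only [shift_op_unit ho, shift_op_cornerEntry ho]
  ext1 k l
  rw [Matrix.add_apply, Matrix.sum_apply, Finset.sum_eq_single l]
  · rw [smul_mul_assoc, Matrix.smul_apply, neg_mul, Matrix.neg_apply, Matrix.mul_apply,
      Matrix.mul_apply, Finset.sum_eq_single i, Finset.sum_eq_single o]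
    · rw [cornerEntry_apply]
      simp only [Matrix.single_apply, eq_comm (a := o)]
      split_ifs <;> simp_all
    · intro j _ hj; simp [hj.symm]
    · simp
    · intro j _ hj; simp [hj.symm]
    · simp
  · intro j _ hj
    rw [Matrix.mul_apply]
    exact Finset.sum_eq_zero fun k _ => by simp [hj]
  · simp

/-- Corner letters multiply, summed over the middle index, as the entries of a matrix product do. -/
theorem sum_cornerEntry_mul (ho : sg o = 1) (i k : Fin n ⊕ Fin n) (x y : SuperMat N n) :
    ∑ j, (superMatGrading N n).shift.op (cornerEntry o i j x) * cornerEntry o j k y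
      = cs i • cornerEntry o i k ((superMatGrading N n).shift.op x * y) := by
  simp only [shift_op_cornerEntry ho]
  ext1 a b
  rw [Matrix.sum_apply, Matrix.smul_apply, cornerEntry_apply, Matrix.mul_apply]
  have h1 : ∀ j, (-cornerEntry o i j x * cornerEntry o j k y) a b
      = if a = o ∧ b = o then -((cs i * cs j) • (x i j * y j k)) else 0 := by
    intro j
    rw [neg_mul, Matrix.neg_apply, Matrix.mul_apply, Finset.sum_eq_single o]
    · rw [cornerEntry_apply, cornerEntry_apply]
      by_cases ha : a = o <;> by_cases hb : b = o <;> simp [ha, hb, smul_smul, mul_comm]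
    · intro c _ hc; simp [cornerEntry_apply, hc]
    · simp
  simp only [h1]
  split_ifs with h
  · rw [smul_smul, cs_mul_self, one_smul]
    refine Finset.sum_congr rfl fun j _ => ?_
    rw [shift_op_apply, neg_mul, smul_mul_assoc]
  · simp

/-- The product of the unit with the letter behind it cancels against that of the letter before it
with the unit, by `unit_mul_add_sum`. Products of two letters in front of the unit are handled by
`sum_cornerEntry_mul`, those behind it are unaffected. -/
theorem bar_insertUnit (ho : sg o = 1) (t : TA (SuperMat N n)) (i : Fin n ⊕ Fin n) :
    bar (superMatGrading N n) (insertUnit o t i)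
      = cs i • insertUnit o (bar (superMatGrading N n) t) i := by
  -- This collects the terms in which the first letter `x` or its contraction is multiplied with its
  -- right neighbour, together with the product of the unit and `x`.
  have key : ∀ (x : SuperMat N n) (u : TA (SuperMat N n)) (i : Fin n ⊕ Fin n),
      lt ((superMatGrading N n).shift.op (Matrix.single o i 1) * x) * u
        + cs i • (lt (Matrix.single o i 1) * merge (superMatGrading N n) x u)
        + ∑ j, merge (superMatGrading N n) (cornerEntry o i j x) (insertUnit o u j)
      = cs i • insertUnit o (merge (superMatGrading N n) x u) i := by
    intro x u i
    have hlt := fun u : TA (SuperMat N n) =>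
      congrArg (fun a => lt a * u) (unit_mul_add_sum (N := N) ho i x)
    simp only [map_add, map_sum, map_zero, add_mul, zero_mul, Finset.sum_mul] at hlt
    refine ta_induction (C := fun u =>
      lt ((superMatGrading N n).shift.op (Matrix.single o i 1) * x) * u
        + cs i • (lt (Matrix.single o i 1) * merge (superMatGrading N n) x u)
        + ∑ j, merge (superMatGrading N n) (cornerEntry o i j x) (insertUnit o u j)
      = cs i • insertUnit o (merge (superMatGrading N n) x u) i) ?_ ?_ ?_ ?_ u
    · have h1 := hlt 1
      simp only [mul_one] at h1
      have h2 : ∀ j, merge (superMatGrading N n) (cornerEntry o i j x) (insertUnit o 1 j)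
          = lt ((superMatGrading N n).shift.op (cornerEntry o i j x) * Matrix.single o j 1) := by
        intro j
        rw [insertUnit_one, ← mul_one (lt _), merge_mul, mul_one]
      simp only [h2, merge_one, mul_zero, smul_zero, add_zero, mul_one, h1, map_zero, Pi.zero_apply]
    · intro s t hs ht
      simp only [map_add, mul_add, smul_add, Pi.add_apply, Finset.sum_add_distrib, ← hs, ← ht]
      abel
    · intro c t ht
      simp only [map_smul, mul_smul_comm, Pi.smul_apply, ← Finset.smul_sum]
      rw [smul_comm (cs i) c, smul_comm (cs i) c, ← ht, smul_add, smul_add]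
    · intro y v _
      have h1 := hlt (lt y * v)
      have h2 : ∀ j, merge (superMatGrading N n) (cornerEntry o i j x) (insertUnit o (lt y * v) j)
          = lt ((superMatGrading N n).shift.op (cornerEntry o i j x) * Matrix.single o j 1)
              * (lt y * v)
            + ∑ k, lt ((superMatGrading N n).shift.op (cornerEntry o i j x) * cornerEntry o j k y)
              * insertUnit o v k := by
        intro j
        rw [insertUnit_mul, map_add, merge_mul, map_sum]
        simp only [merge_mul]
      have h3 : ∀ k, ∑ j, lt ((superMatGrading N n).shift.op (cornerEntry o i j x)
            * cornerEntry o j k y) * insertUnit o v k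
          = cs i • (lt (cornerEntry o i k ((superMatGrading N n).shift.op x * y))
            * insertUnit o v k) := by
        intro k
        rw [← Finset.sum_mul, ← map_sum, sum_cornerEntry_mul ho, map_smul, smul_mul_assoc]
      simp only [h2, Finset.sum_add_distrib]
      rw [Finset.sum_comm]
      simp only [h3, merge_mul, insertUnit_mul, smul_add, Finset.smul_sum]
      rw [← sub_eq_zero, ← h1]
      abel
  refine ta_induction (C := fun t => ∀ i, bar (superMatGrading N n) (insertUnit o t i)
      = cs i • insertUnit o (bar (superMatGrading N n) t) i) ?_ ?_ ?_ ?_ t i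
  · intro i
    rw [insertUnit_one, bar_one, map_zero, Pi.zero_apply, smul_zero, ← mul_one (lt _), bar_mul,
      merge_one, bar_one, mul_zero, add_zero]
  · intro s t hs ht i
    simp only [map_add, Pi.add_apply, hs, ht, smul_add]
  · intro c t ht i
    simp only [map_smul, Pi.smul_apply, ht]
    rw [smul_comm]
  · intro x u hu i
    have h1 := key x u i
    have h2 : ∀ j, lt (cornerEntry o i j ((superMatGrading N n).shift.op x))
        * insertUnit o (bar (superMatGrading N n) u) j
        = -((cs i * cs j) • (lt (cornerEntry o i j x)
          * insertUnit o (bar (superMatGrading N n) u) j)) := by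
      intro j
      rw [cornerEntry_shift_op, map_neg, map_smul, neg_mul, smul_mul_assoc]
    rw [insertUnit_mul, map_add, bar_mul, merge_mul, map_sum]
    simp only [bar_mul, hu, shift_op_unit ho, shift_op_cornerEntry ho, map_add, Pi.add_apply,
      insertUnit_mul, h2, Finset.sum_add_distrib, ← h1, map_neg, map_smul, smul_add, mul_add,
      neg_mul, smul_mul_assoc, mul_smul_comm, Finset.smul_sum, smul_neg, smul_smul]
    have h3 : ∀ j : Fin n ⊕ Fin n, cs i * (cs i * cs j) = cs j := fun j => by
      rw [← mul_assoc, cs_mul_self, one_mul]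
    simp only [h3]
    abel

end Morita

end MoritaLInf

end

noncomputable section

namespace MoritaLInf

open TensorAlgebra

/-! ## The homotopy on functionals -/

section Homotopy

variable {N n : ℕ} (o : Fin n ⊕ Fin n)

/-- The contraction of a functional of parity `p` with the inserted unit. -/
def contractUnit (p : ZMod 2) (φ : TA (SuperMat N n) →ₗ[ℂ] SuperMat N n) :
    TA (SuperMat N n) →ₗ[ℂ] SuperMat N n where
  toFun t := Matrix.of fun k l => cs k ^ p.val • φ (insertUnit o t k) o l
  map_add' s t := by ext1 k l; simp
  map_smul' c t := by ext1 k l; simp [smul_comm c]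

theorem contractUnit_apply (p : ZMod 2) (φ : TA (SuperMat N n) →ₗ[ℂ] SuperMat N n)
    (t : TA (SuperMat N n)) (k l : Fin n ⊕ Fin n) :
    contractUnit o p φ t k l = cs k ^ p.val • φ (insertUnit o t k) o l := rfl

/-- The word of letters of the corner on the entries of a product of letter matrices. -/
def cornerPath (t : TA (SuperMat N n)) (i j : Fin n ⊕ Fin n) : TA (SuperMat N n) :=
  tmap (corner N o) (tmap (gradR N).op (pathMat N n t i j))

theorem cornerPath_one (i j : Fin n ⊕ Fin n) :
    cornerPath (N := N) o 1 i j = if i = j then 1 else 0 := by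
  rw [cornerPath, pathMat_one]
  split_ifs <;> simp

theorem cornerPath_mul (x : SuperMat N n) (t : TA (SuperMat N n)) (i j : Fin n ⊕ Fin n) :
    cornerPath o (lt x * t) i j = ∑ k, lt (cornerEntry o i k x) * cornerPath o t k j := by
  rw [cornerPath, pathMat_mul, map_sum, map_sum]
  refine Finset.sum_congr rfl fun k _ => ?_
  rw [tmap_mul, tmap_mul, gradR_op, ← neg_smul]
  congr 2
  rw [cornerEntry, LinearMap.smul_apply, map_smul]
  rfl

theorem cornerPath_lt (x : SuperMat N n) (i j : Fin n ⊕ Fin n) :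
    cornerPath o (lt x) i j = lt (cornerEntry o i j x) := by
  rw [← mul_one (lt x), cornerPath_mul, Finset.sum_eq_single j]
  · rw [cornerPath_one, if_pos rfl, mul_one]
  · intro k _ hk
    rw [cornerPath_one, if_neg hk, mul_zero]
  · simp

/-- Relative to the last letter, the unit stands either before it or at the very end; in the latter
case all letters have been contracted to the corner. -/
theorem insertUnit_mul_lt (t : TA (SuperMat N n)) (x : SuperMat N n) (i : Fin n ⊕ Fin n) :
    insertUnit o (t * lt x) i = insertUnit o t i * lt x
      + ∑ j, cornerPath o (t * lt x) i j * lt (Matrix.single o j 1) := by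
  refine ta_induction (C := fun t => ∀ i, insertUnit o (t * lt x) i = insertUnit o t i * lt x
      + ∑ j, cornerPath o (t * lt x) i j * lt (Matrix.single o j 1)) ?_ ?_ ?_ ?_ t i
  · intro i
    rw [one_mul, ← mul_one (lt x), insertUnit_mul, mul_one]
    simp only [insertUnit_one, cornerPath_lt]
  · intro s t hs ht i
    simp only [add_mul, map_add, Pi.add_apply, hs, ht, cornerPath, Matrix.add_apply,
      Finset.sum_add_distrib]
    abel
  · intro c t ht i
    simp only [smul_mul_assoc, map_smul, Pi.smul_apply, ht, cornerPath, Matrix.smul_apply, smul_add,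
      Finset.smul_sum]
  · intro y t ht i
    rw [mul_assoc, insertUnit_mul, insertUnit_mul]
    simp only [ht, cornerPath_mul, mul_add, add_mul, Finset.sum_add_distrib, Finset.mul_sum,
      Finset.sum_mul, mul_assoc, add_assoc]
    congr 2
    exact Finset.sum_comm

variable {o}

theorem insertUnit_op (ho : sg o = 1) (t : TA (SuperMat N n)) (i : Fin n ⊕ Fin n) :
    insertUnit o (tmap (superMatGrading N n).shift.op t) i
      = cs i • tmap (superMatGrading N n).shift.op (insertUnit o t i) := by
  refine ta_induction (C := fun t => ∀ i, insertUnit o (tmap (superMatGrading N n).shift.op t) i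
      = cs i • tmap (superMatGrading N n).shift.op (insertUnit o t i)) ?_ ?_ ?_ ?_ t i
  · intro i
    rw [map_one, insertUnit_one, tmap_lt, shift_op_unit ho, map_smul, smul_smul, cs_mul_self,
      one_smul]
  · intro s t hs ht i
    simp only [map_add, Pi.add_apply, hs, ht, smul_add]
  · intro c t ht i
    simp only [map_smul, Pi.smul_apply, ht]
    rw [smul_comm]
  · intro x t ht i
    rw [tmap_mul, insertUnit_mul, insertUnit_mul, map_add, tmap_mul, tmap_mul, shift_op_unit ho,
      map_sum, smul_add, map_smul, smul_mul_assoc, smul_smul, cs_mul_self, one_smul,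
      Finset.smul_sum]
    congr 1
    refine Finset.sum_congr rfl fun j _ => ?_
    rw [ht, cornerEntry_shift_op, tmap_mul, shift_op_cornerEntry ho, map_neg, map_neg, map_smul,
      neg_mul, neg_mul, smul_mul_assoc, mul_smul_comm, smul_smul, mul_assoc, cs_mul_self, mul_one,
      smul_neg]

/-- Multiplications of neighbouring arguments drop out of the homotopy formula, since insertion
commutes with the bar differential up to the sign `cs k`. -/
theorem contractUnit_bar (ho : sg o = 1) (p : ZMod 2) (φ : TA (SuperMat N n) →ₗ[ℂ] SuperMat N n)
    (t : TA (SuperMat N n)) (k l : Fin n ⊕ Fin n) :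
    sgn (1 + p) • contractUnit o p φ (bar (superMatGrading N n) t) k l
      + cs k ^ (1 + p).val • sgn p • φ (bar (superMatGrading N n) (insertUnit o t k)) o l = 0 := by
  rw [bar_insertUnit ho, contractUnit_apply, map_smul, Matrix.smul_apply, smul_smul, smul_smul,
    smul_smul, ← add_smul]
  have h := cs_mul_self k
  have : sgn (1 + p) * cs k ^ p.val + cs k ^ (1 + p).val * sgn p * cs k = 0 := by
    rcases zmod2_cases p with rfl | rfl
    · simp [val_one_zmod2, h]
    · simp [val_one_zmod2, one_add_one_zmod2]
  rw [this, zero_smul]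

/-- Multiplications by the last letter cancel unless the unit is at the end. That case leaves a word
of corner letters, which is the composite of restriction and cotrace. -/
theorem inFront_contractUnit (ho : sg o = 1) (p : ZMod 2)
    (φ : TA (SuperMat N n) →ₗ[ℂ] SuperMat N n) (t : TA (SuperMat N n)) (k l : Fin n ⊕ Fin n) :
    inFront (muFun (superMatGrading N n) 0) (contractUnit o p φ) t k l
      + cs k ^ (1 + p).val • inFront (muFun (superMatGrading N n) 0) φ (insertUnit o t k) o l
      = -(cs k ^ (1 + p).val • φ (cornerPath o t k l) o o) := by
  have hrow : ∀ a : SuperMat N n, ∀ j,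
      ((superMatGrading N n).shift.op a * Matrix.single o j 1 : SuperMat N n) o l
        = if j = l then -(a o o) else 0 := by
    intro a j
    rw [Matrix.mul_apply, Finset.sum_eq_single o]
    · rw [shift_op_apply, cs_mul_self, one_smul, Matrix.single_apply]
      simp
    · intro b _ hb; simp [hb.symm]
    · simp
  let cp : TA (SuperMat N n) →ₗ[ℂ] TA (SuperMat N n) :=
    (tmap (corner N o)).toLinearMap.comp ((tmap (gradR N).op).toLinearMap.comp (pathEntry k l))
  let f : TA (SuperMat N n) →ₗ[ℂ] Poly N :=
    (entry k l).comp (inFront (muFun (superMatGrading N n) 0) (contractUnit o p φ))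
      + cs k ^ (1 + p).val • (entry o l).comp ((inFront (muFun (superMatGrading N n) 0) φ).comp
          ((LinearMap.proj k).comp (insertUnit o)))
  let g : TA (SuperMat N n) →ₗ[ℂ] Poly N :=
    -(cs k ^ (1 + p).val • (entry o o).comp (φ.comp cp))
  have : f = g := by
    refine ta_cases_ext_right ?_ fun t x => ?_
    · change inFront (muFun (superMatGrading N n) 0) (contractUnit o p φ) 1 k l
        + cs k ^ (1 + p).val • inFront (muFun (superMatGrading N n) 0) φ (insertUnit o 1 k) o l
        = -(cs k ^ (1 + p).val • φ (cornerPath o 1 k l) o o)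
      have h := inFront_muFun_mul_lt (superMatGrading N n) φ 1 (Matrix.single o k 1)
      rw [one_mul] at h
      rw [inFront_muFun_one, insertUnit_one, h, hrow, cornerPath_one]
      split_ifs <;> simp
    · change inFront (muFun (superMatGrading N n) 0) (contractUnit o p φ) (t * lt x) k l
        + cs k ^ (1 + p).val • inFront (muFun (superMatGrading N n) 0) φ
          (insertUnit o (t * lt x) k) o l
        = -(cs k ^ (1 + p).val • φ (cornerPath o (t * lt x) k l) o o)
      rw [insertUnit_mul_lt, map_add, map_sum, Matrix.add_apply, Matrix.sum_apply]
      simp only [inFront_muFun_mul_lt, hrow]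
      rw [Finset.sum_ite_eq' Finset.univ l, if_pos (Finset.mem_univ l), smul_add, ← add_assoc,
        smul_neg]
      refine (congrArg (· + _) ?_).trans (zero_add _)
      rw [Matrix.mul_apply, Matrix.mul_apply, Finset.smul_sum, ← Finset.sum_add_distrib]
      refine Finset.sum_eq_zero fun j _ => ?_
      rw [shift_op_apply, shift_op_apply, contractUnit_apply, cs_corner ho, neg_mul, neg_mul,
        smul_mul_assoc, smul_mul_assoc, smul_mul_assoc, smul_neg, smul_smul, smul_smul,
        ← neg_add, ← add_smul]
      have h := cs_mul_self k
      have : cs k * cs j * cs k ^ p.val + cs k ^ (1 + p).val * (-1 * cs j) = 0 := by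
        rcases zmod2_cases p with rfl | rfl
        · simp [val_one_zmod2]
        · simp only [val_one_zmod2, one_add_one_zmod2, ZMod.val_zero, pow_one, pow_zero]
          linear_combination cs j * h
      rw [this, zero_smul, neg_zero]
  exact DFunLike.congr_fun this t

/-- Multiplications by the first letter cancel unless the unit is at the beginning. That case
returns `φ`, the identity term of the homotopy. -/
theorem lead_contractUnit (ho : sg o = 1) (p : ZMod 2)
    (φ : TA (SuperMat N n) →ₗ[ℂ] SuperMat N n) (t : TA (SuperMat N n)) (k l : Fin n ⊕ Fin n) :
    lead (superMatGrading N n) (1 + p) (contractUnit o p φ) t k l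
      + cs k ^ (1 + p).val • lead (superMatGrading N n) p φ (insertUnit o t k) o l = φ t k l := by
  -- Left multiplication by `e_{ok}` moves row `k` to row `o`, where the entry is read off.
  have hunit : ∀ u : TA (SuperMat N n), cs k ^ (1 + p).val •
      lead (superMatGrading N n) p φ (lt (Matrix.single o k 1) * u) o l = φ u k l := by
    intro u
    rw [lead_mul, Matrix.mul_apply, Finset.sum_eq_single k]
    · rw [shift_op_pow_apply, Matrix.single_apply, if_pos ⟨rfl, rfl⟩, smul_mul_assoc, one_mul,
        smul_smul, cs_corner ho]
      have h := cs_mul_self k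
      have : cs k ^ (1 + p).val * (-(-1 * cs k)) ^ (p.val + 1) = 1 := by
        rcases zmod2_cases p with rfl | rfl
        · simp [val_one_zmod2, h]
        · simp only [val_one_zmod2, one_add_one_zmod2, ZMod.val_zero, pow_zero]
          linear_combination h
      rw [this, one_smul]
    · intro j _ hj
      rw [shift_op_pow_apply, Matrix.single_apply, if_neg fun h => hj h.2.symm, smul_zero, zero_mul]
    · simp
  let f : TA (SuperMat N n) →ₗ[ℂ] Poly N :=
    (entry k l).comp (lead (superMatGrading N n) (1 + p) (contractUnit o p φ))
      + cs k ^ (1 + p).val • (entry o l).comp ((lead (superMatGrading N n) p φ).comp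
          ((LinearMap.proj k).comp (insertUnit o)))
  have : f = (entry k l).comp φ := by
    refine ta_cases_ext ?_ fun x t => ?_
    · change lead (superMatGrading N n) (1 + p) (contractUnit o p φ) 1 k l
        + cs k ^ (1 + p).val • lead (superMatGrading N n) p φ (insertUnit o 1 k) o l = φ 1 k l
      rw [lead_one, insertUnit_one, ← mul_one (lt _), hunit, Matrix.zero_apply, zero_add]
    · change lead (superMatGrading N n) (1 + p) (contractUnit o p φ) (lt x * t) k l
        + cs k ^ (1 + p).val • lead (superMatGrading N n) p φ (insertUnit o (lt x * t) k) o l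
        = φ (lt x * t) k l
      rw [insertUnit_mul, map_add, Matrix.add_apply, smul_add, hunit, map_sum, Matrix.sum_apply,
        lead_mul, Matrix.mul_apply, ← add_assoc, add_right_comm, Finset.smul_sum,
        ← Finset.sum_add_distrib]
      refine (congrArg (· + _) (Finset.sum_eq_zero fun j _ => ?_)).trans (zero_add _)
      rw [lead_mul, Matrix.mul_apply, Finset.sum_eq_single o]
      · rw [shift_op_pow_apply, shift_op_pow_apply, contractUnit_apply, cornerEntry_apply,
          if_pos ⟨rfl, rfl⟩, cs_mul_self]
        simp only [smul_mul_assoc, mul_smul_comm, smul_smul, ← add_smul]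
        have h := cs_mul_self k
        have h' := cs_mul_self j
        refine (congrArg (· • _) ?_).trans (zero_smul ℂ _)
        rcases zmod2_cases p with rfl | rfl
        · simp only [val_one_zmod2, add_zero, ZMod.val_zero]
          linear_combination cs k * cs k * h'
        · simp only [val_one_zmod2, one_add_one_zmod2, ZMod.val_zero]
          linear_combination -cs k * h'
      · intro j' _ hj'
        rw [shift_op_pow_apply, cornerEntry_apply, if_neg fun h => hj' h.2, smul_zero, zero_mul]
      · simp
  exact DFunLike.congr_fun this t

end Homotopy

end MoritaLInf

end

noncomputable section

namespace MoritaLInf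

open TensorAlgebra

/-! ## Arities of coderivations -/

section Arity

variable {U : Type*} [AddCommGroup U] [Module ℂ U]

theorem lof_apply_same (m : ℕ) (φ : MultilinearMap ℂ (fun _ : Fin m => U) U) :
    DirectSum.lof ℂ ℕ (fun n => MultilinearMap ℂ (fun _ : Fin n => U) U) m φ m = φ := by
  rw [DirectSum.lof_eq_of]
  exact DirectSum.of_eq_same _ _

theorem lof_apply_ne {m k : ℕ} (φ : MultilinearMap ℂ (fun _ : Fin m => U) U) (h : k ≠ m) :
    DirectSum.lof ℂ ℕ (fun n => MultilinearMap ℂ (fun _ : Fin n => U) U) m φ k = 0 := by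
  rw [DirectSum.lof_eq_of]
  exact DirectSum.of_eq_of_ne _ _ _ h

theorem circ_apply_eq_zero (G : SuperGrading U) (q : ZMod 2) {Φ Ψ : Coder U} {k : ℕ}
    (h : ∀ a b, a + b = k + 1 → Φ a = 0 ∨ Ψ b = 0) : circ G q Φ Ψ k = 0 := by
  classical
  rw [← DirectSum.sum_support_of Φ, ← DirectSum.sum_support_of Ψ, map_sum, map_sum,
    DFinsupp.finsetSum_apply]
  refine Finset.sum_eq_zero fun b _ => ?_
  rw [LinearMap.sum_apply, DFinsupp.finsetSum_apply]
  refine Finset.sum_eq_zero fun a _ => ?_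
  rw [← DirectSum.lof_eq_of ℂ, ← DirectSum.lof_eq_of ℂ]
  by_cases hab : a + b = k + 1
  · rcases h a b hab with h | h <;> rw [h] <;> simp
  · match a, hab with
    | 0, _ => rw [circ_lof_zero]; rfl
    | m + 1, hab =>
      rw [circ_lof_lof, DFinsupp.finsetSum_apply]
      refine Finset.sum_eq_zero fun i _ => ?_
      exact lof_apply_ne _ (by omega)

theorem bracket_apply_eq_zero (G : SuperGrading U) {p q : ZMod 2} {Φ Ψ : Coder U}
    (hΦ : Φ ∈ (coderGrading G).part p) (hΨ : Ψ ∈ (coderGrading G).part q) {k : ℕ}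
    (h : ∀ a b, a + b = k + 1 → Φ a = 0 ∨ Ψ b = 0) : coderBracket G Φ Ψ k = 0 := by
  rw [coderBracket_of_mem G hΦ hΨ]
  have h1 := circ_apply_eq_zero G q h
  have h2 := circ_apply_eq_zero G p (Φ := Ψ) (Ψ := Φ) (k := k) fun a b hab =>
    (h b a (by omega)).symm
  change circ G q Φ Ψ k - sgn (p * q) • circ G p Ψ Φ k = 0
  rw [h1, h2, smul_zero, sub_zero]

theorem lof_mem {G : SuperGrading U} {p : ZMod 2} {Φ : Coder U} (hΦ : Φ ∈ (coderGrading G).part p)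
    (m : ℕ) : DirectSum.lof ℂ ℕ (fun n => MultilinearMap ℂ (fun _ : Fin n => U) U) m (Φ m)
      ∈ (coderGrading G).part p := by
  have h := congrArg (fun Ψ : Coder U => Ψ m) ((coderGrading G).op_of_mem hΦ)
  have h1 : (coderGrading G).op Φ m = ((G.op.compMultilinearMapₗ ℂ).comp
      (MultilinearMap.compLinearMapₗ fun _ => G.op)) (Φ m) := DirectSum.lmap_apply _ _ _
  rw [SuperGrading.mem_part]
  refine (DirectSum.lmap_lof _ _ _).trans ?_
  rw [← h1, ← map_smul]
  exact congrArg _ h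

theorem toFun_word_eq_zero {Φ : Coder U} {l : List U} (h : Φ l.length = 0) :
    toFun Φ (word l) = 0 := by
  have := toFun_tprod Φ l.length l.get
  rwa [tprod_eq_word, List.ofFn_get, h] at this

theorem exists_toFun_eq (φ : TA U →ₗ[ℂ] U) (m : ℕ)
    (h : ∀ l : List U, l.length ≠ m → φ (word l) = 0) :
    ∃ Φ : Coder U, toFun Φ = φ ∧ ∀ k, k ≠ m → Φ k = 0 := by
  refine ⟨DirectSum.lof ℂ ℕ (fun n => MultilinearMap ℂ (fun _ : Fin n => U) U) m
    (φ.compMultilinearMap (TensorAlgebra.tprod ℂ U m)), ?_, fun k hk => ?_⟩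
  · rw [toFun_lof]
    refine word_ext fun l => ?_
    by_cases hl : l.length = m
    · subst hl
      have := compFun_tprod l.length (φ.compMultilinearMap (TensorAlgebra.tprod ℂ U l.length))
        l.length l.get
      rw [dif_pos rfl, tprod_eq_word, List.ofFn_get] at this
      refine this.trans (congrArg φ ?_)
      change TensorAlgebra.tprod ℂ U l.length l.get = word l
      rw [tprod_eq_word, List.ofFn_get]
    · rw [compFun_word _ _ _ hl, h _ hl]
  · exact lof_apply_ne _ hk

theorem exists_arity_bound (Φ : Coder U) : ∃ m, ∀ k, m ≤ k → Φ k = 0 := by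
  classical
  refine ⟨(DFinsupp.support Φ).sup id + 1, fun k hk => ?_⟩
  by_contra h
  have := Finset.le_sup (f := id) (DFinsupp.mem_support_iff.2 h)
  simp only [id] at this
  omega

theorem curvedCodiff_apply_eq_zero {A : Type*} [Ring A] [Algebra ℂ A] (G : SuperGrading A) {k : ℕ}
    (h2 : k ≠ 2) : curvedCodiff G 0 k = 0 := by
  rw [curvedCodiff]
  have h1 : MultilinearMap.constOfIsEmpty ℂ (fun _ : Fin 0 => A) (0 : A) = 0 := rfl
  rw [h1, map_zero, zero_add]
  exact lof_apply_ne _ h2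

theorem curvature_apply_eq_zero {A : Type*} [Ring A] [Algebra ℂ A] (G : SuperGrading A) (c : A)
    {k : ℕ} (h : k ≠ 0) : (curvedCodiff G c - curvedCodiff G 0) k = 0 := by
  rw [curvedCodiff, curvedCodiff, add_sub_add_right_eq_sub, ← map_sub]
  exact lof_apply_ne _ h

end Arity

/-! ## Acyclicity of the cokernel of the cotrace map -/

section Acyclic

variable {N n : ℕ} {W : Poly N} (D : MatrixFactorization W n) {o : Fin n ⊕ Fin n}

theorem restrictCorner_mem {p : ZMod 2} {Φ : Coder (SuperMat N n)}
    (hΦ : Φ ∈ (coderGrading (superMatGrading N n).shift).part p) :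
    restrictCorner N o Φ ∈ (coderGrading (gradR N)).part p := by
  refine mem_part_of_toFun _ fun t => ?_
  have h1 : tmap (corner N o) (tmap (gradR N).op t)
      = tmap (superMatGrading N n).shift.op (tmap (corner N o) t) := by
    rw [tmap_tmap, tmap_tmap]
    congr 2
    refine LinearMap.ext fun r => ?_
    ext1 k l
    rw [LinearMap.comp_apply, LinearMap.comp_apply, shift_op_apply, gradR_op]
    simp only [corner, Matrix.singleLinearMap_apply, Matrix.single_apply]
    split_ifs with h
    · rw [← h.1, ← h.2, cs_mul_self, one_smul]
    · simp
  have h2 := toFun_tmap (superMatGrading N n).shift hΦ 1 (tmap (corner N o) t)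
  rw [val_one_zmod2, pow_one, one_mul] at h2
  rw [toFun_restrictCorner, toFun_restrictCorner, h1, h2, Matrix.smul_apply, shift_op_apply,
    cs_mul_self, one_smul, map_smul, gradR_op, neg_neg]

/-- The bracket with the product of the matrix algebra. -/
abbrev barDiff : Coder (SuperMat N n) →ₗ[ℂ] Coder (SuperMat N n) :=
  coderBracket (superMatGrading N n).shift (curvedCodiff (superMatGrading N n) 0)

theorem curvedCodiff_zero_mem : curvedCodiff (superMatGrading N n) 0
    ∈ (coderGrading (superMatGrading N n).shift).part 1 :=
  curvedCodiff_mem (isAlgGrading_superMat N n) (map_zero _)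

theorem barDiff_mem {p : ZMod 2} {X : Coder (SuperMat N n)}
    (hX : X ∈ (coderGrading (superMatGrading N n).shift).part p) :
    barDiff X ∈ (coderGrading (superMatGrading N n).shift).part (1 + p) :=
  bracket_mem _ curvedCodiff_zero_mem hX

theorem barDiff_barDiff (X : Coder (SuperMat N n)) : barDiff (barDiff X) = 0 :=
  (dgLie_coder _ curvedCodiff_zero_mem (curvedCodiff_bracket_self (isAlgGrading_superMat N n)
    (map_zero _) fun a => by rw [zero_mul, mul_zero])).d_d X

/-- The homotopy between the identity and the composite of the cotrace map with the restriction to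
a corner. -/
theorem homotopy_contractUnit (ho : sg o = 1) {p : ZMod 2} {X Y : Coder (SuperMat N n)}
    (hX : X ∈ (coderGrading (superMatGrading N n).shift).part p)
    (hY : Y ∈ (coderGrading (superMatGrading N n).shift).part (1 + p))
    (h : toFun Y = contractUnit o p (toFun X)) :
    toFun (barDiff Y) + contractUnit o (1 + p) (toFun (barDiff X))
      = toFun X - toFun (cotr D (restrictCorner N o X)) := by
  ext1 t
  ext1 k l
  have h1 := contractUnit_bar ho p (toFun X) t k l
  have h2 := inFront_contractUnit ho p (toFun X) t k l
  have h3 := lead_contractUnit ho p (toFun X) t k l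
  -- The corner path differs from the path by the parity operator on each letter; with `cs = -sg`
  -- this accounts for the two forms of the sign.
  have h4 : toFun (cotr D (restrictCorner N o X)) t k l
      = cs k ^ (1 + p).val • toFun X (cornerPath o t k l) o o := by
    have hm := restrictCorner_mem (o := o) hX
    have h5 := toFun_tmap (gradR N) hm 1 (pathMat N n t k l)
    rw [val_one_zmod2, pow_one, one_mul, toFun_restrictCorner, gradR_op] at h5
    rw [toFun_cotr D hm, cornerPath, h5, smul_neg, ← neg_smul, smul_smul]
    congr 1
    rcases zmod2_cases p with rfl | rfl
    · simp [val_one_zmod2, cs]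
    · simp [val_one_zmod2, one_add_one_zmod2, pow_succ, sg_mul_self]
  rw [LinearMap.add_apply, LinearMap.sub_apply, Matrix.add_apply, Matrix.sub_apply, h4,
    contractUnit_apply, toFun_bracket_curvedCodiff _ (isAlgGrading_superMat N n) hX,
    toFun_bracket_curvedCodiff _ (isAlgGrading_superMat N n) hY, h]
  simp only [Matrix.add_apply, Matrix.sub_apply, Matrix.smul_apply, smul_add, smul_sub]
  linear_combination (norm := module) h2 + h3 - h1

theorem contractUnit_mem (ho : sg o = 1) {p : ZMod 2} {X Y : Coder (SuperMat N n)}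
    (hX : X ∈ (coderGrading (superMatGrading N n).shift).part p)
    (h : toFun Y = contractUnit o p (toFun X)) :
    Y ∈ (coderGrading (superMatGrading N n).shift).part (1 + p) := by
  refine mem_part_of_toFun _ fun t => ?_
  ext1 k l
  have h2 := toFun_tmap (superMatGrading N n).shift hX 1 (insertUnit o t k)
  rw [val_one_zmod2, pow_one, one_mul] at h2
  rw [h, shift_op_apply, Matrix.smul_apply, contractUnit_apply, contractUnit_apply,
    insertUnit_op ho, map_smul, h2, Matrix.smul_apply, Matrix.smul_apply, shift_op_apply,
    cs_corner ho, sgn_add, sgn_one]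
  simp only [smul_smul, ← neg_smul]
  congr 1
  linear_combination (-(sgn p * cs k ^ p.val)) * (cs l * cs l * cs_mul_self k + cs_mul_self l)

/-- Inserting a unit lengthens words by one, so the homotopy lowers arity by one. Being concentrated
in one arity, the resulting functional comes from a coderivation. -/
theorem exists_contractUnit (p : ZMod 2) {X : Coder (SuperMat N n)} {m : ℕ}
    (hX : ∀ k, k ≠ m → X k = 0) : ∃ Y : Coder (SuperMat N n),
      toFun Y = contractUnit o p (toFun X) ∧ ∀ k, k + 1 ≠ m → Y k = 0 := by
  have hspan : ∀ {k : ℕ}, k ≠ m → ∀ t ∈ wordSpan (SuperMat N n) k, toFun X t = 0 := by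
    intro k hk t ht
    refine Submodule.span_induction (p := fun t _ => toFun X t = 0) ?_ (map_zero _) ?_ ?_ ht
    · rintro _ ⟨l, rfl, rfl⟩
      exact toFun_word_eq_zero (hX _ hk)
    · intro s t _ _ hs ht; rw [map_add, hs, ht, add_zero]
    · intro c t _ ht; rw [map_smul, ht, smul_zero]
  have hins : ∀ l : List (SuperMat N n), ∀ i,
      insertUnit o (word l) i ∈ wordSpan (SuperMat N n) (l.length + 1) := by
    intro l
    induction l with
    | nil =>
      intro i
      rw [word_nil, insertUnit_one]
      have := word_mem [Matrix.single o i (1 : Poly N)]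
      rwa [word_cons, word_nil, mul_one] at this
    | cons x l ih =>
      intro i
      rw [word_cons, insertUnit_mul, ← word_cons]
      exact add_mem (lt_mul_mem _ (word_mem (x :: l)))
        (Submodule.sum_mem _ fun j _ => lt_mul_mem _ (ih j))
  have hzero : ∀ l : List (SuperMat N n), l.length + 1 ≠ m →
      contractUnit o p (toFun X) (word l) = 0 := by
    intro l hl
    ext1 k j
    rw [contractUnit_apply, hspan hl _ (hins l k)]
    exact smul_zero _
  -- In arity zero the contracted functional is zero, as the inserted word is never empty.
  match m with
  | 0 =>
    refine ⟨0, ?_, fun _ _ => rfl⟩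
    rw [map_zero]
    exact word_ext fun l => (hzero l (by omega)).symm
  | m + 1 =>
    obtain ⟨Y, h1, h2⟩ := exists_toFun_eq (contractUnit o p (toFun X)) m
      fun l hl => hzero l (by omega)
    exact ⟨Y, h1, fun k hk => h2 k (by omega)⟩

theorem contractUnit_zero (p : ZMod 2) : contractUnit (N := N) o p 0 = 0 := by
  ext1 t
  ext1 k l
  exact smul_zero (cs k ^ p.val)

theorem one_add_one_add (p : ZMod 2) : 1 + (1 + p) = p := by
  rw [← add_assoc, one_add_one_zmod2, zero_add]

/-- The homotopy applied to `barDiff X` leaves an error `E`. Because `barDiff X` is a cotrace, on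
which restriction followed by `cotr` is the identity, `E` is a cycle; a second application of the
homotopy makes it a boundary modulo cotraces. -/
theorem exists_sub_barDiff (ho : sg o = 1) {p : ZMod 2} {X : Coder (SuperMat N n)} {m : ℕ}
    (hX : X ∈ (coderGrading (superMatGrading N n).shift).part p) (hm : ∀ k, k ≠ m → X k = 0)
    {Z : Coder (Poly N)} (hZ : barDiff X = cotr D Z) :
    ∃ Y ∈ (coderGrading (superMatGrading N n).shift).part (1 + p),
      (∀ k, k + 1 ≠ m → Y k = 0) ∧ ∃ U, X - barDiff Y = cotr D U := by
  have hdX : ∀ k, k ≠ m + 1 → barDiff X k = 0 := fun k hk =>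
    bracket_apply_eq_zero _ curvedCodiff_zero_mem hX fun a b hab => by
      by_cases ha : a = 2
      · exact Or.inr (hm b (by omega))
      · exact Or.inl (curvedCodiff_apply_eq_zero _ ha)
  obtain ⟨Y₁, hY₁, hk₁⟩ := exists_contractUnit (o := o) p hm
  obtain ⟨E, hE, hkE⟩ := exists_contractUnit (o := o) (1 + p) hdX
  have hEm := contractUnit_mem ho (barDiff_mem hX) hE
  have hEp : E ∈ (coderGrading (superMatGrading N n).shift).part p := by
    rwa [one_add_one_add] at hEm
  have hY₁m := contractUnit_mem ho hX hY₁
  have h1 := homotopy_contractUnit D ho hX hY₁m hY₁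
  have h2 := homotopy_contractUnit D ho (barDiff_mem hX) hEm hE
  rw [barDiff_barDiff, map_zero, contractUnit_zero, add_zero, hZ, restrictCorner_cotr D ho,
    sub_self, ← map_zero toFun] at h2
  have hdE : barDiff E = 0 := toFun_injective h2
  obtain ⟨Y₂, hY₂, hk₂⟩ := exists_contractUnit (o := o) p
    (X := E) (m := m) fun k hk => hkE k (by omega)
  have hY₂m := contractUnit_mem ho hEp hY₂
  have h3 := homotopy_contractUnit D ho hEp hY₂m hY₂
  rw [hdE, map_zero, contractUnit_zero, add_zero, ← map_sub] at h3
  rw [← hE, ← map_sub, ← map_add] at h1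
  have h1 := toFun_injective h1
  have h3 := toFun_injective h3
  refine ⟨Y₁ + Y₂, add_mem hY₁m hY₂m, fun k hk => ?_,
    restrictCorner N o X + restrictCorner N o E, ?_⟩
  · rw [DirectSum.add_apply, hk₁ k hk, hk₂ k hk, add_zero]
  · calc X - barDiff (Y₁ + Y₂) = X - (barDiff Y₁ + barDiff Y₂) := congrArg (X - ·) (map_add _ _ _)
      _ = (X - (barDiff Y₁ + E)) + (E - barDiff Y₂) := by abel
      _ = cotr D (restrictCorner N o X) + cotr D (restrictCorner N o E) := by
        rw [h1, h3, sub_sub_cancel, sub_sub_cancel]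
      _ = _ := (map_add _ _ _).symm

/-- Only the product can raise arity, so the top component of `Φ` is a cycle modulo cotraces for the
product alone. It is removed by `exists_sub_barDiff`, and what the curvature adds lies in lower
arity. -/
theorem exists_sub_bracket_of_mem (ho : sg o = 1) (m : ℕ) {p : ZMod 2} {Φ : Coder D.EndAlg}
    (hΦ : Φ ∈ (coderGrading (gradA D)).part p) (hm : ∀ k, m ≤ k → Φ k = 0)
    (h : coderBracket (gradA D) (codiffA D) Φ ∈ LinearMap.range (cotr D)) :
    ∃ Y, Φ - coderBracket (gradA D) (codiffA D) Y ∈ LinearMap.range (cotr D) := by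
  induction m generalizing Φ with
  | zero =>
    have : Φ = 0 := DFinsupp.ext fun k => hm k (Nat.zero_le k)
    exact ⟨0, by rw [this, map_zero, sub_zero]; exact zero_mem _⟩
  | succ m ih =>
    obtain ⟨Z, hZ⟩ := h
    set c : SuperMat N n := -(W • (1 : SuperMat N n)) with hc
    set Q₀ : Coder (SuperMat N n) := codiffA D - curvedCodiff (superMatGrading N n) 0 with hQ₀
    have hQ₀k : ∀ {k : ℕ}, k ≠ 0 → Q₀ k = 0 := fun hk => curvature_apply_eq_zero _ c hk
    have hQm : codiffA D ∈ (coderGrading (gradA D)).part 1 :=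
      curvedCodiff_mem (isAlgGrading_superMat N n) (by rw [map_neg, superMat_op_smul_one])
    have hQ₀m : Q₀ ∈ (coderGrading (gradA D)).part 1 := sub_mem hQm curvedCodiff_zero_mem
    have hsplit : ∀ Ψ, coderBracket (gradA D) (codiffA D) Ψ
        = barDiff Ψ + coderBracket (gradA D) Q₀ Ψ := fun Ψ => by
      rw [hQ₀, map_sub, LinearMap.sub_apply]
      abel
    set X := DirectSum.lof ℂ ℕ (fun n' => MultilinearMap ℂ (fun _ : Fin n' => SuperMat N n)
      (SuperMat N n)) m (Φ m) with hXdef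
    have hXm : X ∈ (coderGrading (gradA D)).part p := lof_mem hΦ m
    have hXk : ∀ k, k ≠ m → X k = 0 := fun k hk => lof_apply_ne _ hk
    have hXk' : X m = Φ m := lof_apply_same m _
    -- In arity `m + 1` the full differential of `Φ` sees only the product applied to the top
    -- component, so the corresponding component of `Z` provides the preimage.
    have hdX : barDiff X = cotr D (DirectSum.lof ℂ ℕ
        (fun n' => MultilinearMap ℂ (fun _ : Fin n' => Poly N) (Poly N)) (m + 1) (Z (m + 1))) := by
      refine Eq.trans ?_ (DirectSum.lmap_lof _ _ _).symm
      have hZm : cotrComp N n (m + 1) (Z (m + 1)) = cotr D Z (m + 1) :=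
        (DirectSum.lmap_apply _ _ _).symm
      rw [hZm, hZ]
      refine DFinsupp.ext fun k => ?_
      by_cases hk : k = m + 1
      · subst hk
        refine Eq.trans ?_ (lof_apply_same (m + 1) _).symm
        rw [hsplit]
        have h1 : barDiff (Φ - X) (m + 1) = 0 :=
          bracket_apply_eq_zero _ curvedCodiff_zero_mem (sub_mem hΦ hXm) fun a b hab => by
            by_cases ha : a = 2
            · obtain rfl : b = m := by omega
              exact Or.inr ((congrArg (Φ b - ·) hXk').trans (sub_self _))
            · exact Or.inl (curvedCodiff_apply_eq_zero _ ha)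
        have h2 : coderBracket (gradA D) Q₀ Φ (m + 1) = 0 :=
          bracket_apply_eq_zero _ hQ₀m hΦ fun a b hab => by
            by_cases ha : a = 0
            · exact Or.inr (hm b (by omega))
            · exact Or.inl (hQ₀k ha)
        rw [map_sub] at h1
        change barDiff X (m + 1) = barDiff Φ (m + 1) + coderBracket (gradA D) Q₀ Φ (m + 1)
        rw [h2, add_zero]
        exact (sub_eq_zero.1 h1).symm
      · have h1 : barDiff X k = 0 :=
          bracket_apply_eq_zero _ curvedCodiff_zero_mem hXm fun a b hab => by
            by_cases ha : a = 2
            · exact Or.inr (hXk b (by omega))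
            · exact Or.inl (curvedCodiff_apply_eq_zero _ ha)
        exact h1.trans (lof_apply_ne _ hk).symm
    obtain ⟨Y, hYm, hYk, V, hV⟩ := exists_sub_barDiff D ho hXm hXk hdX
    have hVm : cotr D V ∈ (coderGrading (gradA D)).part p := by
      rw [← hV]
      refine sub_mem hXm ?_
      have := barDiff_mem hYm
      rwa [one_add_one_add] at this
    have hdYm : coderBracket (gradA D) (codiffA D) Y ∈ (coderGrading (gradA D)).part p := by
      have := bracket_mem (gradA D) hQm hYm
      rwa [one_add_one_add] at this
    -- `Y` lives in arity `m - 1`; its bracket with the curvature is of arity below `m`, and in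
    -- arity `m` the product part cancels the top component.
    have hvanish : ∀ k, m ≤ k →
        (Φ - coderBracket (gradA D) (codiffA D) Y - cotr D V) k = 0 := by
      intro k hk
      rw [hsplit, ← hV]
      have h1 : coderBracket (gradA D) Q₀ Y k = 0 :=
        bracket_apply_eq_zero _ hQ₀m hYm fun a b hab => by
          by_cases ha : a = 0
          · exact Or.inr (hYk b (by omega))
          · exact Or.inl (hQ₀k ha)
      have h2 : X k = Φ k := by
        rcases hk.eq_or_lt with rfl | hk
        · exact hXk'
        · rw [hXk k (by omega), hm k (by omega)]
      change Φ k - (barDiff Y k + coderBracket (gradA D) Q₀ Y k) - (X k - barDiff Y k) = 0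
      rw [h1, h2]
      abel
    have hrange : coderBracket (gradA D) (codiffA D)
        (Φ - coderBracket (gradA D) (codiffA D) Y - cotr D V) ∈ LinearMap.range (cotr D) :=
      ⟨Z - coderBracket (gradR N) (codiffR W) V, by
        rw [map_sub, map_sub, map_sub, cotr_bracket, cotr_codiffR, hZ, (dgLie_coderA D).d_d,
          sub_zero]⟩
    obtain ⟨Y', T, hT⟩ := ih (sub_mem (sub_mem hΦ hdYm) hVm) hvanish hrange
    refine ⟨Y + Y', T + V, ?_⟩
    rw [map_add, map_add, hT]
    abel

/-- The cokernel of the cotrace map is acyclic. -/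
theorem exists_sub_bracket (ho : sg o = 1) (Φ : Coder D.EndAlg)
    (h : coderBracket (gradA D) (codiffA D) Φ ∈ LinearMap.range (cotr D)) :
    ∃ Y, Φ - coderBracket (gradA D) (codiffA D) Y ∈ LinearMap.range (cotr D) := by
  have hq : ∀ q, ∃ Y, (coderGrading (gradA D)).proj q Φ - coderBracket (gradA D) (codiffA D) Y
      ∈ LinearMap.range (cotr D) := by
    intro q
    obtain ⟨m, hm⟩ := exists_arity_bound ((coderGrading (gradA D)).proj q Φ)
    refine exists_sub_bracket_of_mem D ho m ((coderGrading (gradA D)).proj_mem q Φ) hm ?_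
    obtain ⟨Z, hZ⟩ := h
    have h1 := (dgLie_coderA D).oddLie.op_d Φ
    rw [SuperGrading.shift_op, SuperGrading.shift_op, map_neg, neg_neg] at h1
    -- The differential is odd and `cotr` is even, so the differential of the parity `q` part comes
    -- from the part of `Z` of opposite parity, whence the minus sign.
    refine ⟨(2⁻¹ : ℂ) • (Z - sgn q • (coderGrading (gradR N)).op Z), ?_⟩
    rw [SuperGrading.proj_apply, map_smul, map_smul, map_sub, map_add, map_smul, map_smul, ← h1,
      cotr_op, hZ, smul_neg, sub_eq_add_neg]
  obtain ⟨Y₀, T₀, h₀⟩ := hq 0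
  obtain ⟨Y₁, T₁, h₁⟩ := hq 1
  refine ⟨Y₀ + Y₁, T₀ + T₁, ?_⟩
  rw [map_add, map_add, h₀, h₁]
  nth_rewrite 3 [← (coderGrading (gradA D)).proj_zero_add_proj_one Φ]
  abel

theorem exists_even_index (D : MatrixFactorization W n) : ∃ o : Fin n ⊕ Fin n, sg o = 1 :=
  ⟨Sum.inl ⟨0, D.size_pos⟩, rfl⟩

end Acyclic

end MoritaLInf

end

open MoritaLInf in
theorem lemma3p3 (N n : ℕ) (W : Poly N) (D : MatrixFactorization W n) :
    -- `cotr` is a morphism of graded Lie algebras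
    (∀ (p : ZMod 2) (Φ : Coder (Poly N)), Φ ∈ (coderGrading (gradR N)).part p →
      cotr D Φ ∈ (coderGrading (gradA D)).part p) ∧
    (∀ Φ Ψ : Coder (Poly N),
      cotr D (coderBracket (gradR N) Φ Ψ) = coderBracket (gradA D) (cotr D Φ) (cotr D Ψ)) ∧
    -- it carries the codifferential of `R` to that of `A`
    cotr D (codiffR W) = codiffA D ∧
    -- it is the linear part of an `L∞`-quasi-isomorphism without higher components
    IsLInfQuasiIso (coderGrading (gradR N)) (coderGrading (gradA D))
      (coderOps (gradR N) (codiffR W)) (coderOps (gradA D) (codiffA D)) (strictOps (cotr D)) ∧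
    -- there is an `L∞`-quasi-isomorphism in the opposite direction
    ∃ F : Ops (Coder D.EndAlg) (Coder (Poly N)),
      IsLInfQuasiIso (coderGrading (gradA D)) (coderGrading (gradR N))
        (coderOps (gradA D) (codiffA D)) (coderOps (gradR N) (codiffR W)) F := by
  -- An even index, whose corner gives the sign-free left inverse of `cotr`, exists because the size
  -- is positive.
  obtain ⟨o, ho⟩ := exists_even_index D
  refine ⟨fun p Φ h => cotr_mem D h, cotr_bracket D, cotr_codiffR D, ?_⟩
  exact isLInfQuasiIso_strictOps (dgLie_coderR W) (dgLie_coderA D)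
    (Function.LeftInverse.injective (restrictCorner_cotr D ho)) (cotr_op D)
    (fun x => by rw [cotr_bracket, cotr_codiffR]) (cotr_bracket D) (exists_sub_bracket D ho)
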